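/- **Setting.** A *linear network* is a finite directed network with an origin $s$, a destination $t$ and a latency function $c_e(x)=a_e x$, $a_e>0$, on each edge $e$. A subnetwork $H$ is obtained by deleting edges. A flow of rate $r>0$ in $H$ assigns nonnegative amounts $f_p$ with $\sum_p f_p=r$ to the simple $s$-$t$ paths $p$ of $H$; $f_e=\sum_{p\ni e}f_p$; the bottleneck cost of a path is $b_p(f)=\max_{e\in p}c_e(f_e)$, and that of the flow is $B(f)=\max_{p:f_p>0}b_p(f)$. The flow is a Nash flow of $H$ if $f_p>0$ implies $b_p(f)\le b_{p'}(f)$ for all simple $s$-$t$ paths $p,p'$ of $H$. $B^*(G,r)$ is the minimum bottleneck cost of a flow of rate $r$ in $G$, and $B(H,r)$ is the maximum bottleneck cost of a Nash flow of rate $r$ in $H$ ($B(H,r)=\infty$ if $H$ has no $s$-$t$ path). A 2DDP instance $I=(D,s_1,s_2,t_1,t_2)$ is a finite directed network $D$ with four distinct vertices. It is a YES-instance if $D$ has vertex-disjoint $s_1$-$t_1$ and $s_2$-$t_2$ paths, and a NO-instance otherwise. A subnetwork of $D$ is *good* if in it each of $s_1,s_2$ reaches $t_1$ or $t_2$, each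 of $t_1,t_2$ is reached from $s_1$ or $s_2$, and there is no $s_1$-$t_2$ path or no $s_2$-$t_1$ path. Let $0<\gamma_2<\gamma_1$. A linear network $G$ with a designated family of copies of (subnetworks of) $D$ inside it, at least one of them a copy of all of $D$, is a *$\gamma_1/\gamma_2$-gap instance based on $I$* if for every $r>0$: $B^*(G,r)=r/\gamma_1$; (1) if $I$ is a YES-instance, some subnetwork $H$ of $G$ has $B(H,r)=r/\gamma_1$; (2) if $I$ is a NO-instance, every subnetwork $H'$ of $G$ has $B(H',r)\ge r/\gamma_2$; (3) for every subnetwork $H'$ of $G$, either $H'$ contains a copy of a good subnetwork of $D$ (that is, for some designated copy, the part of $D$ whose copy is retained in $H'$ is good), or $B(H',r)\ge r/\gamma_2$. **Construction.** Given $I$, $G$ and $\varepsilon>0$, let $G'$ consist of $D$, four new vertices $s,t,u,v$ ($s$ the origin, $t$ the destination), the edge $e_2=(u,v)$ with latency $\varepsilon x$, latency $\varepsilon x$ on each edge of $D$, and, instead of each of the external edges $e_1=(s,u)$, $e_3=(v,t)$, $e_4=(s,v)$, $e_5=(v,s_1)$, $e_6=(s,s_2)$, $e_7=(t_1,u)$,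 $e_8=(u,t)$, $e_9=(t_2,t)$, a copy of $G$ whose origin and destination are the tail and the head of that edge, without the edges of $G$ that enter its origin or leave its destination. The latencies in the copies replacing $e_1$ and $e_3$ are halved. The designated copies of $D$ in $G'$ are the initial $D$ and the images of the designated copies in the eight copies of $G$. **Lemma.** Let $I=(D,s_1,s_2,t_1,t_2)$ be a 2DDP instance such that $D$ contains edge-disjoint $s_1$-$t_2$ and $s_2$-$t_1$ paths, and let $G$ be a $\gamma_1/\gamma_2$-gap instance based on $I$. For every $\varepsilon\in(0,\frac1{4\gamma_1})$, the network $G'$ is a $4\gamma_1/(3\gamma_2)$-gap instance based on $I$ with constants $4\gamma_1$ and $3\gamma_2$; that is, for every $r>0$, $B^*(G',r)=r/(4\gamma_1)$, and 1. if $I$ is a YES-instance, there is a subnetwork $H$ of $G'$ with $B(H,r)=r/(4\gamma_1)$; 2. if $I$ is a NO-instance, $B(H',r)\ge r/(3\gamma_2)$ for every subnetwork $H'$ of $G'$; 3. every subnetwork $H'$ of $G'$ either contains a copy of a good subnetwork of $D$ or has $B(H',r)\ge r/(3\gamma_2)$. Moreover, there is a single polynomial-time algorithm (a Turing machine) that,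 for all such $I$ and $G$ with rational latency coefficients written in binary, constructs from $I$ and $G$ alone the network $G'$ for some $\varepsilon\in(0,\frac1{4\gamma_1})$. -/

import Mathlib

open scoped NNReal

noncomputable section

/-! ### Directed networks and simple paths -/

/-- A directed (multi)graph with vertices `V` and edges `E`. -/
structure DiMultigraph (V E : Type*) where
  src : E → V
  tgt : E → V

namespace DiMultigraph

variable {V E : Type*} (G : DiMultigraph V E)

/-- The edge list `p` is a walk from `x` to `y`. -/
def IsWalk : V → List E → V → Prop
  | x, [], y => x = y
  | x, e :: p, y => G.src e = x ∧ IsWalk (G.tgt e) p y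

/-- The vertices visited by the edge list `p` when it starts at `x`. -/
def verts (x : V) (p : List E) : List V := x :: p.map G.tgt

/-- `p` is a simple `x`-`y` path: no vertex is repeated. -/
def IsPath (x : V) (p : List E) (y : V) : Prop := G.IsWalk x p y ∧ (G.verts x p).Nodup

/-- `p` is a simple `x`-`y` path all of whose edges lie in the edge set `S`. -/
def IsPathIn (S : Set E) (x : V) (p : List E) (y : V) : Prop := G.IsPath x p y ∧ ∀ e ∈ p, e ∈ S

/-- The subnetwork with edge set `S` contains an `x`-`y` path. -/
def Reach (S : Set E) (x y : V) : Prop := ∃ p, G.IsPathIn S x p y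

end DiMultigraph

/-! ### 2-Directed Disjoint Paths -/

/-- An instance of 2-Directed Disjoint Paths: a directed network `D` with four distinguished
vertices. -/
structure DDP (V E : Type*) extends DiMultigraph V E where
  s₁ : V
  s₂ : V
  t₁ : V
  t₂ : V
  distinct : [s₁, s₂, t₁, t₂].Nodup

namespace DDP

variable {V E : Type*} (I : DDP V E)

/-- YES-instance: there are vertex-disjoint `s₁`-`t₁` and `s₂`-`t₂` paths. -/
def IsYes : Prop :=
  ∃ p q, I.IsPath I.s₁ p I.t₁ ∧ I.IsPath I.s₂ q I.t₂ ∧ (I.verts I.s₁ p).Disjoint (I.verts I.s₂ q)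

/-- The network contains edge-disjoint `s₁`-`t₂` and `s₂`-`t₁` paths. -/
def HasCrossingPaths : Prop :=
  ∃ p q, I.IsPath I.s₁ p I.t₂ ∧ I.IsPath I.s₂ q I.t₁ ∧ p.Disjoint q

/-- The subnetwork with edge set `S` is good. -/
def Good (S : Set E) : Prop :=
  ((I.Reach S I.s₁ I.t₁ ∨ I.Reach S I.s₁ I.t₂) ∧ (I.Reach S I.s₂ I.t₁ ∨ I.Reach S I.s₂ I.t₂)) ∧
  ((I.Reach S I.s₁ I.t₁ ∨ I.Reach S I.s₂ I.t₁) ∧ (I.Reach S I.s₁ I.t₂ ∨ I.Reach S I.s₂ I.t₂)) ∧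
  (¬ I.Reach S I.s₁ I.t₂ ∨ ¬ I.Reach S I.s₂ I.t₁)

end DDP

/-! ### Bottleneck routing games with linear latencies -/

/-- An `s`-`t` network with a linear latency function `x ↦ coef e * x`, `coef e > 0`, on each
edge `e`. A subnetwork is given by its set of edges. -/
structure LinNetwork (W F : Type*) extends DiMultigraph W F where
  s : W
  t : W
  coef : F → ℝ≥0
  coef_pos : ∀ e, 0 < coef e

namespace LinNetwork

variable {W F : Type*} (N : LinNetwork W F)

/-- `p` is a simple `s`-`t` path of the subnetwork `H`. -/
def IsSTPath (H : Set F) (p : List F) : Prop := N.IsPathIn H N.s p N.t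

/-- `f` is a feasible flow of rate `r` in the subnetwork `H`: nonnegative amounts on the simple
`s`-`t` paths of `H` that sum up to `r`. -/
def IsFlow (H : Set F) (r : ℝ≥0) (f : List F →₀ ℝ≥0) : Prop :=
  (∀ p ∈ f.support, N.IsSTPath H p) ∧ (f.sum fun _ x => x) = r

open Classical in
/-- The amount of flow through the edge `e`. -/
def load (f : List F →₀ ℝ≥0) (e : F) : ℝ≥0 := f.sum fun p x => if e ∈ p then x else 0

open Classical in
/-- The bottleneck cost of the path `p` under the flow `f`. -/
def pathCost (f : List F →₀ ℝ≥0) (p : List F) : ℝ≥0 :=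
  p.toFinset.sup fun e => N.coef e * load f e

/-- The bottleneck cost of the flow `f`: the maximum bottleneck cost of a used path. -/
def cost (f : List F →₀ ℝ≥0) : ℝ≥0 := f.support.sup (N.pathCost f)

/-- `f` is a Nash flow of rate `r` of the subnetwork `H`. -/
def IsNash (H : Set F) (r : ℝ≥0) (f : List F →₀ ℝ≥0) : Prop :=
  N.IsFlow H r f ∧
    ∀ p p', N.IsSTPath H p → N.IsSTPath H p' → 0 < f p → N.pathCost f p ≤ N.pathCost f p'

/-- `b` is the optimal bottleneck cost of the network at rate `r`. -/
def IsOptCost (r b : ℝ≥0) : Prop := IsLeast {c | ∃ f, N.IsFlow Set.univ r f ∧ N.cost f = c} b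

/-- `b` is the worst equilibrium bottleneck cost of the subnetwork `H` at rate `r`. -/
def IsWorstCost (H : Set F) (r b : ℝ≥0) : Prop :=
  IsGreatest {c | ∃ f, N.IsNash H r f ∧ N.cost f = c} b

/-- The worst equilibrium bottleneck cost of the subnetwork `H` at rate `r` is at least `b`: some
Nash flow costs at least `b`. A subnetwork without `s`-`t` paths admits no flow at all, and its
cost is regarded as infinite. -/
def WorstCostGE (H : Set F) (r b : ℝ≥0) : Prop :=
  (∃ p, N.IsSTPath H p) → ∃ f, N.IsNash H r f ∧ b ≤ N.cost f

/-- The edges that do not enter the origin and do not leave the destination. All other edges lie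
on no simple `s`-`t` path. -/
def Useful (e : F) : Prop := N.tgt e ≠ N.s ∧ N.src e ≠ N.t

end LinNetwork

/-! ### Copies of `D` and gap instances -/

/-- A copy in `N` of (a subnetwork of) `D`: the edges `e` with `emap e ≠ none` are copied. -/
structure DCopy {V E W F : Type*} (I : DDP V E) (N : LinNetwork W F) where
  vmap : V → W
  vmap_inj : Function.Injective vmap
  emap : E → Option F
  emap_inj : ∀ e e' f, emap e = some f → emap e' = some f → e = e'
  src_eq : ∀ e f, emap e = some f → N.src f = vmap (I.src e)
  tgt_eq : ∀ e f, emap e = some f → N.tgt f = vmap (I.tgt e)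

namespace DCopy

variable {V E W F : Type*} {I : DDP V E} {N : LinNetwork W F}

/-- All of `D` is copied. -/
def IsTotal (c : DCopy I N) : Prop := ∀ e, ∃ f, c.emap e = some f

/-- The subnetwork of `D` whose copy the subnetwork `H` retains. -/
def retained (c : DCopy I N) (H : Set F) : Set E := {e | ∃ f ∈ H, c.emap e = some f}

end DCopy

/-- `N`, with its designated copies of `D`, is a `γ₁/γ₂`-gap instance based on `I`. -/
structure IsGapInstance {V E W F K : Type*} (I : DDP V E) (N : LinNetwork W F)
    (copies : K → DCopy I N) (γ₁ γ₂ : ℝ≥0) : Prop where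
  pos : 0 < γ₂
  lt : γ₂ < γ₁
  includes : ∃ k, (copies k).IsTotal
  opt : ∀ r, 0 < r → N.IsOptCost r (r / γ₁)
  yes : ∀ r, 0 < r → I.IsYes → ∃ H, N.IsWorstCost H r (r / γ₁)
  no : ∀ r, 0 < r → ¬ I.IsYes → ∀ H, N.WorstCostGE H r (r / γ₂)
  good : ∀ r, 0 < r → ∀ H, (∃ k, I.Good ((copies k).retained H)) ∨ N.WorstCostGE H r (r / γ₂)

/-! ### The amplified network -/

/-- The external edges that are replaced by edgeworks. -/
inductive ExtEdge
  | e₁ | e₃ | e₄ | e₅ | e₆ | e₇ | e₈ | e₉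

/-- Vertices of the amplified network: `s`, `t`, `u`, `v`, the vertices `X` of `D`, and the inner
vertices `Y` of the eight edgeworks. -/
inductive AmpVertex (X Y : Type*)
  | s | t | u | v
  | base (x : X)
  | inner (i : ExtEdge) (y : Y)

/-- Edges of the amplified network: `e₂`, the edges `E` of `D`, and the edges `F` of the eight
edgeworks. -/
inductive AmpEdge (E F : Type*)
  | e₂
  | base (e : E)
  | work (i : ExtEdge) (f : F)

namespace ExtEdge

variable {V E Y : Type*}

/-- The tail of an external edge. -/
def tail (I : DDP V E) : ExtEdge → AmpVertex V Y
  | e₁ => .s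
  | e₃ => .v
  | e₄ => .s
  | e₅ => .v
  | e₆ => .s
  | e₇ => .base I.t₁
  | e₈ => .u
  | e₉ => .base I.t₂

/-- The head of an external edge. -/
def head (I : DDP V E) : ExtEdge → AmpVertex V Y
  | e₁ => .u
  | e₃ => .t
  | e₄ => .v
  | e₅ => .base I.s₁
  | e₆ => .base I.s₂
  | e₇ => .u
  | e₈ => .t
  | e₉ => .t

/-- The factor by which the latencies of an edgework are scaled. -/
def scale : ExtEdge → ℝ≥0
  | e₁ => 1 / 2
  | e₃ => 1 / 2
  | _ => 1

theorem scale_pos (i : ExtEdge) : 0 < i.scale := by cases i <;> simp [scale]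

theorem tail_ne_head (I : DDP V E) (i : ExtEdge) : (i.tail I : AmpVertex V Y) ≠ i.head I := by
  cases i <;> simp [tail, head]

theorem tail_ne_inner (I : DDP V E) (i j : ExtEdge) (y : Y) : i.tail I ≠ .inner j y := by
  cases i <;> simp [tail]

theorem head_ne_inner (I : DDP V E) (i j : ExtEdge) (y : Y) : i.head I ≠ .inner j y := by
  cases i <;> simp [head]

end ExtEdge

section Amplify

variable {V E W F : Type*} (I : DDP V E) (N : LinNetwork W F)

/-- The inner vertices of `N`. -/
abbrev LinNetwork.Inner : Type _ := {x : W // x ≠ N.s ∧ x ≠ N.t}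

/-- The edges of `N` that are kept in an edgework. -/
abbrev LinNetwork.Kept : Type _ := {e : F // N.Useful e}

open Classical in
/-- The vertex of the amplified network that corresponds to the vertex `x` of the edgework
replacing `i`; origin and destination of the edgework are the ends of `i`. -/
def glue (i : ExtEdge) (x : W) : AmpVertex V N.Inner :=
  if hs : x = N.s then i.tail I
  else if ht : x = N.t then i.head I
  else .inner i ⟨x, hs, ht⟩

theorem glue_injective (i : ExtEdge) : Function.Injective (glue I N i) := by
  intro x y h
  unfold glue at h
  split_ifs at h with h1 h2 h3 h4 h5 h6 h7
  · rw [h1, h2]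
  · exact absurd h (ExtEdge.tail_ne_head I i)
  · exact absurd h (ExtEdge.tail_ne_inner I i i _)
  · exact absurd h.symm (ExtEdge.tail_ne_head I i)
  · rw [h4, h6]
  · exact absurd h (ExtEdge.head_ne_inner I i i _)
  · exact absurd h.symm (ExtEdge.tail_ne_inner I i i _)
  · exact absurd h.symm (ExtEdge.head_ne_inner I i i _)
  · simpa using h

/-- The amplified network: `D`, four new vertices, the edge `e₂ = (u, v)`, and, instead of each of
the other external edges, an edgework, that is a copy of `N` (without its edges that enter the
origin or leave the destination) with appropriately scaled latencies. The edge `e₂` and the edges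
of `D` have latency `ε x`. -/
def amplify (ε : ℝ≥0) (hε : 0 < ε) :
    LinNetwork (AmpVertex V N.Inner) (AmpEdge E N.Kept) where
  s := .s
  t := .t
  src
    | .e₂ => .u
    | .base e => .base (I.src e)
    | .work i f => glue I N i (N.src f)
  tgt
    | .e₂ => .v
    | .base e => .base (I.tgt e)
    | .work i f => glue I N i (N.tgt f)
  coef
    | .e₂ => ε
    | .base _ => ε
    | .work i f => i.scale * N.coef f
  coef_pos
    | .e₂ => hε
    | .base _ => hε
    | .work i f => mul_pos i.scale_pos (N.coef_pos f)

/-- The copy of `D` with which the construction of the amplified network starts. -/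
def baseCopy (ε : ℝ≥0) (hε : 0 < ε) : DCopy I (amplify I N ε hε) where
  vmap := .base
  vmap_inj := fun _ _ h => by simpa using h
  emap e := some (.base e)
  emap_inj := by
    intro e e' f h h'
    rw [← h'] at h
    simpa using h
  src_eq := by
    rintro e f ⟨⟩
    rfl
  tgt_eq := by
    rintro e f ⟨⟩
    rfl

variable {I N}

open Classical in
/-- The image in the edgework replacing `i` of a copy of `D` in `N`. -/
def edgeworkCopy (c : DCopy I N) (i : ExtEdge) (ε : ℝ≥0) (hε : 0 < ε) :
    DCopy I (amplify I N ε hε) where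
  vmap x := glue I N i (c.vmap x)
  vmap_inj := (glue_injective I N i).comp c.vmap_inj
  emap e := (c.emap e).bind fun f => if hf : N.Useful f then some (.work i ⟨f, hf⟩) else none
  emap_inj := by
    intro e e' g h h'
    simp only [Option.bind_eq_some_iff] at h h'
    obtain ⟨f, hf, h⟩ := h
    obtain ⟨f', hf', h'⟩ := h'
    split_ifs at h h'
    rw [← h'] at h
    simp only [Option.some.injEq, AmpEdge.work.injEq, Subtype.mk.injEq, true_and] at h
    subst h
    exact c.emap_inj e e' f hf hf'
  src_eq := by
    intro e g h
    simp only [Option.bind_eq_some_iff] at h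
    obtain ⟨f, hf, h⟩ := h
    split_ifs at h
    cases h
    exact congrArg (glue I N i) (c.src_eq e f hf)
  tgt_eq := by
    intro e g h
    simp only [Option.bind_eq_some_iff] at h
    obtain ⟨f, hf, h⟩ := h
    split_ifs at h
    cases h
    exact congrArg (glue I N i) (c.tgt_eq e f hf)

/-- The copies of `D` in the amplified network. -/
def amplifyCopies {K : Type*} (copies : K → DCopy I N) (ε : ℝ≥0) (hε : 0 < ε) :
    Option (ExtEdge × K) → DCopy I (amplify I N ε hε)
  | none => baseCopy I N ε hε
  | some (i, k) => edgeworkCopy (copies k) i ε hε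

end Amplify

/-! ### Encodings by finite words -/

/-- Reserved names of distinguished vertices. -/
inductive Terminal
  | s | t | s₁ | s₂ | t₁ | t₂

/-- The alphabet. -/
inductive Letter
  | bit (b : Bool)
  | sep
  | vertex
  | edge
  | bar
  | term (a : Terminal)

/-- Vertex names: reserved symbols for distinguished vertices, bit strings for the others. -/
inductive VName
  | term (a : Terminal)
  | inner (w : List Bool)

/-- A terminated bit string. -/
def bitsWord (w : List Bool) : List Letter := w.map Letter.bit ++ [Letter.sep]

/-- The word of a vertex name. -/
def VName.word : VName → List Letter
  | .term a => [Letter.term a]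
  | .inner w => bitsWord w

/-- The natural number with binary digits `w`, least significant digit first. -/
def bitsVal (w : List Bool) : ℕ := Nat.ofDigits 2 (w.map Bool.toNat)

/-- The word of a list of vertices. -/
def verticesWord (l : List (List Bool)) : List Letter := l.flatMap fun w => Letter.vertex :: bitsWord w

/-- Code of a 2-Directed Disjoint Paths instance: the names of the vertices that are not
distinguished, and the list of the edges. -/
structure DDPCode where
  inner : List (List Bool)
  edges : List (VName × VName)

/-- The word of a 2-Directed Disjoint Paths instance. -/
def DDPCode.word (c : DDPCode) : List Letter :=
  verticesWord c.inner ++ c.edges.flatMap fun e => Letter.edge :: (e.1.word ++ e.2.word)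

/-- Code of an edge of a network: its ends and the numerator and denominator, in binary, of its
latency coefficient. -/
structure EdgeCode where
  src : VName
  tgt : VName
  num : List Bool
  den : List Bool

/-- Code of a network with rational latency coefficients. -/
structure NetCode where
  inner : List (List Bool)
  edges : List EdgeCode

/-- The word of a network. -/
def NetCode.word (c : NetCode) : List Letter :=
  verticesWord c.inner ++ c.edges.flatMap fun e =>
    Letter.edge :: (e.src.word ++ e.tgt.word ++ bitsWord e.num ++ bitsWord e.den)

/-- Code of a pair of a 2-Directed Disjoint Paths instance and a network. -/
structure InputCode where
  ddp : DDPCode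
  net : NetCode

/-- The word of a pair; its length is the size of the input. -/
def InputCode.word (c : InputCode) : List Letter := c.ddp.word ++ Letter.bar :: c.net.word

/-- `name` names the vertices injectively, the bit strings it uses are those listed in `l`, without
repetition, and the vertices with reserved names are exactly those listed in `ts`. -/
def IsNaming {V : Type*} (name : V → VName) (l : List (List Bool)) (ts : List (V × Terminal)) :
    Prop :=
  Function.Injective name ∧ l.Nodup ∧ (∀ w, w ∈ l ↔ ∃ x, name x = .inner w) ∧
    ∀ x a, name x = .term a ↔ (x, a) ∈ ts

/-- The code `c` represents the instance `I`. -/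
def DDPCode.Represents {V E : Type*} (c : DDPCode) (I : DDP V E) : Prop :=
  ∃ name : V → VName,
    IsNaming name c.inner [(I.s₁, .s₁), (I.s₂, .s₂), (I.t₁, .t₁), (I.t₂, .t₂)] ∧
    ∃ es : List E, es.Nodup ∧ (∀ e, e ∈ es) ∧
      c.edges = es.map fun e => (name (I.src e), name (I.tgt e))

/-- The code `c` represents the network `N`. -/
def NetCode.Represents {W F : Type*} (c : NetCode) (N : LinNetwork W F) : Prop :=
  ∃ name : W → VName,
    IsNaming name c.inner [(N.s, .s), (N.t, .t)] ∧
    ∃ es : List F, es.Nodup ∧ (∀ e, e ∈ es) ∧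
      List.Forall₂ (fun (d : EdgeCode) e => d.src = name (N.src e) ∧ d.tgt = name (N.tgt e) ∧
        bitsVal d.den ≠ 0 ∧ N.coef e = (bitsVal d.num : ℝ≥0) / (bitsVal d.den : ℝ≥0)) c.edges es

end

/-! Contract every edgework of `G'` to a single edge. In this skeleton write `l_i` for the load of
the edge `e_i`. The simple `s`-`t` paths of `G'` are the skeleton paths together with a simple path
of `G` for each edgework that they traverse (`isPath_liftPath`, `exists_liftPath`). Hence flows of
`G'` project to the skeleton and to the edgeworks (`exists_projection`), and a skeleton flow lifts
by splitting in each edgework in proportion to a unit flow (`liftFlow`). An edgework acts like an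
edge of latency `scale * x / γ₁` if it is routed optimally, or pruned well in a YES-instance, and
like one of latency at least `scale * x / γ₂` in its bad equilibria.

Optimum. The rate is `l₁ + l₄ + l₆`. At cost `B` these loads are at most `2γ₁B`, `γ₁B` and `γ₁B`, so
`r ≤ 4γ₁B`. Equality holds for `r/2` along `e₁e₂e₃` and `r/4` along each of `e₆…e₇e₈` and `e₄e₅…e₉`,
which use the crossing connections of `D`.

YES-instance. Keep two disjoint paths of `D` and a best subnetwork of `G` in each edgework. In a
Nash flow of cost `B`, every skeleton path meets a blocked edgework, one whose paths all cost at
least `B`; otherwise some path would cost less than `B`. A blocked edgework is itself in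
equilibrium, so it carries at least `γ₁B`, and twice that for `e₁` and `e₃`. Disjointness gives `l₆
= l₉` and `l₇ ≤ l₅ ≤ l₄`, and a case analysis over the possible blocked sets yields `r ≥ 4γ₁B`
(`rate_ge_of_blocked`).

Bad equilibria. Suppose that the retained part of `D` is not good and that every edgework has an
equilibrium of cost at least `1/γ₂` at rate 1. Since latencies are linear, a flow of cost 1 that
blocks every path rescales to a Nash flow, of cost `r` divided by its rate
(`exists_nash_of_blocking`), and any flow of cost at most 1 extends to a blocking one
(`exists_blocking_extension`). So it suffices to start with a flow all of whose extensions have rate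
at most `3γ₂`. Conservation gives rate `= l₁ + l₃ + l₅ + l₆ - l₂ = l₁ + l₃ + l₇ + l₉ - l₂`, so the
start should load `e₂` heavily (`exists_bad_start`). NO-instances have no good subnetwork
(`not_good_of_not_isYes`), so this settles both (2) and (3).

Algorithm. For an input of length `n` take `ε = 2^{-(n+2)}`: it is small enough because `γ₁` is at
most the sum of the denominators of the latencies, which is below `2^n`. The output word is a
concatenation of 18 words, each a letter-by-letter rewriting of the input, and a stack machine
produces them one after the other. -/

noncomputable section

/-! ### Walks and simple paths -/

namespace DiMultigraph

variable {V E : Type*} (G : DiMultigraph V E)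

theorem isWalk_append {x y : V} {p q : List E} :
    G.IsWalk x (p ++ q) y ↔ ∃ z, G.IsWalk x p z ∧ G.IsWalk z q y := by
  induction p generalizing x with
  | nil => simp [IsWalk]
  | cons e p ih => simp [IsWalk, ih, and_assoc]

/-- Along a walk, the differences of a potential telescope. -/
theorem IsWalk.sum_potential (φ : V → ℤ) {x y : V} {p : List E} (h : G.IsWalk x p y) :
    (p.map fun e => φ (G.tgt e) - φ (G.src e)).sum = φ y - φ x := by
  induction p generalizing x with
  | nil => simp [show x = y from h]
  | cons e p ih =>
    obtain ⟨rfl, h⟩ := h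
    simp [ih h]

theorem IsWalk.src_mem_verts {x y : V} {p : List E} (h : G.IsWalk x p y) {e : E} (he : e ∈ p) :
    G.src e ∈ G.verts x p := by
  induction p generalizing x with
  | nil => simp at he
  | cons e' p ih =>
    obtain ⟨rfl, h⟩ := h
    rcases List.mem_cons.1 he with rfl | he
    · simp [verts]
    · have := ih h he
      simp only [verts, List.map_cons] at this ⊢
      exact List.mem_cons_of_mem _ this

theorem IsWalk.target_mem_verts {x y : V} {p : List E} (h : G.IsWalk x p y) :
    y ∈ G.verts x p := by
  induction p generalizing x with
  | nil => simp [verts, show x = y from h]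
  | cons e' p ih =>
    obtain ⟨rfl, h⟩ := h
    exact List.mem_cons_of_mem _ (ih h)

theorem IsWalk.exists_split {x y z : V} {p : List E} (h : G.IsWalk x p y)
    (hz : z ∈ G.verts x p) : ∃ q r, p = q ++ r ∧ G.IsWalk x q z ∧ G.IsWalk z r y := by
  induction p generalizing x with
  | nil =>
    simp only [verts, List.map_nil, List.mem_singleton] at hz
    subst hz
    exact ⟨[], [], rfl, rfl, h⟩
  | cons e p ih =>
    by_cases hzx : z = x
    · subst hzx
      exact ⟨[], e :: p, rfl, rfl, h⟩
    · obtain ⟨hx, h⟩ := h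
      obtain ⟨q, r, rfl, hq, hr⟩ := ih h
        (by simpa [verts, hzx] using hz)
      exact ⟨e :: q, r, rfl, ⟨hx, hq⟩, hr⟩

theorem IsPath.targets_nodup {x y : V} {p : List E} (h : G.IsPath x p y) : (p.map G.tgt).Nodup :=
  (List.nodup_cons.1 h.2).2

theorem IsPath.nodup {x y : V} {p : List E} (h : G.IsPath x p y) : p.Nodup :=
  h.targets_nodup.of_map

theorem IsPath.tgt_ne_source {x y : V} {p : List E} (h : G.IsPath x p y) {e : E} (he : e ∈ p) :
    G.tgt e ≠ x := by
  rintro rfl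
  exact (List.nodup_cons.1 h.2).1 (List.mem_map_of_mem he)

theorem IsWalk.target_mem_targets {x y : V} {p : List E} (h : G.IsWalk x p y) (hp : p ≠ []) :
    y ∈ p.map G.tgt := by
  obtain ⟨e, p, rfl⟩ := List.exists_cons_of_ne_nil hp
  exact h.2.target_mem_verts

theorem IsPath.src_ne_target {x y : V} {p : List E} (h : G.IsPath x p y) {e : E} (he : e ∈ p) :
    G.src e ≠ y := by
  obtain ⟨q, r, rfl⟩ := List.append_of_mem he
  obtain ⟨z, hq, hz, hr⟩ := (G.isWalk_append).1 h.1
  rintro hy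
  have h2 := h.2
  simp only [verts, List.map_append, ← List.cons_append] at h2
  have hd := (List.nodup_append.1 h2).2.2
  have h1 : z ∈ x :: q.map G.tgt := hq.target_mem_verts
  have h3 : y ∈ (e :: r).map G.tgt := IsWalk.target_mem_targets (x := z) G ⟨hz, hr⟩ (by simp)
  exact hd _ h1 _ h3 (by rw [← hz, hy])

theorem IsPath.suffix {x y z : V} {p q : List E} (h : G.IsPath x (p ++ q) y)
    (hz : G.IsWalk z q y) (hp : G.IsWalk x p z) : G.IsPath z q y := by
  refine ⟨hz, ?_⟩
  have h2 := h.2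
  simp only [verts, List.map_append] at h2
  rw [← List.cons_append, List.nodup_append] at h2
  refine List.nodup_cons.2 ⟨fun hzq => ?_, h2.2.1⟩
  exact h2.2.2 _ hp.target_mem_verts _ hzq rfl

/-- A walk can be shortcut to a simple path. -/
theorem IsWalk.reach {S : Set E} {x y : V} {p : List E} (h : G.IsWalk x p y)
    (hp : ∀ e ∈ p, e ∈ S) : G.Reach S x y := by
  induction p generalizing x with
  | nil => exact ⟨[], ⟨h, by simp [verts]⟩, by simp⟩
  | cons e p ih =>
    obtain ⟨hx, h⟩ := h
    obtain ⟨q, hq, hqS⟩ := ih h fun e he => hp e (List.mem_cons_of_mem _ he)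
    -- If the shortcut path returns to `x`, the edge `e` and the closed part before that return are
    -- dropped.
    by_cases hxq : x ∈ G.verts (G.tgt e) q
    · obtain ⟨a, b, rfl, ha, hb⟩ := hq.1.exists_split G hxq
      exact ⟨b, hq.suffix G hb ha, fun e he => hqS e (List.mem_append_right _ he)⟩
    · refine ⟨e :: q, ⟨⟨hx, hq.1⟩, List.nodup_cons.2 ⟨hxq, hq.2⟩⟩, ?_⟩
      intro e' he'
      rcases List.mem_cons.1 he' with rfl | he'
      · exact hp _ List.mem_cons_self
      · exact hqS _ he'

theorem Reach.refl (S : Set E) (x : V) : G.Reach S x x :=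
  IsWalk.reach (p := []) G rfl (by simp)

theorem Reach.trans {S : Set E} {x y z : V} (h : G.Reach S x y) (h' : G.Reach S y z) :
    G.Reach S x z := by
  obtain ⟨p, hp, hpS⟩ := h
  obtain ⟨q, hq, hqS⟩ := h'
  refine IsWalk.reach (p := p ++ q) G ((G.isWalk_append).2 ⟨y, hp.1, hq.1⟩) ?_
  intro e he
  rcases List.mem_append.1 he with he | he
  exacts [hpS e he, hqS e he]

theorem Reach.edge {S : Set E} {e : E} (he : e ∈ S) : G.Reach S (G.src e) (G.tgt e) :=
  IsWalk.reach (p := [e]) G ⟨rfl, rfl⟩ (by simpa using he)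

/-- Two walks of a subnetwork through a common vertex can be switched there. -/
theorem reach_of_common_vertex {S : Set E} {x y x' y' z : V} {p q : List E}
    (hp : G.IsPathIn S x p y) (hq : G.IsPathIn S x' q y')
    (hzp : z ∈ G.verts x p) (hzq : z ∈ G.verts x' q) : G.Reach S x y' := by
  obtain ⟨a, b, rfl, ha, -⟩ := hp.1.1.exists_split G hzp
  obtain ⟨c, d, rfl, -, hd⟩ := hq.1.1.exists_split G hzq
  exact Reach.trans G (ha.reach G fun e he => hp.2 e (List.mem_append_left _ he))
    (hd.reach G fun e he => hq.2 e (List.mem_append_right _ he))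

end DiMultigraph

/-! ### NO-instances and good subnetworks -/

namespace DDP

variable {V E : Type*} (I : DDP V E)

/-- A NO-instance has no good subnetwork. -/
theorem not_good_of_not_isYes (h : ¬ I.IsYes) (S : Set E) : ¬ I.Good S := by
  rintro ⟨⟨h1, h2⟩, ⟨h3, h4⟩, h5⟩
  -- In a NO-instance an `s₁`-`t₁` and an `s₂`-`t₂` path meet, and switching at the common vertex
  -- gives both crossing connections. If one crossing connection is missing, goodness forces both
  -- parallel connections, a contradiction.
  have key : I.Reach S I.s₁ I.t₁ → I.Reach S I.s₂ I.t₂ →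
      I.Reach S I.s₁ I.t₂ ∧ I.Reach S I.s₂ I.t₁ := by
    rintro ⟨p, hp⟩ ⟨q, hq⟩
    have hd : ¬ (I.verts I.s₁ p).Disjoint (I.verts I.s₂ q) :=
      fun hd => h ⟨p, q, hp.1, hq.1, hd⟩
    simp only [List.Disjoint, not_forall] at hd
    obtain ⟨z, hzp, hzq, -⟩ := hd
    exact ⟨I.reach_of_common_vertex hp hq hzp hzq, I.reach_of_common_vertex hq hp hzq hzp⟩
  tauto

end DDP

/-! ### Flows, blocking flows and Nash flows -/

namespace LinNetwork

variable {W F : Type*} (N : LinNetwork W F)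

/-- The total amount of a flow. -/
def rate (f : List F →₀ ℝ≥0) : ℝ≥0 := f.sum fun _ x => x

theorem rate_add (f g : List F →₀ ℝ≥0) : rate (f + g) = rate f + rate g :=
  Finsupp.sum_add_index' (fun _ => rfl) (fun _ _ _ => rfl)

theorem rate_single (p : List F) (x : ℝ≥0) : rate (Finsupp.single p x) = x :=
  Finsupp.sum_single_index rfl

theorem rate_smul (c : ℝ≥0) (f : List F →₀ ℝ≥0) : rate (c • f) = c * rate f := by
  unfold rate
  rw [Finsupp.sum_smul_index (fun _ => rfl), Finsupp.sum, Finsupp.sum, Finset.mul_sum]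

open Classical in
theorem load_add (f g : List F →₀ ℝ≥0) (e : F) : load (f + g) e = load f e + load g e :=
  Finsupp.sum_add_index' (fun _ => by simp) (fun _ _ _ => by split_ifs <;> simp)

open Classical in
theorem load_single (p : List F) (x : ℝ≥0) (e : F) :
    load (Finsupp.single p x) e = if e ∈ p then x else 0 :=
  Finsupp.sum_single_index (by simp)

theorem load_smul (c : ℝ≥0) (f : List F →₀ ℝ≥0) (e : F) : load (c • f) e = c * load f e := by
  classical
  unfold load
  rw [Finsupp.sum_smul_index (fun _ => by simp), Finsupp.sum, Finsupp.sum, Finset.mul_sum]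
  exact Finset.sum_congr rfl fun p _ => by split_ifs <;> simp

theorem load_le_rate (f : List F →₀ ℝ≥0) (e : F) : load f e ≤ rate f := by
  classical
  exact Finset.sum_le_sum fun p _ => by dsimp only; split_ifs <;> simp

theorem load_eq_zero (f : List F →₀ ℝ≥0) (e : F) (h : ∀ p ∈ f.support, e ∉ p) : load f e = 0 := by
  classical
  exact Finset.sum_eq_zero fun p hp => if_neg (h p hp)

theorem load_mono {f g : List F →₀ ℝ≥0} (h : f ≤ g) (e : F) : load f e ≤ load g e := by
  obtain ⟨k, rfl⟩ := exists_add_of_le h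
  rw [load_add]
  exact le_self_add

theorem pathCost_le_iff {f : List F →₀ ℝ≥0} {p : List F} {b : ℝ≥0} :
    N.pathCost f p ≤ b ↔ ∀ e ∈ p, N.coef e * load f e ≤ b := by
  simp [pathCost]

theorem le_pathCost {f : List F →₀ ℝ≥0} {p : List F} {e : F} (he : e ∈ p) :
    N.coef e * load f e ≤ N.pathCost f p :=
  N.pathCost_le_iff.1 le_rfl e he

theorem exists_le_of_le_pathCost {f : List F →₀ ℝ≥0} {p : List F} {b : ℝ≥0} (hb : 0 < b)
    (h : b ≤ N.pathCost f p) : ∃ e ∈ p, b ≤ N.coef e * load f e := by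
  classical
  obtain ⟨e, he, h'⟩ := (Finset.le_sup_iff hb).1 h
  exact ⟨e, by simpa using he, h'⟩

/-- Edges on no used path carry no load, so the maximum may be taken over all edges of the network.
-/
theorem cost_le_iff {f : List F →₀ ℝ≥0} {b : ℝ≥0} :
    N.cost f ≤ b ↔ ∀ e, N.coef e * load f e ≤ b := by
  constructor
  · intro h e
    by_cases he : ∃ p ∈ f.support, e ∈ p
    · obtain ⟨p, hp, hep⟩ := he
      exact (N.le_pathCost hep).trans ((Finset.le_sup (f := N.pathCost f) hp).trans h)
    · push Not at he
      simp [load_eq_zero f e he]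
  · intro h
    exact Finset.sup_le fun p _ => N.pathCost_le_iff.2 fun e _ => h e

theorem coef_mul_load_le_cost (f : List F →₀ ℝ≥0) (e : F) : N.coef e * load f e ≤ N.cost f :=
  N.cost_le_iff.1 le_rfl e

theorem pathCost_le_cost (f : List F →₀ ℝ≥0) (p : List F) : N.pathCost f p ≤ N.cost f :=
  N.pathCost_le_iff.2 fun e _ => N.coef_mul_load_le_cost f e

theorem pathCost_smul (c : ℝ≥0) (f : List F →₀ ℝ≥0) (p : List F) :
    N.pathCost (c • f) p = c * N.pathCost f p := by
  unfold pathCost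
  rw [NNReal.mul_finset_sup]
  congr 1
  ext e
  rw [load_smul]
  ring_nf

theorem cost_smul {c : ℝ≥0} (hc : 0 < c) (f : List F →₀ ℝ≥0) :
    N.cost (c • f) = c * N.cost f := by
  apply le_antisymm
  · rw [N.cost_le_iff]
    intro e
    rw [load_smul, mul_left_comm]
    exact mul_le_mul_right (N.coef_mul_load_le_cost f e) _
  · rw [mul_comm, ← le_div_iff₀ hc, N.cost_le_iff]
    intro e
    rw [le_div_iff₀ hc]
    refine le_trans (le_of_eq ?_) (N.coef_mul_load_le_cost (c • f) e)
    rw [load_smul]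
    ring

theorem IsFlow.smul {H : Set F} {r : ℝ≥0} {f : List F →₀ ℝ≥0} (h : N.IsFlow H r f) (c : ℝ≥0) :
    N.IsFlow H (c * r) (c • f) :=
  ⟨fun p hp => h.1 p (Finsupp.support_smul hp), by
    change rate _ = _
    rw [rate_smul, show rate f = r from h.2]⟩

/-- The cost of the flow is attained on a used path, and no used path exceeds it. So comparing used
paths with all paths is the same as comparing one number with all paths; this form is used
throughout. -/
theorem isNash_iff {H : Set F} {r : ℝ≥0} {f : List F →₀ ℝ≥0} :
    N.IsNash H r f ↔ N.IsFlow H r f ∧ ∀ p, N.IsSTPath H p → N.cost f ≤ N.pathCost f p := by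
  constructor
  · rintro ⟨hf, h⟩
    refine ⟨hf, fun p hp => Finset.sup_le fun q hq => h q p (hf.1 q hq) hp ?_⟩
    exact pos_iff_ne_zero.2 (Finsupp.mem_support_iff.1 hq)
  · rintro ⟨hf, h⟩
    exact ⟨hf, fun p p' _ hp' _ => (N.pathCost_le_cost f p).trans (h p' hp')⟩

theorem IsNash.smul {H : Set F} {r : ℝ≥0} {f : List F →₀ ℝ≥0} (h : N.IsNash H r f) (c : ℝ≥0) 
    (hc : 0 < c) : N.IsNash H (c * r) (c • f) := by
  rw [isNash_iff] at h ⊢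
  refine ⟨h.1.smul N c, fun p hp => ?_⟩
  rw [N.cost_smul hc, pathCost_smul]
  exact mul_le_mul_right (h.2 p hp) _

/-- A subnetwork that admits a flow of positive rate has a simple path. -/
theorem IsFlow.exists_path {H : Set F} {r : ℝ≥0} {f : List F →₀ ℝ≥0} (h : N.IsFlow H r f)
    (hr : 0 < r) : ∃ p ∈ f.support, N.IsSTPath H p := by
  by_contra hc
  push Not at hc
  have h0 : f.support = ∅ := Finset.eq_empty_of_forall_notMem fun p hp => hc p hp (h.1 p hp)
  have := h.2
  simp only [Finsupp.sum, h0, Finset.sum_empty] at this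
  exact hr.ne this

/-- If the ends coincided, the empty path would be the only simple path, and it costs nothing. -/
theorem s_ne_t_of_cost_pos {H : Set F} {r : ℝ≥0} {f : List F →₀ ℝ≥0} (h : N.IsFlow H r f)
    (hc : 0 < N.cost f) : N.s ≠ N.t := by
  intro hst
  refine hc.ne' (nonpos_iff_eq_zero.1 (Finset.sup_le fun p hp => ?_))
  have hp' := (h.1 p hp).1
  cases p with
  | nil => simp [pathCost]
  | cons e p =>
    exfalso
    have h1 : N.t ∈ (e :: p).map N.tgt := hp'.1.target_mem_targets _ (by simp)
    have h2 := (List.nodup_cons.1 hp'.2).1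
    exact h2 (hst ▸ h1)

theorem IsSTPath.ne_nil {H : Set F} {p : List F} (h : N.IsSTPath H p) (hst : N.s ≠ N.t) :
    p ≠ [] := by
  rintro rfl
  exact hst h.1.1

theorem IsSTPath.useful {H : Set F} {p : List F} (h : N.IsSTPath H p) {e : F} (he : e ∈ p) :
    N.Useful e :=
  ⟨h.1.tgt_ne_source _ he, h.1.src_ne_target _ he⟩

/-- Every flow whose cost is at most `b` can be extended, by sending more flow along paths all of
whose edges cost less than `b`, to a flow of cost at most `b` for which every path has bottleneck
cost at least `b`. -/
theorem exists_blocking_extension [Finite F] (hst : N.s ≠ N.t) (H : Set F) (b : ℝ≥0)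
    (f : List F →₀ ℝ≥0) (hf : ∀ p ∈ f.support, N.IsSTPath H p) (hb : N.cost f ≤ b) :
    ∃ g, f ≤ g ∧ (∀ p ∈ g.support, N.IsSTPath H p) ∧ N.cost g ≤ b ∧
      ∀ p, N.IsSTPath H p → b ≤ N.pathCost g p := by
  classical
  have := Fintype.ofFinite F
  induction hn : (Finset.univ.filter fun e => N.coef e * load f e < b).card
    using Nat.strong_induction_on generalizing f with
  | _ n ih =>
    by_cases hbl : ∀ p, N.IsSTPath H p → b ≤ N.pathCost f p
    · exact ⟨f, le_rfl, hf, hb, hbl⟩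
    push Not at hbl
    obtain ⟨p, hp, hpb⟩ := hbl
    have hne : p.toFinset.Nonempty := by
      simpa using hp.ne_nil N hst
    -- The edge of `p` that admits the least additional flow; sending exactly this amount `x`
    -- saturates it and overloads no other edge.
    obtain ⟨e, he, hmin⟩ := Finset.exists_min_image p.toFinset
      (fun e => (b - N.coef e * load f e) / N.coef e) hne
    set x := (b - N.coef e * load f e) / N.coef e with hx
    have hlt : ∀ e ∈ p, N.coef e * load f e < b := fun e he => (N.le_pathCost he).trans_lt hpb
    have hload : ∀ e', load (f + Finsupp.single p x) e' = load f e' + if e' ∈ p then x else 0 := by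
      intro e'
      rw [load_add, load_single]
    have hle : ∀ e', N.coef e' * load (f + Finsupp.single p x) e' ≤ b := by
      intro e'
      rw [hload]
      split_ifs with h'
      · have h1 := hmin e' (by simpa using h')
        rw [le_div_iff₀ (N.coef_pos e')] at h1
        rw [mul_add, mul_comm _ x]
        calc _ ≤ N.coef e' * load f e' + (b - N.coef e' * load f e') := by gcongr
          _ = b := add_tsub_cancel_of_le (hlt e' h').le
      · simpa using N.cost_le_iff.1 hb e'
    have heq : N.coef e * load (f + Finsupp.single p x) e = b := by
      rw [hload, if_pos (by simpa using he), mul_add, hx, mul_div_cancel₀ _ (N.coef_pos e).ne']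
      exact add_tsub_cancel_of_le (hlt e (by simpa using he)).le
    have hmono : f ≤ f + Finsupp.single p x := le_self_add
    -- Saturated edges stay saturated and `e` becomes saturated, so the induction on the number of
    -- unsaturated edges proceeds.
    have hcard : (Finset.univ.filter fun e' =>
        N.coef e' * load (f + Finsupp.single p x) e' < b).card < n := by
      rw [← hn]
      apply Finset.card_lt_card
      refine ⟨fun e' he' => ?_, fun hs => ?_⟩
      · simp only [Finset.mem_filter, Finset.mem_univ, true_and] at he' ⊢
        exact (mul_le_mul_right (load_mono hmono e') _).trans_lt he'
      · have h1 := hs (x := e) (by simpa using hlt e (by simpa using he))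
        simp [heq] at h1
    have hsupp : ∀ q ∈ (f + Finsupp.single p x).support, N.IsSTPath H q := by
      intro q hq
      rcases Finset.mem_union.1 (Finsupp.support_add hq) with hq | hq
      · exact hf q hq
      · have := Finsupp.support_single_subset hq
        simp only [Finset.mem_singleton] at this
        exact this ▸ hp
    obtain ⟨g, hg, hg'⟩ := ih _ hcard _ hsupp (N.cost_le_iff.2 hle) rfl
    exact ⟨g, hmono.trans hg, hg'⟩

/-- A flow for which every path has bottleneck cost at least its own cost bound can be rescaled to
a Nash flow of any rate. -/
theorem exists_nash_of_blocking {H : Set F} {b : ℝ≥0} (hb : 0 < b) (f : List F →₀ ℝ≥0)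
    (hf : ∀ p ∈ f.support, N.IsSTPath H p) (hc : N.cost f ≤ b)
    (hbl : ∀ p, N.IsSTPath H p → b ≤ N.pathCost f p) (hp : ∃ p, N.IsSTPath H p)
    {r : ℝ≥0} (hr : 0 < r) :
    0 < rate f ∧ ∃ g, N.IsNash H r g ∧ N.cost g = r / rate f * b := by
  obtain ⟨p, hp⟩ := hp
  have hcb : N.cost f = b := le_antisymm hc ((hbl p hp).trans (N.pathCost_le_cost f p))
  have hpos : 0 < rate f := by
    rw [pos_iff_ne_zero]
    intro h0
    obtain ⟨e, -, he⟩ := N.exists_le_of_le_pathCost hb (hbl p hp)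
    have : load f e = 0 := nonpos_iff_eq_zero.1 (h0 ▸ load_le_rate f e)
    rw [this, mul_zero] at he
    exact hb.not_ge he
  have hN : N.IsNash H (rate f) f := N.isNash_iff.2 ⟨⟨hf, rfl⟩, fun q hq => hcb ▸ hbl q hq⟩
  have hq : 0 < r / rate f := div_pos hr hpos
  refine ⟨hpos, _, ?_, (N.cost_smul hq f).trans (by rw [hcb])⟩
  have := hN.smul N (r / rate f) hq
  rwa [div_mul_cancel₀ _ hpos.ne'] at this

/-- The zero flow extends to a blocking flow for the arbitrary bound 1, which is then rescaled. -/
theorem exists_nash [Finite F] (hst : N.s ≠ N.t) {H : Set F} (hp : ∃ p, N.IsSTPath H p)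
    {r : ℝ≥0} (hr : 0 < r) : ∃ f, N.IsNash H r f := by
  obtain ⟨g, -, h1, h2, h3⟩ := N.exists_blocking_extension hst H 1 0 (by simp)
    (by simp [cost])
  obtain ⟨-, f, hf, -⟩ := N.exists_nash_of_blocking one_pos g h1 h2 h3 hp hr
  exact ⟨f, hf⟩

/-- The worst equilibrium cost scales linearly with the rate. -/
theorem IsWorstCost.scale {H : Set F} {r b : ℝ≥0} (h : N.IsWorstCost H r b) {c : ℝ≥0}
    (hc : 0 < c) : N.IsWorstCost H (c * r) (c * b) := by
  obtain ⟨⟨f, hf, rfl⟩, hub⟩ := h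
  refine ⟨⟨c • f, hf.smul N c hc, N.cost_smul hc f⟩, ?_⟩
  rintro _ ⟨g, hg, rfl⟩
  have hc' := inv_pos.2 hc
  have h1 := hg.smul N c⁻¹ hc'
  rw [inv_mul_cancel_left₀ hc.ne'] at h1
  have h2 := hub ⟨_, h1, rfl⟩
  rw [N.cost_smul hc', inv_mul_le_iff₀ hc] at h2
  exact h2

end LinNetwork

/-! ### The skeleton and the lifting of its paths -/

instance : Finite ExtEdge :=
  Finite.of_injective (β := Fin 8) (fun
    | .e₁ => 0 | .e₃ => 1 | .e₄ => 2 | .e₅ => 3 | .e₆ => 4 | .e₇ => 5 | .e₈ => 6 | .e₉ => 7) (by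
    intro a b h
    cases a <;> cases b <;> simp_all)

instance : Fintype ExtEdge := Fintype.ofFinite _

instance : DecidableEq ExtEdge := Classical.decEq _

instance {E F : Type*} [Finite E] [Finite F] : Finite (AmpEdge E F) :=
  Finite.of_injective (β := Option (E ⊕ (ExtEdge × F))) (fun
    | .e₂ => none | .base e => some (.inl e) | .work i f => some (.inr (i, f))) (by
    intro a b h
    cases a <;> cases b <;> simp_all)

/-- The vertices of the skeleton as vertices of the amplified network. -/
def AmpVertex.embed {V Y : Type*} : AmpVertex V Empty → AmpVertex V Y
  | .s => .s
  | .t => .t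
  | .u => .u
  | .v => .v
  | .base x => .base x
  | .inner _ y => y.elim

theorem AmpVertex.embed_injective {V Y : Type*} :
    Function.Injective (AmpVertex.embed : AmpVertex V Empty → AmpVertex V Y) := by
  intro a b h
  rcases a with _ | _ | _ | _ | a | ⟨_, ⟨⟩⟩ <;> rcases b with _ | _ | _ | _ | b | ⟨_, ⟨⟩⟩ <;>
    simp_all [embed]

theorem AmpVertex.embed_ne_inner {V Y : Type*} (a : AmpVertex V Empty) (i : ExtEdge) (y : Y) :
    a.embed ≠ .inner i y := by
  rcases a with _ | _ | _ | _ | a | ⟨_, ⟨⟩⟩ <;> simp [embed]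

section

variable {V E W F : Type*} (I : DDP V E) (N : LinNetwork W F)

theorem ExtEdge.embed_tail {Y : Type*} (i : ExtEdge) :
    (i.tail I : AmpVertex V Empty).embed = (i.tail I : AmpVertex V Y) := by
  cases i <;> rfl

theorem ExtEdge.embed_head {Y : Type*} (i : ExtEdge) :
    (i.head I : AmpVertex V Empty).embed = (i.head I : AmpVertex V Y) := by
  cases i <;> rfl

/-- The skeleton of the amplified network: every edgework is contracted to a single edge. -/
def skel : DiMultigraph (AmpVertex V Empty) (AmpEdge E Unit) where
  src
    | .e₂ => .u
    | .base e => .base (I.src e)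
    | .work i _ => i.tail I
  tgt
    | .e₂ => .v
    | .base e => .base (I.tgt e)
    | .work i _ => i.head I

/-- The skeleton with latency coefficients `a i` for the contracted edgeworks and `ε` for the other
edges. -/
def skeleton (ε : ℝ≥0) (hε : 0 < ε) (a : ExtEdge → ℝ≥0) (ha : ∀ i, 0 < a i) :
    LinNetwork (AmpVertex V Empty) (AmpEdge E Unit) where
  toDiMultigraph := skel I
  s := .s
  t := .t
  coef
    | .e₂ => ε
    | .base _ => ε
    | .work i _ => a i
  coef_pos
    | .e₂ => hε
    | .base _ => hε
    | .work i _ => ha i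

theorem glue_s (i : ExtEdge) : glue I N i N.s = i.tail I := by simp [glue]

theorem glue_t (hst : N.s ≠ N.t) (i : ExtEdge) : glue I N i N.t = i.head I := by
  simp [glue, hst.symm]

theorem glue_eq_inner {i j : ExtEdge} {x : W} {y : N.Inner} (h : glue I N i x = .inner j y) :
    i = j ∧ x = y.1 := by
  unfold glue at h
  split_ifs at h
  · exact absurd h (ExtEdge.tail_ne_inner I i j y)
  · exact absurd h (ExtEdge.head_ne_inner I i j y)
  · simp only [AmpVertex.inner.injEq] at h
    exact ⟨h.1, congrArg Subtype.val h.2⟩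

theorem glue_inner (i : ExtEdge) (y : N.Inner) : glue I N i y.1 = .inner i y := by
  simp [glue, y.2.1, y.2.2]

theorem vertex_cases (x : W) : x = N.s ∨ x = N.t ∨ ∃ y : N.Inner, x = y.1 := by
  by_cases hs : x = N.s
  · exact .inl hs
  by_cases ht : x = N.t
  · exact .inr (.inl ht)
  · exact .inr (.inr ⟨⟨x, hs, ht⟩, rfl⟩)

open Classical in
/-- The edge of the edgework `i` that is a copy of `f`. -/
def toWork (E : Type*) (i : ExtEdge) (f : F) : Option (AmpEdge E N.Kept) :=
  if hf : N.Useful f then some (.work i ⟨f, hf⟩) else none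

/-- The part of a path of the amplified network that corresponds to one edge of the skeleton, if
the edgework `i` is traversed along the path `P i`. -/
def liftEdge (P : ExtEdge → List F) : AmpEdge E Unit → List (AmpEdge E N.Kept)
  | .e₂ => [.e₂]
  | .base e => [.base e]
  | .work i _ => (P i).filterMap (toWork N E i)

/-- The path of the amplified network that follows the path `π` of the skeleton and traverses the
edgework `i` along the path `P i`. -/
def liftPath (P : ExtEdge → List F) (π : List (AmpEdge E Unit)) : List (AmpEdge E N.Kept) :=
  π.flatMap (liftEdge N P)

variable {N}

theorem toWork_eq_some {i : ExtEdge} {f : F} {e : AmpEdge E N.Kept} :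
    toWork N E i f = some e ↔ ∃ hf : N.Useful f, e = .work i ⟨f, hf⟩ := by
  unfold toWork
  split_ifs with hf
  · simp [hf, eq_comm]
  · simp [hf]

theorem mem_liftPath_e₂ {P : ExtEdge → List F} {π : List (AmpEdge E Unit)} :
    .e₂ ∈ liftPath N P π ↔ .e₂ ∈ π := by
  simp only [liftPath, List.mem_flatMap]
  constructor
  · rintro ⟨e, he, h⟩
    cases e <;> simp_all [liftEdge, toWork_eq_some]
  · exact fun h => ⟨_, h, by simp [liftEdge]⟩

theorem mem_liftPath_base {P : ExtEdge → List F} {π : List (AmpEdge E Unit)} {e : E} :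
    .base e ∈ liftPath N P π ↔ .base e ∈ π := by
  simp only [liftPath, List.mem_flatMap]
  constructor
  · rintro ⟨e, he, h⟩
    cases e <;> simp_all [liftEdge, toWork_eq_some]
  · exact fun h => ⟨_, h, by simp [liftEdge]⟩

theorem mem_liftPath_work {P : ExtEdge → List F} {π : List (AmpEdge E Unit)} {i : ExtEdge}
    {f : N.Kept} : .work i f ∈ liftPath N P π ↔ .work i () ∈ π ∧ f.1 ∈ P i := by
  simp only [liftPath, List.mem_flatMap]
  constructor
  · rintro ⟨e, he, h⟩
    cases e with
    | e₂ => simp [liftEdge] at h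
    | base e => simp [liftEdge] at h
    | work j _ =>
      simp only [liftEdge, List.mem_filterMap, toWork_eq_some] at h
      obtain ⟨f', hf', hu, h⟩ := h
      cases h
      exact ⟨he, hf'⟩
  · rintro ⟨h, hf⟩
    exact ⟨_, h, List.mem_filterMap.2 ⟨f.1, hf, toWork_eq_some.2 ⟨f.2, rfl⟩⟩⟩

theorem filterMap_toWork_map_tgt {ε : ℝ≥0} {hε : 0 < ε} (i : ExtEdge) {q : List F}
    (hq : ∀ f ∈ q, N.Useful f) :
    (q.filterMap (toWork N E i)).map (amplify I N ε hε).tgt =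
      q.map fun f => glue I N i (N.tgt f) := by
  induction q with
  | nil => rfl
  | cons f q ih =>
    have hf := hq f List.mem_cons_self
    rw [List.filterMap_cons_some (toWork_eq_some.2 ⟨hf, rfl⟩), List.map_cons, List.map_cons,
      ih fun f hf => hq f (List.mem_cons_of_mem _ hf)]
    rfl

theorem isWalk_filterMap_toWork {ε : ℝ≥0} {hε : 0 < ε} (i : ExtEdge) {q : List F} {x y : W}
    (hq : ∀ f ∈ q, N.Useful f) (h : N.IsWalk x q y) :
    (amplify I N ε hε).IsWalk (glue I N i x) (q.filterMap (toWork N E i)) (glue I N i y) := by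
  induction q generalizing x with
  | nil => exact congrArg _ (show x = y from h)
  | cons f q ih =>
    have hf := hq f List.mem_cons_self
    rw [List.filterMap_cons_some (toWork_eq_some.2 ⟨hf, rfl⟩)]
    exact ⟨congrArg (glue I N i) h.1, ih (fun f hf => hq f (List.mem_cons_of_mem _ hf)) h.2⟩

theorem isWalk_liftEdge {ε : ℝ≥0} {hε : 0 < ε} (hst : N.s ≠ N.t) {P : ExtEdge → List F}
    {e : AmpEdge E Unit} (hP : ∀ i, e = .work i () → N.IsSTPath Set.univ (P i)) :
    (amplify I N ε hε).IsWalk ((skel I).src e).embed (liftEdge N P e) ((skel I).tgt e).embed := by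
  rcases e with _ | e | ⟨i, ⟨⟩⟩
  · exact ⟨rfl, rfl⟩
  · exact ⟨rfl, rfl⟩
  · have h := hP i rfl
    have := isWalk_filterMap_toWork I (ε := ε) (hε := hε) i (fun f hf => h.useful N hf) h.1.1
    rw [glue_s, glue_t I N hst, ← ExtEdge.embed_tail, ← ExtEdge.embed_head] at this
    exact this

theorem isWalk_liftPath {ε : ℝ≥0} {hε : 0 < ε} (hst : N.s ≠ N.t) {P : ExtEdge → List F}
    {π : List (AmpEdge E Unit)} (hP : ∀ i, .work i () ∈ π → N.IsSTPath Set.univ (P i))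
    {x y : AmpVertex V Empty} (h : (skel I).IsWalk x π y) :
    (amplify I N ε hε).IsWalk x.embed (liftPath N P π) y.embed := by
  induction π generalizing x with
  | nil => exact congrArg _ (show x = y from h)
  | cons e π ih =>
    obtain ⟨rfl, h⟩ := h
    rw [liftPath, List.flatMap_cons, DiMultigraph.isWalk_append]
    refine ⟨_, isWalk_liftEdge I hst ?_, ih (fun i hi => hP i (List.mem_cons_of_mem _ hi)) h⟩
    rintro i rfl
    exact hP i List.mem_cons_self

/-- Useful edges do not enter the origin of their edgework, so a traversal visits, after its start,
only inner vertices and the head. Inner vertices belong to a single edgework; hence lifts of simple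
paths stay simple. -/
theorem mem_targets_liftEdge {ε : ℝ≥0} {hε : 0 < ε} (hst : N.s ≠ N.t) {P : ExtEdge → List F}
    {e : AmpEdge E Unit} (hP : ∀ i, e = .work i () → N.IsSTPath Set.univ (P i))
    {z : AmpVertex V N.Inner} (hz : z ∈ (liftEdge N P e).map (amplify I N ε hε).tgt) :
    z = ((skel I).tgt e).embed ∨ ∃ i y, e = .work i () ∧ z = .inner i y := by
  rcases e with _ | e | ⟨i, ⟨⟩⟩
  · exact .inl (List.mem_singleton.1 hz)
  · exact .inl (List.mem_singleton.1 hz)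
  · have h := hP i rfl
    simp only [liftEdge] at hz
    rw [filterMap_toWork_map_tgt I i fun f hf => h.useful N hf] at hz
    obtain ⟨f, hf, rfl⟩ := List.mem_map.1 hz
    rcases vertex_cases N (N.tgt f) with h' | h' | ⟨y, h'⟩
    · exact absurd h' (h.useful N hf).1
    · left
      rw [h', glue_t I N hst]
      exact (ExtEdge.embed_head I i).symm
    · exact .inr ⟨i, y, rfl, by rw [h', glue_inner]⟩

theorem isPath_liftPath {ε : ℝ≥0} {hε : 0 < ε} (hst : N.s ≠ N.t) {P : ExtEdge → List F}
    {π : List (AmpEdge E Unit)} (hP : ∀ i, .work i () ∈ π → N.IsSTPath Set.univ (P i))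
    {x y : AmpVertex V Empty} (h : (skel I).IsPath x π y) :
    (amplify I N ε hε).IsPath x.embed (liftPath N P π) y.embed := by
  refine ⟨isWalk_liftPath I hst hP h.1, ?_⟩
  have hP' : ∀ e ∈ π, ∀ i, e = .work i () → N.IsSTPath Set.univ (P i) := by
    rintro e he i rfl
    exact hP i he
  have hmap : (liftPath N P π).map (amplify I N ε hε).tgt =
      π.flatMap fun e => (liftEdge N P e).map (amplify I N ε hε).tgt := by
    rw [liftPath, List.map_flatMap]
  rw [DiMultigraph.verts, hmap, List.nodup_cons, List.nodup_flatMap]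
  refine ⟨fun hx => ?_, fun e he => ?_, ?_⟩
  · obtain ⟨e, he, hx⟩ := List.mem_flatMap.1 hx
    rcases mem_targets_liftEdge I hst (hP' e he) hx with hx | ⟨i, y, -, hx⟩
    · exact h.tgt_ne_source _ he (AmpVertex.embed_injective hx).symm
    · exact AmpVertex.embed_ne_inner _ _ _ hx
  · rcases e with _ | e | ⟨i, ⟨⟩⟩
    · simp [liftEdge]
    · simp [liftEdge]
    · have hp := hP i he
      simp only [liftEdge]
      rw [filterMap_toWork_map_tgt I i fun f hf => hp.useful N hf]
      have := (hp.1.targets_nodup).map (glue_injective I N i)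
      rwa [List.map_map] at this
  · have hnd : π.Pairwise fun e e' => (skel I).tgt e ≠ (skel I).tgt e' :=
      List.pairwise_map.1 h.targets_nodup
    refine List.Pairwise.imp_of_mem ?_ hnd
    intro e e' he he' hne z hz hz'
    rcases mem_targets_liftEdge I hst (hP' e he) hz with h1 | ⟨i, y, rfl, h1⟩ <;>
      rcases mem_targets_liftEdge I hst (hP' e' he') hz' with h2 | ⟨j, y', rfl, h2⟩
    · exact hne (AmpVertex.embed_injective (h1.symm.trans h2))
    · exact AmpVertex.embed_ne_inner _ _ _ (h1.symm.trans h2)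
    · exact AmpVertex.embed_ne_inner _ _ _ (h2.symm.trans h1)
    · rw [h1] at h2
      simp only [AmpVertex.inner.injEq] at h2
      rw [h2.1] at hne
      exact hne rfl

/-- A walk of the amplified network that starts inside an edgework leaves it at its head. -/
theorem exists_split_of_glue {ε : ℝ≥0} {hε : 0 < ε} (hst : N.s ≠ N.t) (i : ExtEdge)
    {p : List (AmpEdge E N.Kept)} {x : W} (hx : x ≠ N.s)
    (h : (amplify I N ε hε).IsWalk (glue I N i x) p .t) :
    ∃ q p', p = q.filterMap (toWork N E i) ++ p' ∧ N.IsWalk x q N.t ∧ (∀ f ∈ q, N.Useful f) ∧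
      (amplify I N ε hε).IsWalk (i.head I) p' .t := by
  induction p generalizing x with
  | nil =>
    rcases vertex_cases N x with rfl | rfl | ⟨y, rfl⟩
    · exact absurd rfl hx
    · exact ⟨[], [], rfl, rfl, by simp, by rwa [glue_t I N hst] at h⟩
    · rw [glue_inner] at h
      cases h
  | cons e p ih =>
    rcases vertex_cases N x with rfl | rfl | ⟨y, rfl⟩
    · exact absurd rfl hx
    · exact ⟨[], e :: p, rfl, rfl, by simp, by rwa [glue_t I N hst] at h⟩
    -- Only edges of the same edgework leave an inner vertex, so the walk stays in the edgework for
    -- one more edge.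
    · obtain ⟨h1, h2⟩ := h
      rw [glue_inner] at h1
      rcases e with _ | e | ⟨j, f⟩
      · cases h1
      · cases h1
      · obtain ⟨rfl, hf⟩ := glue_eq_inner I N h1
        obtain ⟨q, p', rfl, hq, hqu, hp'⟩ := ih f.2.1 h2
        refine ⟨f.1 :: q, p', ?_, ⟨hf, hq⟩, ?_, hp'⟩
        · rw [List.filterMap_cons_some (toWork_eq_some.2 ⟨f.2, rfl⟩)]
          rfl
        · intro f' hf'
          rcases List.mem_cons.1 hf' with rfl | hf'
          exacts [f.2, hqu f' hf']

theorem liftPath_congr {P P' : ExtEdge → List F} {π : List (AmpEdge E Unit)}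
    (h : ∀ i, .work i () ∈ π → P i = P' i) : liftPath N P π = liftPath N P' π := by
  induction π with
  | nil => rfl
  | cons e π ih =>
    simp only [liftPath, List.flatMap_cons] at ih ⊢
    rw [ih fun i hi => h i (List.mem_cons_of_mem _ hi)]
    congr 1
    rcases e with _ | e | ⟨i, ⟨⟩⟩
    · rfl
    · rfl
    · simp [liftEdge, h i List.mem_cons_self]

/-- Whole traversals of edgeworks are split off from the front, by induction on the length. The
sublist clause transfers simplicity from the path to its skeleton and shows that no edgework is
traversed twice. -/
theorem exists_liftPath_aux {ε : ℝ≥0} {hε : 0 < ε} (hst : N.s ≠ N.t)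
    (p : List (AmpEdge E N.Kept)) (x : AmpVertex V Empty)
    (h : (amplify I N ε hε).IsPath x.embed p .t) :
    ∃ P π, p = liftPath N P π ∧ (skel I).IsWalk x π .t ∧
      ((π.map (skel I).tgt).map AmpVertex.embed).Sublist (p.map (amplify I N ε hε).tgt) ∧
      ∀ i, .work i () ∈ π → N.IsSTPath Set.univ (P i) := by
  induction hn : p.length using Nat.strong_induction_on generalizing p x with
  | _ n ih =>
    cases p with
    | nil =>
      refine ⟨fun _ => [], [], rfl, ?_, by simp, by simp⟩
      exact AmpVertex.embed_injective (show x.embed = AmpVertex.embed .t from h.1)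
    | cons e p =>
      have hsuf : ∀ y : AmpVertex V Empty, (amplify I N ε hε).tgt e = y.embed →
          (amplify I N ε hε).IsPath y.embed p .t := by
        intro y hy
        exact hy ▸ ⟨h.1.2, (List.nodup_cons.1 h.2).2⟩
      have hx : (amplify I N ε hε).src e = x.embed := h.1.1
      rcases e with _ | e | ⟨i, f⟩
      · obtain ⟨P, π, rfl, h1, h2, h3⟩ := ih p.length (by simp [← hn]) p .v (hsuf _ rfl) rfl
        refine ⟨P, .e₂ :: π, rfl, ⟨?_, h1⟩, h2.cons_cons _, by simpa using h3⟩
        exact AmpVertex.embed_injective hx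
      · obtain ⟨P, π, rfl, h1, h2, h3⟩ := ih p.length (by simp [← hn]) p (.base (I.tgt e))
          (hsuf _ rfl) rfl
        refine ⟨P, .base e :: π, rfl, ⟨?_, h1⟩, h2.cons_cons _, by simpa using h3⟩
        exact AmpVertex.embed_injective hx
      -- The path enters the edgework from a skeleton vertex. This is not an inner vertex, and no
      -- kept edge leaves the destination, so it is the origin.
      · have hfs : N.src f.1 = N.s := by
          change glue I N i (N.src f.1) = _ at hx
          rcases vertex_cases N (N.src f.1) with h' | h' | ⟨y, h'⟩
          · exact h'
          · exact absurd h' f.2.2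
          · rw [h', glue_inner] at hx
            exact absurd hx.symm (AmpVertex.embed_ne_inner _ _ _)
        obtain ⟨q, p', rfl, hq, hqu, hp'⟩ := exists_split_of_glue I hst i f.2.1 h.1.2
        have hq' : N.IsWalk N.s (f.1 :: q) N.t := ⟨hfs, hq⟩
        have hqu' : ∀ g ∈ f.1 :: q, N.Useful g := by simpa using ⟨f.2, hqu⟩
        have heq : (AmpEdge.work i f :: (q.filterMap (toWork N E i) ++ p')) =
            (f.1 :: q).filterMap (toWork N E i) ++ p' := by
          rw [List.filterMap_cons_some (toWork_eq_some.2 ⟨f.2, rfl⟩)]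
          rfl
        have hnd := h.2
        rw [heq, DiMultigraph.verts, List.map_append, filterMap_toWork_map_tgt I i hqu',
          List.nodup_cons, List.nodup_append] at hnd
        obtain ⟨hnd0, hnd1, hnd2, hnd3⟩ := hnd
        have hhead : (i.head I : AmpVertex V N.Inner) ∈
            (f.1 :: q).map fun f => glue I N i (N.tgt f) := by
          have h1 : N.t ∈ (f.1 :: q).map N.tgt := hq'.target_mem_targets _ (by simp)
          have h2 := List.mem_map_of_mem (f := glue I N i) h1
          rwa [List.map_map, glue_t I N hst] at h2
        have hpath : (amplify I N ε hε).IsPath (i.head I : AmpVertex V Empty).embed p' .t := by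
          rw [ExtEdge.embed_head]
          exact ⟨hp', List.nodup_cons.2 ⟨fun h' => hnd3 _ hhead _ h' rfl, hnd2⟩⟩
        obtain ⟨P, π, rfl, h1, h2, h3⟩ := ih p'.length (by simp [← hn]) p' _ hpath rfl
        -- A second traversal of `i` would visit its head again. Hence `P` can be redefined at `i`
        -- without affecting the rest of the path.
        have hi : .work i () ∉ π := by
          intro hi
          have h4 := List.mem_map_of_mem (f := AmpVertex.embed (Y := N.Inner))
            (List.mem_map_of_mem (f := (skel I).tgt) hi)
          have h5 := h2.subset h4
          change (i.head I : AmpVertex V Empty).embed ∈ _ at h5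
          rw [ExtEdge.embed_head] at h5
          exact hnd3 _ hhead _ h5 rfl
        have hne : ∀ j, .work j () ∈ π → j ≠ i := by
          rintro j hj rfl
          exact hi hj
        have hP : N.IsSTPath Set.univ (f.1 :: q) := by
          refine ⟨⟨hq', List.nodup_cons.2 ⟨fun h' => ?_, ?_⟩⟩, by simp⟩
          · obtain ⟨g, hg, hg'⟩ := List.mem_map.1 h'
            exact (hqu' g hg).1 hg'
          · have h4 : (((f.1 :: q).map N.tgt).map (glue I N i)).Nodup := by
              rwa [List.map_map]
            exact h4.of_map
        refine ⟨Function.update P i (f.1 :: q), .work i () :: π, ?_, ⟨?_, h1⟩, ?_, ?_⟩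
        · rw [heq, liftPath_congr (P := P) (P' := Function.update P i (f.1 :: q))]
          · simp [liftPath, liftEdge]
          · intro j hj
            rw [Function.update_of_ne (hne j hj)]
        · apply AmpVertex.embed_injective (Y := N.Inner)
          change (i.tail I : AmpVertex V Empty).embed = _
          rw [ExtEdge.embed_tail, ← hx, ← glue_s I N, ← hfs]
          rfl
        · rw [heq, List.map_append, filterMap_toWork_map_tgt I i hqu']
          refine List.Sublist.append (l₁ := [(i.head I : AmpVertex V Empty).embed]) ?_ h2
          rw [List.singleton_sublist, ExtEdge.embed_head]
          exact hhead
        · intro j hj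
          rcases List.mem_cons.1 hj with hj | hj
          · cases hj
            simpa using hP
          · rw [Function.update_of_ne (hne j hj)]
            exact h3 j hj

/-- Every simple `s`-`t` path of the amplified network follows a simple path of the skeleton and
traverses edgeworks along simple paths. -/
theorem exists_liftPath {ε : ℝ≥0} {hε : 0 < ε} (hst : N.s ≠ N.t) {p : List (AmpEdge E N.Kept)}
    (h : (amplify I N ε hε).IsPath .s p .t) :
    ∃ P π, p = liftPath N P π ∧ (skel I).IsPath .s π .t ∧
      ∀ i, .work i () ∈ π → N.IsSTPath Set.univ (P i) := by
  obtain ⟨P, π, hp, h1, h2, h3⟩ := exists_liftPath_aux I hst p .s h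
  refine ⟨P, π, hp, ⟨h1, ?_⟩, h3⟩
  have h4 : (((skel I).verts .s π).map (AmpVertex.embed (Y := N.Inner))).Nodup :=
    (h2.cons_cons _).nodup h.2
  exact h4.of_map

end

/-! ### Incidence identities for skeleton paths -/

section Skeleton

variable {V E : Type*} (I : DDP V E)

-- A simple path repeats no edge, so the telescoping sum runs over its edge set. Indicator functions
-- as potentials then count how often the path enters and leaves a set of vertices.
open Classical in
theorem skel_path_sum {π : List (AmpEdge E Unit)} {x y : AmpVertex V Empty}
    (h : (skel I).IsPath x π y) (φ : AmpVertex V Empty → ℤ) :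
    ∑ e ∈ π.toFinset, (φ ((skel I).tgt e) - φ ((skel I).src e)) = φ y - φ x := by
  rw [List.sum_toFinset _ (h.nodup)]
  exact h.1.sum_potential _ φ

open Classical in
/-- The indicator of an edge along a path. -/
def onPath (π : List (AmpEdge E Unit)) (e : AmpEdge E Unit) : ℤ := if e ∈ π then 1 else 0

open Classical in
theorem sum_indicator (π : List (AmpEdge E Unit)) (e : AmpEdge E Unit) :
    ∑ e' ∈ π.toFinset, (if e' = e then (1 : ℤ) else 0) = onPath π e := by
  rw [Finset.sum_ite_eq']
  simp [onPath]

variable {I} {π : List (AmpEdge E Unit)}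

theorem onPath_source (h : (skel I).IsPath .s π .t) :
    onPath π (.work .e₁ ()) + onPath π (.work .e₄ ()) + onPath π (.work .e₆ ()) = 1 := by
  classical
  have h1 := skel_path_sum I h fun z => if z = .s then 1 else 0
  simp only [← sum_indicator, ← Finset.sum_add_distrib]
  -- The path starts at `s`, so the indicator of `s` telescopes to `-1`; the signs are reversed to
  -- match.
  rw [← neg_inj, ← Finset.sum_neg_distrib]
  refine Eq.trans (Finset.sum_congr rfl fun e _ => ?_) (h1.trans (by simp))
  rcases e with _ | e | ⟨i, ⟨⟩⟩
  · simp [skel]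
  · simp [skel]
  · cases i <;> simp [skel, ExtEdge.head, ExtEdge.tail]

theorem onPath_target (h : (skel I).IsPath .s π .t) :
    onPath π (.work .e₃ ()) + onPath π (.work .e₈ ()) + onPath π (.work .e₉ ()) = 1 := by
  classical
  have h1 := skel_path_sum I h fun z => if z = .t then 1 else 0
  simp only [← sum_indicator, ← Finset.sum_add_distrib]
  refine Eq.trans (Finset.sum_congr rfl fun e _ => ?_) (h1.trans (by simp))
  rcases e with _ | e | ⟨i, ⟨⟩⟩
  · simp [skel]
  · simp [skel]
  · cases i <;> simp [skel, ExtEdge.head, ExtEdge.tail]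

theorem onPath_v (h : (skel I).IsPath .s π .t) :
    onPath π (.work .e₄ ()) + onPath π .e₂ = onPath π (.work .e₃ ()) + onPath π (.work .e₅ ()) := by
  classical
  have h1 := skel_path_sum I h fun z => if z = .v then 1 else 0
  rw [← sub_eq_zero]
  simp only [← sum_indicator, ← Finset.sum_add_distrib, ← Finset.sum_sub_distrib]
  refine Eq.trans (Finset.sum_congr rfl fun e _ => ?_) (h1.trans (by simp))
  rcases e with _ | e | ⟨i, ⟨⟩⟩
  · simp [skel]
  · simp [skel]
  · cases i <;> simp [skel, ExtEdge.head, ExtEdge.tail]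

theorem onPath_u (h : (skel I).IsPath .s π .t) :
    onPath π (.work .e₁ ()) + onPath π (.work .e₇ ()) = onPath π .e₂ + onPath π (.work .e₈ ()) := by
  classical
  have h1 := skel_path_sum I h fun z => if z = .u then 1 else 0
  rw [← sub_eq_zero]
  simp only [← sum_indicator, ← Finset.sum_add_distrib, ← Finset.sum_sub_distrib]
  refine Eq.trans (Finset.sum_congr rfl fun e _ => ?_) (h1.trans (by simp))
  rcases e with _ | e | ⟨i, ⟨⟩⟩
  · simp [skel]
  · simp [skel]
  · cases i <;> simp [skel, ExtEdge.head, ExtEdge.tail]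

open Classical in
/-- The indicator of a vertex set of `D` on the vertices of the skeleton. -/
def baseInd (S : Set V) : AmpVertex V Empty → ℤ
  | .base x => if x ∈ S then 1 else 0
  | _ => 0

/-- A path does not enter a part of `D` that it cannot leave. -/
theorem notMem_of_closed (h : (skel I).IsPath .s π .t) {S : Set V}
    (hS : ∀ e, .base e ∈ π → I.src e ∈ S → I.tgt e ∈ S) (h₁ : I.t₁ ∉ S) (h₂ : I.t₂ ∉ S) :
    (I.s₁ ∈ S → .work .e₅ () ∉ π) ∧ (I.s₂ ∈ S → .work .e₆ () ∉ π) := by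
  classical
  have h1 := skel_path_sum I h (baseInd S)
  -- No edge of the path leaves `S`, so every difference is nonnegative. The differences sum to 0,
  -- since neither `s` nor `t` is in `S`; hence no edge enters `S` either.
  have h2 : ∀ e ∈ π.toFinset, 0 ≤ baseInd S ((skel I).tgt e) - baseInd S ((skel I).src e) := by
    intro e he
    rcases e with _ | e | ⟨i, ⟨⟩⟩
    · simp [skel, baseInd]
    · have := hS e (by simpa using he)
      simp only [skel, baseInd]
      split_ifs <;> simp_all
    · cases i <;> simp [skel, baseInd, ExtEdge.head, ExtEdge.tail, h₁, h₂] <;> split_ifs <;> simp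
  rw [show baseInd S AmpVertex.t - baseInd S AmpVertex.s = 0 from rfl,
    Finset.sum_eq_zero_iff_of_nonneg h2] at h1
  constructor
  · intro hs he
    have := h1 _ (by simpa using he)
    simp [skel, baseInd, ExtEdge.head, ExtEdge.tail, hs] at this
  · intro hs he
    have := h1 _ (by simpa using he)
    simp [skel, baseInd, ExtEdge.head, ExtEdge.tail, hs] at this

/-- A path does not leave a part of `D` that it cannot enter. -/
theorem notMem_of_coclosed (h : (skel I).IsPath .s π .t) {S : Set V}
    (hS : ∀ e, .base e ∈ π → I.tgt e ∈ S → I.src e ∈ S) (h₁ : I.s₁ ∉ S) (h₂ : I.s₂ ∉ S) :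
    (I.t₁ ∈ S → .work .e₇ () ∉ π) ∧ (I.t₂ ∈ S → .work .e₉ () ∉ π) := by
  classical
  have h1 := skel_path_sum I h (baseInd S)
  have h2 : ∀ e ∈ π.toFinset, baseInd S ((skel I).tgt e) - baseInd S ((skel I).src e) ≤ 0 := by
    intro e he
    rcases e with _ | e | ⟨i, ⟨⟩⟩
    · simp [skel, baseInd]
    · have := hS e (by simpa using he)
      simp only [skel, baseInd]
      split_ifs <;> simp_all
    · cases i <;> simp [skel, baseInd, ExtEdge.head, ExtEdge.tail, h₁, h₂] <;> split_ifs <;> simp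
  rw [show baseInd S AmpVertex.t - baseInd S AmpVertex.s = 0 from rfl,
    Finset.sum_eq_zero_iff_of_nonpos h2] at h1
  constructor
  · intro hs he
    have := h1 _ (by simpa using he)
    simp [skel, baseInd, ExtEdge.head, ExtEdge.tail, hs] at this
  · intro hs he
    have := h1 _ (by simpa using he)
    simp [skel, baseInd, ExtEdge.head, ExtEdge.tail, hs] at this

open Classical in
/-- A path enters a union of components of its part in `D` as often as it leaves it. -/
theorem onPath_component (h : (skel I).IsPath .s π .t) {S : Set V}
    (hS : ∀ e, .base e ∈ π → (I.src e ∈ S ↔ I.tgt e ∈ S)) :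
    (if I.s₁ ∈ S then onPath π (.work .e₅ ()) else 0) +
      (if I.s₂ ∈ S then onPath π (.work .e₆ ()) else 0) =
    (if I.t₁ ∈ S then onPath π (.work .e₇ ()) else 0) +
      (if I.t₂ ∈ S then onPath π (.work .e₉ ()) else 0) := by
  have h1 := skel_path_sum I h (baseInd S)
  rw [← sub_eq_zero]
  have key : ∀ (c : Prop) [Decidable c] (e : AmpEdge E Unit), (if c then onPath π e else 0) =
      ∑ e' ∈ π.toFinset, if c then (if e' = e then (1 : ℤ) else 0) else 0 := by
    intro c _ e
    split_ifs
    · rw [sum_indicator]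
    · simp
  simp only [key, ← Finset.sum_add_distrib, ← Finset.sum_sub_distrib]
  refine Eq.trans (Finset.sum_congr rfl fun e he => ?_) (h1.trans (by simp [baseInd]))
  rcases e with _ | e | ⟨i, ⟨⟩⟩
  · simp [skel, baseInd]
  · have := hS e (by simpa using he)
    simp [skel, baseInd, this]
  · cases i <;> simp [skel, baseInd, ExtEdge.head, ExtEdge.tail]

/-- If a path can leave the component of `s₁` only through `t₁`, then it enters `s₁` through
`e₄`. -/
theorem mem_e₄_of_mem_e₅ (h : (skel I).IsPath .s π .t) {S : Set V}
    (hS : ∀ e, .base e ∈ π → (I.src e ∈ S ↔ I.tgt e ∈ S)) (hs : I.s₁ ∈ S) (ht : I.t₂ ∉ S)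
    (h5 : .work .e₅ () ∈ π) : .work .e₄ () ∈ π := by
  classical
  obtain ⟨α, β, rfl⟩ := List.append_of_mem h5
  obtain ⟨z, hα, hz, hβ⟩ := (skel I).isWalk_append.1 h.1
  change AmpVertex.v = z at hz
  subst hz
  have hnd := h.targets_nodup
  rw [List.map_append, List.nodup_append] at hnd
  -- After `e₅` the path is at `s₁ ∈ S` and has to leave `S` on its way to `t`; `e₇` is the only
  -- edge that can do so.
  have h7 : .work .e₇ () ∈ β := by
    by_contra h7
    have h1 := hβ.sum_potential _ (baseInd S)
    have h2 : 0 ≤ (β.map fun e =>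
        baseInd S ((skel I).tgt e) - baseInd S ((skel I).src e)).sum := by
      refine List.sum_nonneg fun x hx => ?_
      obtain ⟨e, he, rfl⟩ := List.mem_map.1 hx
      rcases e with _ | e | ⟨i, ⟨⟩⟩
      · simp [skel, baseInd]
      · have := hS e (by simp [he])
        simp [skel, baseInd, this]
      · cases i <;> simp [skel, baseInd, ExtEdge.head, ExtEdge.tail, ht] <;>
          first | exact absurd he h7 | (split_ifs <;> simp)
    rw [h1] at h2
    simp [skel, baseInd, ExtEdge.head, hs] at h2
  -- The path visits `u` after `v`, hence not before. So it cannot have reached `v` along `e₂`, and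
  -- `e₄` is the only other edge into `v`.
  have hu : AmpVertex.u ∉ (skel I).verts .s α := by
    rw [DiMultigraph.verts, List.mem_cons, not_or]
    refine ⟨by simp, fun hu => hnd.2.2 _ hu _ ?_ rfl⟩
    exact List.mem_cons_of_mem _ (List.mem_map_of_mem (f := (skel I).tgt) h7)
  have hαn : α ≠ [] := by
    rintro rfl
    cases hα
  obtain ⟨e, he, hev⟩ := List.mem_map.1 (hα.target_mem_targets _ hαn)
  have hse := hα.src_mem_verts _ he
  rcases e with _ | e | ⟨i, ⟨⟩⟩
  · exact absurd hse hu
  · cases hev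
  · cases i <;> first | exact List.mem_append_left _ he | cases hev

/-! ### Conservation of flow in the skeleton -/

variable {h : List (AmpEdge E Unit) →₀ ℝ≥0}

/-- The incidence identities of the used paths, weighted with the amounts of flow on them, add up to
the cut and conservation laws. -/
theorem skel_rate_source (hh : ∀ π ∈ h.support, (skel I).IsPath .s π .t) :
    LinNetwork.rate h = LinNetwork.load h (.work .e₁ ()) + LinNetwork.load h (.work .e₄ ()) +
      LinNetwork.load h (.work .e₆ ()) := by
  classical
  simp only [LinNetwork.rate, LinNetwork.load, Finsupp.sum, ← Finset.sum_add_distrib]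
  refine Finset.sum_congr rfl fun π hπ => ?_
  have := onPath_source (hh π hπ)
  unfold onPath at this
  split_ifs at this ⊢ <;> simp_all

theorem skel_rate_target (hh : ∀ π ∈ h.support, (skel I).IsPath .s π .t) :
    LinNetwork.rate h = LinNetwork.load h (.work .e₃ ()) + LinNetwork.load h (.work .e₈ ()) +
      LinNetwork.load h (.work .e₉ ()) := by
  classical
  simp only [LinNetwork.rate, LinNetwork.load, Finsupp.sum, ← Finset.sum_add_distrib]
  refine Finset.sum_congr rfl fun π hπ => ?_
  have := onPath_target (hh π hπ)
  unfold onPath at this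
  split_ifs at this ⊢ <;> simp_all

theorem skel_load_v (hh : ∀ π ∈ h.support, (skel I).IsPath .s π .t) :
    LinNetwork.load h (.work .e₄ ()) + LinNetwork.load h .e₂ =
      LinNetwork.load h (.work .e₃ ()) + LinNetwork.load h (.work .e₅ ()) := by
  classical
  simp only [LinNetwork.load, Finsupp.sum, ← Finset.sum_add_distrib]
  refine Finset.sum_congr rfl fun π hπ => ?_
  have := onPath_v (hh π hπ)
  unfold onPath at this
  split_ifs at this ⊢ <;> simp_all

theorem skel_load_u (hh : ∀ π ∈ h.support, (skel I).IsPath .s π .t) :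
    LinNetwork.load h (.work .e₁ ()) + LinNetwork.load h (.work .e₇ ()) =
      LinNetwork.load h .e₂ + LinNetwork.load h (.work .e₈ ()) := by
  classical
  simp only [LinNetwork.load, Finsupp.sum, ← Finset.sum_add_distrib]
  refine Finset.sum_congr rfl fun π hπ => ?_
  have := onPath_u (hh π hπ)
  unfold onPath at this
  split_ifs at this ⊢ <;> simp_all

theorem LinNetwork.load_le_of_imp {F : Type*} {f : List F →₀ ℝ≥0} {e e' : F}
    (hf : ∀ p ∈ f.support, e ∈ p → e' ∈ p) : LinNetwork.load f e ≤ LinNetwork.load f e' := by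
  classical
  refine Finset.sum_le_sum fun p hp => ?_
  have := hf p hp
  dsimp only
  split_ifs <;> simp_all

/-! ### Paths of the skeleton through `D` -/

theorem skel_isWalk_base {x y : V} {q : List E} (hq : I.IsWalk x q y) :
    (skel I).IsWalk (.base x) (q.map .base) (.base y) := by
  induction q generalizing x with
  | nil => exact congrArg _ (show x = y from hq)
  | cons e q ih => exact ⟨congrArg _ hq.1, ih hq.2⟩

/-- `L` lists the vertices visited before `D`. The vertices outside `D` are disjoint from those of
the path `q`, so only repetitions among themselves have to be excluded. -/
theorem skel_isPath_through {a b : AmpVertex V Empty} {x y : V} {α β : List (AmpEdge E Unit)}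
    {q : List E} {L : List (AmpVertex V Empty)} (hα : (skel I).IsWalk a α (.base x))
    (hq : I.IsPath x q y) (hβ : (skel I).IsWalk (.base y) β b)
    (hL : (skel I).verts a α = L ++ [.base x])
    (hb : ∀ z ∈ L ++ β.map (skel I).tgt, ∀ x', z ≠ .base x')
    (hnd : (L ++ β.map (skel I).tgt).Nodup) :
    (skel I).IsPath a (α ++ q.map .base ++ β) b := by
  refine ⟨(skel I).isWalk_append.2 ⟨_, (skel I).isWalk_append.2 ⟨_, hα, skel_isWalk_base hq.1⟩,
    hβ⟩, ?_⟩
  have hv : (skel I).verts a (α ++ q.map .base ++ β) =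
      L ++ ((I.verts x q).map .base ++ β.map (skel I).tgt) := by
    have : (skel I).verts a (α ++ q.map .base ++ β) =
      (skel I).verts a α ++ ((q.map .base).map (skel I).tgt ++ β.map (skel I).tgt) := by
      simp [DiMultigraph.verts]
    rw [this, hL]
    simp [DiMultigraph.verts, skel]
  rw [hv]
  rw [List.nodup_append] at hnd
  obtain ⟨h1, h2, h3⟩ := hnd
  refine List.nodup_append.2 ⟨h1, List.nodup_append.2 ⟨?_, h2, ?_⟩, ?_⟩
  · exact hq.2.map fun x y hxy => by simpa using hxy
  · intro z hz z' hz' hzz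
    obtain ⟨x', -, rfl⟩ := List.mem_map.1 hz
    exact hb z' (List.mem_append_right _ hz') x' hzz.symm
  · intro z hz z' hz' hzz
    rcases List.mem_append.1 hz' with hz' | hz'
    · obtain ⟨x', -, rfl⟩ := List.mem_map.1 hz'
      exact hb z (List.mem_append_left _ hz) x' hzz
    · exact h3 _ hz _ hz' hzz

theorem skel_isPath_e₁e₂e₃ :
    (skel I).IsPath .s [.work .e₁ (), .e₂, .work .e₃ ()] .t :=
  ⟨⟨rfl, rfl, rfl, rfl⟩, by simp [DiMultigraph.verts, skel, ExtEdge.head]⟩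

theorem skel_isPath_e₁e₈ : (skel I).IsPath .s [.work .e₁ (), .work .e₈ ()] .t :=
  ⟨⟨rfl, rfl, rfl⟩, by simp [DiMultigraph.verts, skel, ExtEdge.head]⟩

theorem skel_isPath_e₄e₃ : (skel I).IsPath .s [.work .e₄ (), .work .e₃ ()] .t :=
  ⟨⟨rfl, rfl, rfl⟩, by simp [DiMultigraph.verts, skel, ExtEdge.head]⟩

theorem skel_isPath_e₁e₂e₅e₉ {q : List E} (hq : I.IsPath I.s₁ q I.t₂) :
    (skel I).IsPath .s ([.work .e₁ (), .e₂, .work .e₅ ()] ++ q.map .base ++ [.work .e₉ ()]) .t :=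
  skel_isPath_through (L := [.s, .u, .v]) ⟨rfl, rfl, rfl, rfl⟩ hq ⟨rfl, rfl⟩ rfl
    (by simp [skel, ExtEdge.head]) (by simp [skel, ExtEdge.head])

theorem skel_isPath_e₆e₇e₂e₃ {q : List E} (hq : I.IsPath I.s₂ q I.t₁) :
    (skel I).IsPath .s ([.work .e₆ ()] ++ q.map .base ++ [.work .e₇ (), .e₂, .work .e₃ ()]) .t :=
  skel_isPath_through (L := [.s]) ⟨rfl, rfl⟩ hq ⟨rfl, rfl, rfl, rfl⟩ rfl
    (by simp [skel, ExtEdge.head]) (by simp [skel, ExtEdge.head])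

theorem skel_isPath_e₆e₇e₈ {q : List E} (hq : I.IsPath I.s₂ q I.t₁) :
    (skel I).IsPath .s ([.work .e₆ ()] ++ q.map .base ++ [.work .e₇ (), .work .e₈ ()]) .t :=
  skel_isPath_through (L := [.s]) ⟨rfl, rfl⟩ hq ⟨rfl, rfl, rfl⟩ rfl
    (by simp [skel, ExtEdge.head]) (by simp [skel, ExtEdge.head])

theorem skel_isPath_e₄e₅e₉ {q : List E} (hq : I.IsPath I.s₁ q I.t₂) :
    (skel I).IsPath .s ([.work .e₄ (), .work .e₅ ()] ++ q.map .base ++ [.work .e₉ ()]) .t :=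
  skel_isPath_through (L := [.s, .v]) ⟨rfl, rfl, rfl⟩ hq ⟨rfl, rfl⟩ rfl
    (by simp [skel, ExtEdge.head]) (by simp [skel, ExtEdge.head])

theorem skel_isPath_e₄e₅e₇e₈ {q : List E} (hq : I.IsPath I.s₁ q I.t₁) :
    (skel I).IsPath .s
      ([.work .e₄ (), .work .e₅ ()] ++ q.map .base ++ [.work .e₇ (), .work .e₈ ()]) .t :=
  skel_isPath_through (L := [.s, .v]) ⟨rfl, rfl, rfl⟩ hq ⟨rfl, rfl, rfl⟩ rfl
    (by simp [skel, ExtEdge.head]) (by simp [skel, ExtEdge.head])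

theorem skel_isPath_e₆e₉ {q : List E} (hq : I.IsPath I.s₂ q I.t₂) :
    (skel I).IsPath .s ([.work .e₆ ()] ++ q.map .base ++ [.work .e₉ ()]) .t :=
  skel_isPath_through (L := [.s]) ⟨rfl, rfl⟩ hq ⟨rfl, rfl⟩ rfl
    (by simp [skel, ExtEdge.head]) (by simp [skel, ExtEdge.head])

end Skeleton

/-! ### Lifting flows from the skeleton -/

section LiftFlow

variable {V E W F : Type*} (I : DDP V E) (N : LinNetwork W F)

open LinNetwork

/-- The flow of the amplified network that follows the flow `h` of the skeleton and splits in each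
edgework `i` proportionally to the flow `g i`. -/
def liftFlow (h : List (AmpEdge E Unit) →₀ ℝ≥0) (g : ExtEdge → List F →₀ ℝ≥0) :
    List (AmpEdge E N.Kept) →₀ ℝ≥0 :=
  ∑ π ∈ h.support, ∑ P ∈ Fintype.piFinset fun i => (g i).support,
    Finsupp.single (liftPath N P π) (h π * ∏ i, g i (P i))

variable {N} {h : List (AmpEdge E Unit) →₀ ℝ≥0} {g : ExtEdge → List F →₀ ℝ≥0}

theorem mem_support_liftFlow {p : List (AmpEdge E N.Kept)} (hp : p ∈ (liftFlow N h g).support) :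
    ∃ π ∈ h.support, ∃ P : ExtEdge → List F, (∀ i, P i ∈ (g i).support) ∧ p = liftPath N P π := by
  classical
  obtain ⟨π, hπ, hp⟩ := Finset.mem_biUnion.1 (Finsupp.support_finsetSum hp)
  obtain ⟨P, hP, hp⟩ := Finset.mem_biUnion.1 (Finsupp.support_finsetSum hp)
  exact ⟨π, hπ, P, Fintype.mem_piFinset.1 hP,
    Finset.mem_singleton.1 (Finsupp.support_single_subset hp)⟩

theorem rate_sum {ι α : Type*} (s : Finset ι) (f : ι → List α →₀ ℝ≥0) :
    rate (∑ i ∈ s, f i) = ∑ i ∈ s, rate (f i) := by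
  classical
  induction s using Finset.induction_on with
  | empty => simp [rate]
  | insert a s ha ih => rw [Finset.sum_insert ha, Finset.sum_insert ha, rate_add, ih]

theorem load_sum {ι α : Type*} (s : Finset ι) (f : ι → List α →₀ ℝ≥0) (e : α) :
    load (∑ i ∈ s, f i) e = ∑ i ∈ s, load (f i) e := by
  classical
  induction s using Finset.induction_on with
  | empty => simp [load]
  | insert a s ha ih => rw [Finset.sum_insert ha, Finset.sum_insert ha, load_add, ih]

/-- Independent choices of a path in every edgework form a probability distribution. All eight
edgeworks take part, also untraversed ones, so every `g i` needs rate 1. -/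
theorem sum_prod_eq_one (hg : ∀ i, rate (g i) = 1) :
    ∑ P ∈ Fintype.piFinset fun i => (g i).support, ∏ i, g i (P i) = 1 := by
  rw [← Finset.prod_univ_sum (fun i => (g i).support) fun i p => g i p]
  exact Finset.prod_eq_one fun i _ => hg i

theorem rate_liftFlow (hg : ∀ i, rate (g i) = 1) : rate (liftFlow N h g) = rate h := by
  simp only [liftFlow, rate_sum, rate_single, ← Finset.mul_sum, sum_prod_eq_one hg, mul_one]
  rfl

theorem load_liftFlow_of_iff (hg : ∀ i, rate (g i) = 1) (e : AmpEdge E N.Kept)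
    (e' : AmpEdge E Unit) (he : ∀ P π, e ∈ liftPath N P π ↔ e' ∈ π) :
    load (liftFlow N h g) e = load h e' := by
  classical
  simp only [liftFlow, load_sum, load_single, he]
  refine Finset.sum_congr rfl fun π _ => ?_
  dsimp only
  split_ifs
  · rw [← Finset.mul_sum, sum_prod_eq_one hg, mul_one]
  · simp

/-- This is the marginal of the product distribution at `i`: the other factors sum to 1, and what
remains is the share of `g i` on paths through `f`. -/
theorem load_liftFlow_work (hg : ∀ i, rate (g i) = 1) (i : ExtEdge) (f : N.Kept) :
    load (liftFlow N h g) (.work i f) = load h (.work i ()) * load (g i) f.1 := by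
  classical
  have key : ∑ P ∈ Fintype.piFinset fun i => (g i).support,
      (if f.1 ∈ P i then ∏ j, g j (P j) else 0) = load (g i) f.1 := by
    -- The condition on `P i` is moved into the factor at `i`, so that the sum of products factors
    -- again.
    have h1 : ∀ P : ExtEdge → List F, (if f.1 ∈ P i then ∏ j, g j (P j) else 0) =
        ∏ j, if j = i then (if f.1 ∈ P j then g j (P j) else 0) else g j (P j) := by
      intro P
      split_ifs with hf
      · refine Finset.prod_congr rfl fun j _ => ?_
        split_ifs with h1 h2
        · rfl
        · subst h1
          exact absurd hf h2
        · rfl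
      · exact (Finset.prod_eq_zero (Finset.mem_univ i) (by simp [hf])).symm
    simp only [h1]
    rw [← Finset.prod_univ_sum (fun j => (g j).support) fun j p =>
      if j = i then (if f.1 ∈ p then g j p else 0) else g j p]
    rw [Finset.prod_eq_single i]
    · simp [load, Finsupp.sum]
    · intro j _ hj
      simp only [if_neg hj]
      exact hg j
    · simp
  simp only [liftFlow, load_sum, load_single, mem_liftPath_work]
  rw [load, Finsupp.sum, Finset.sum_mul]
  refine Finset.sum_congr rfl fun π _ => ?_
  by_cases hπ : AmpEdge.work i () ∈ π
  · simp only [hπ, true_and, if_true, ← key, Finset.mul_sum]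
    refine Finset.sum_congr rfl fun P _ => ?_
    split_ifs <;> simp
  · simp [hπ]

/-- Costs of lifted flows. -/
theorem cost_liftFlow_le {ε : ℝ≥0} {hε : 0 < ε} (hg : ∀ i, rate (g i) = 1) {b : ℝ≥0}
    (h₂ : ε * load h .e₂ ≤ b) (hb : ∀ e, ε * load h (.base e) ≤ b)
    (hw : ∀ i, i.scale * N.cost (g i) * load h (.work i ()) ≤ b) :
    (amplify I N ε hε).cost (liftFlow N h g) ≤ b := by
  rw [cost_le_iff]
  rintro (_ | e | ⟨i, f⟩)
  · rw [load_liftFlow_of_iff hg _ _ fun _ _ => mem_liftPath_e₂]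
    exact h₂
  · rw [load_liftFlow_of_iff hg _ _ fun _ _ => mem_liftPath_base]
    exact hb e
  · rw [load_liftFlow_work hg]
    refine le_trans (le_of_eq ?_) ((mul_le_mul_left (mul_le_mul_right
      (N.coef_mul_load_le_cost (g i) f.1) i.scale) (load h (.work i ()))).trans (hw i))
    change i.scale * N.coef f.1 * _ = _
    ring

theorem support_liftFlow_isPath {ε : ℝ≥0} {hε : 0 < ε} (hst : N.s ≠ N.t)
    (hh : ∀ π ∈ h.support, (skel I).IsPath .s π .t)
    (hg : ∀ i, (∃ π ∈ h.support, .work i () ∈ π) → ∀ p ∈ (g i).support, N.IsSTPath Set.univ p)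
    {p : List (AmpEdge E N.Kept)} (hp : p ∈ (liftFlow N h g).support) :
    (amplify I N ε hε).IsPath .s p .t := by
  obtain ⟨π, hπ, P, hP, rfl⟩ := mem_support_liftFlow hp
  exact isPath_liftPath I hst (fun i hi => hg i ⟨π, hπ, hi⟩ _ (hP i)) (hh π hπ)

end LiftFlow

open LinNetwork

/-! ### Subnetworks, projected flows and lifted equilibria -/

section Subnetworks

variable {V E W F : Type*} (I : DDP V E) {N : LinNetwork W F}

/-- The subnetwork of `N` retained in the edgework `i`. -/
def workPart (H : Set (AmpEdge E N.Kept)) (i : ExtEdge) : Set F :=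
  {f | ∃ hf : N.Useful f, .work i ⟨f, hf⟩ ∈ H}

/-- The subnetwork of the skeleton that corresponds to a subnetwork of the amplified network. -/
def skelPart (H : Set (AmpEdge E N.Kept)) : Set (AmpEdge E Unit)
  | .e₂ => .e₂ ∈ H
  | .base e => .base e ∈ H
  | .work i _ => ∃ p, N.IsSTPath (workPart H i) p

theorem exists_liftPath_of_isSTPath {ε : ℝ≥0} {hε : 0 < ε} (hst : N.s ≠ N.t)
    {H : Set (AmpEdge E N.Kept)} {p : List (AmpEdge E N.Kept)}
    (h : (amplify I N ε hε).IsSTPath H p) :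
    ∃ P π, p = liftPath N P π ∧ (skel I).IsPathIn (skelPart H) .s π .t ∧
      ∀ i, .work i () ∈ π → N.IsSTPath (workPart H i) (P i) := by
  obtain ⟨P, π, rfl, hπ, hP⟩ := exists_liftPath I hst h.1
  have hP' : ∀ i, .work i () ∈ π → N.IsSTPath (workPart H i) (P i) := by
    intro i hi
    refine ⟨(hP i hi).1, fun f hf => ⟨(hP i hi).useful N hf, h.2 _ ?_⟩⟩
    exact mem_liftPath_work.2 ⟨hi, hf⟩
  refine ⟨P, π, rfl, ⟨hπ, ?_⟩, hP'⟩
  rintro (_ | e | ⟨i, ⟨⟩⟩) he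
  · exact h.2 _ (mem_liftPath_e₂.2 he)
  · exact h.2 _ (mem_liftPath_base.2 he)
  · exact ⟨_, hP' i he⟩

theorem isSTPath_liftPath {ε : ℝ≥0} {hε : 0 < ε} (hst : N.s ≠ N.t)
    {H : Set (AmpEdge E N.Kept)} {P : ExtEdge → List F} {π : List (AmpEdge E Unit)}
    (hπ : (skel I).IsPathIn (skelPart H) .s π .t)
    (hP : ∀ i, .work i () ∈ π → N.IsSTPath (workPart H i) (P i)) :
    (amplify I N ε hε).IsSTPath H (liftPath N P π) := by
  refine ⟨isPath_liftPath I hst (fun i hi => ⟨(hP i hi).1, by simp⟩) hπ.1, ?_⟩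
  rintro (_ | e | ⟨i, f⟩) he
  · exact hπ.2 _ (mem_liftPath_e₂.1 he)
  · exact hπ.2 _ (mem_liftPath_base.1 he)
  · obtain ⟨h1, h2⟩ := mem_liftPath_work.1 he
    exact ((hP i h1).2 _ h2).2

theorem rate_mapDomain {α β : Type*} (φ : List α → List β) (f : List α →₀ ℝ≥0) :
    rate (f.mapDomain φ) = rate f :=
  Finsupp.sum_mapDomain_index (fun _ => rfl) (fun _ _ _ => rfl)

open Classical in
theorem load_mapDomain {α β : Type*} (φ : List α → List β) (f : List α →₀ ℝ≥0) (e : β) :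
    load (f.mapDomain φ) e = f.sum fun p x => if e ∈ φ p then x else 0 :=
  Finsupp.sum_mapDomain_index (fun _ => by simp) (fun _ _ _ => by split_ifs <;> simp)

open Classical in
theorem rate_mapDomain_filter {α β : Type*} (φ : List α → List β) (c : List α → Prop)
    (f : List α →₀ ℝ≥0) :
    rate ((f.filter c).mapDomain φ) = f.sum fun p x => if c p then x else 0 := by
  rw [rate_mapDomain, rate, Finsupp.sum_filter_index, Finsupp.support_filter, Finset.sum_filter]
  rfl

open Classical in
theorem load_mapDomain_filter {α β : Type*} (φ : List α → List β) (c : List α → Prop)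
    (f : List α →₀ ℝ≥0) (e : β) (e' : α) (he : ∀ p ∈ f.support, e' ∈ p ↔ c p ∧ e ∈ φ p) :
    load ((f.filter c).mapDomain φ) e = load f e' := by
  rw [load_mapDomain, Finsupp.sum_filter_index, Finsupp.support_filter, Finset.sum_filter]
  refine Finset.sum_congr rfl fun p hp => ?_
  simp only [he p hp]
  exact (ite_and _ _ _ _).symm

/-- A flow of the amplified network induces flows of the skeleton and of the edgeworks. -/
theorem exists_projection {ε : ℝ≥0} {hε : 0 < ε} (hst : N.s ≠ N.t)
    {H : Set (AmpEdge E N.Kept)} {f : List (AmpEdge E N.Kept) →₀ ℝ≥0}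
    (hf : ∀ p ∈ f.support, (amplify I N ε hε).IsSTPath H p) :
    ∃ (h : List (AmpEdge E Unit) →₀ ℝ≥0) (k : ExtEdge → List F →₀ ℝ≥0),
      (∀ π ∈ h.support, (skel I).IsPathIn (skelPart H) .s π .t) ∧ rate h = rate f ∧
      (∀ i, ∀ p ∈ (k i).support, N.IsSTPath (workPart H i) p) ∧
      (∀ i, rate (k i) = load h (.work i ())) ∧
      (∀ i (e : N.Kept), load (k i) e.1 = load f (.work i e)) := by
  classical
  have hex : ∀ p, (amplify I N ε hε).IsSTPath H p → ∃ x : (ExtEdge → List F) × _,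
      p = liftPath N x.1 x.2 ∧ (skel I).IsPathIn (skelPart H) .s x.2 .t ∧
      ∀ i, .work i () ∈ x.2 → N.IsSTPath (workPart H i) (x.1 i) := fun p hp => by
    obtain ⟨P, π, h⟩ := exists_liftPath_of_isSTPath I (ε := ε) (hε := hε) hst hp
    exact ⟨(P, π), h⟩
  -- One decomposition is fixed for every path; the value at other lists is never used. The path
  -- chosen for an untraversed edgework is arbitrary, so the flow in edgework `i` is built only from
  -- paths that traverse it.
  let φ : List (AmpEdge E N.Kept) → (ExtEdge → List F) × List (AmpEdge E Unit) := fun p =>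
    if hp : (amplify I N ε hε).IsSTPath H p then (hex p hp).choose else ⟨fun _ => [], []⟩
  have hφ : ∀ p ∈ f.support, p = liftPath N (φ p).1 (φ p).2 ∧
      (skel I).IsPathIn (skelPart H) .s (φ p).2 .t ∧
      ∀ i, .work i () ∈ (φ p).2 → N.IsSTPath (workPart H i) ((φ p).1 i) := by
    intro p hp
    simp only [φ, dif_pos (hf p hp)]
    exact (hex p (hf p hp)).choose_spec
  clear_value φ
  refine ⟨f.mapDomain fun p => (φ p).2,
    fun i => (f.filter fun p => .work i () ∈ (φ p).2).mapDomain fun p => (φ p).1 i,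
    ?_, rate_mapDomain _ _, ?_, ?_, ?_⟩
  · intro π' hπ'
    obtain ⟨p, hp, rfl⟩ := Finset.mem_image.1 (Finsupp.mapDomain_support hπ')
    exact (hφ p hp).2.1
  · intro i p hp
    obtain ⟨p', hp', rfl⟩ := Finset.mem_image.1 (Finsupp.mapDomain_support hp)
    rw [Finsupp.support_filter, Finset.mem_filter] at hp'
    exact (hφ p' hp'.1).2.2 i hp'.2
  · intro i
    rw [load_mapDomain]
    convert rate_mapDomain_filter _ _ _
  · intro i e
    convert load_mapDomain_filter _ _ f e.1 (.work i e) ?_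
    intro p hp
    conv_lhs => rw [(hφ p hp).1]
    exact mem_liftPath_work

/-- Kept edges have the same load in both networks, with coefficients scaled; the other edges lie on
no simple path of `N` and carry nothing. -/
theorem scale_mul_cost_projection_le {ε : ℝ≥0} {hε : 0 < ε}
    {H : Set (AmpEdge E N.Kept)} {f : List (AmpEdge E N.Kept) →₀ ℝ≥0} {i : ExtEdge}
    {k : List F →₀ ℝ≥0} (hk : ∀ p ∈ k.support, N.IsSTPath (workPart H i) p)
    (hl : ∀ e : N.Kept, load k e.1 = load f (.work i e)) :
    i.scale * N.cost k ≤ (amplify I N ε hε).cost f := by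
  rw [mul_comm, ← le_div_iff₀ i.scale_pos, cost_le_iff]
  intro e
  by_cases he : N.Useful e
  · rw [le_div_iff₀ i.scale_pos, hl ⟨e, he⟩]
    refine le_trans (le_of_eq ?_) ((amplify I N ε hε).coef_mul_load_le_cost f (.work i ⟨e, he⟩))
    change _ = i.scale * N.coef e * _
    ring
  · rw [load_eq_zero]
    · simp
    · intro p hp hep
      exact he ((hk p hp).useful N hep)

/-- A Nash flow of the skeleton lifts to a Nash flow of the amplified network, if it splits in each
edgework according to a Nash flow. -/
theorem isNash_liftFlow {ε : ℝ≥0} {hε : 0 < ε} (hst : N.s ≠ N.t) {H : Set (AmpEdge E N.Kept)}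
    {g : ExtEdge → List F →₀ ℝ≥0} (hg : ∀ i, rate (g i) = 1)
    (hgN : ∀ i, (∃ p, N.IsSTPath (workPart H i) p) → N.IsNash (workPart H i) 1 (g i))
    {a : ExtEdge → ℝ≥0} {ha : ∀ i, 0 < a i}
    (hag : ∀ i, (∃ p, N.IsSTPath (workPart H i) p) → a i = i.scale * N.cost (g i))
    {r : ℝ≥0} (hr : 0 < r) {h : List (AmpEdge E Unit) →₀ ℝ≥0}
    (hh : (skeleton I ε hε a ha).IsNash (skelPart H) r h) :
    (amplify I N ε hε).IsNash H r (liftFlow N h g) ∧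
      (skeleton I ε hε a ha).cost h ≤ (amplify I N ε hε).cost (liftFlow N h g) := by
  rw [isNash_iff] at hh
  obtain ⟨hhf, hhc⟩ := hh
  have hhc0 := (skeleton I ε hε a ha).coef_mul_load_le_cost h
  have hle : (amplify I N ε hε).cost (liftFlow N h g) ≤ (skeleton I ε hε a ha).cost h := by
    refine cost_liftFlow_le I hg (hhc0 .e₂) (fun e => hhc0 (.base e)) fun i => ?_
    by_cases hi : ∃ p, N.IsSTPath (workPart H i) p
    · rw [← hag i hi]
      exact hhc0 (.work i ())
    -- An edgework without paths carries no flow, so its coefficient `a i` does not matter.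
    · rw [load_eq_zero h]
      · simp
      · exact fun π hπ hiπ => hi ((hhf.1 π hπ).2 _ hiπ)
  have hge : ∀ p, (amplify I N ε hε).IsSTPath H p →
      (skeleton I ε hε a ha).cost h ≤ (amplify I N ε hε).pathCost (liftFlow N h g) p := by
    intro p hp
    obtain ⟨P, π, rfl, hπ, hP⟩ := exists_liftPath_of_isSTPath I hst hp
    refine (hhc π hπ).trans ((pathCost_le_iff _).2 ?_)
    rintro (_ | e | ⟨i, ⟨⟩⟩) he
    · have := (amplify I N ε hε).le_pathCost (f := liftFlow N h g)
        (mem_liftPath_e₂ (P := P).2 he)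
      rwa [load_liftFlow_of_iff hg _ _ fun _ _ => mem_liftPath_e₂] at this
    · have := (amplify I N ε hε).le_pathCost (f := liftFlow N h g)
        (mem_liftPath_base (P := P).2 he)
      rwa [load_liftFlow_of_iff hg _ _ fun _ _ => mem_liftPath_base] at this
    · have hex : ∃ p, N.IsSTPath (workPart H i) p := ⟨_, hP i he⟩
      -- Since `g i` is a Nash flow, each path through the edgework costs at least as much as the
      -- contracted edge. So no path of `G'` is cheaper than the skeleton path below it.
      have h1 := (N.isNash_iff.1 (hgN i hex)).2 _ (hP i he)
      change a i * _ ≤ _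
      rw [hag i hex]
      calc _ = i.scale * load h (.work i ()) * N.cost (g i) := by ring
        _ ≤ i.scale * load h (.work i ()) * N.pathCost (g i) (P i) := by gcongr
        _ = N.pathCost ((i.scale * load h (.work i ())) • g i) (P i) := (pathCost_smul _ _ _ _).symm
        _ ≤ _ := (pathCost_le_iff _).2 fun f hf => ?_
      have hu := (hP i he).useful N hf
      have := (amplify I N ε hε).le_pathCost (f := liftFlow N h g)
        (mem_liftPath_work (f := ⟨f, hu⟩) (P := P).2 ⟨he, hf⟩)
      rw [load_liftFlow_work hg] at this
      refine le_trans (le_of_eq ?_) this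
      change _ = i.scale * N.coef f * _
      rw [load_smul]
      ring
  have hflow : (amplify I N ε hε).IsFlow H r (liftFlow N h g) := by
    refine ⟨fun p hp => ?_, (rate_liftFlow hg).trans hhf.2⟩
    obtain ⟨π, hπ, P, hP, rfl⟩ := mem_support_liftFlow hp
    exact isSTPath_liftPath I hst (hhf.1 π hπ) fun i hi =>
      (hgN i ((hhf.1 π hπ).2 _ hi)).1.1 _ (hP i)
  refine ⟨(isNash_iff _).2 ⟨hflow, fun p hp => hle.trans (hge p hp)⟩, ?_⟩
  obtain ⟨p, -, hp⟩ := hflow.exists_path _ hr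
  exact (hge p hp).trans (pathCost_le_cost _ _ _)

end Subnetworks

/-! ### Bad equilibria of the skeleton -/

section BadNash

variable {V E : Type*} {I : DDP V E}

theorem Finsupp.eq_of_mem_support_single {α : Type*} {a b : α} {x : ℝ≥0}
    (h : b ∈ (Finsupp.single a x).support) : b = a ∧ x ≠ 0 := by
  classical
  rw [Finsupp.mem_support_iff, Finsupp.single_apply] at h
  split_ifs at h with hab
  · exact ⟨hab.symm, h⟩
  · exact absurd rfl h

theorem capacity_le {γ a : ℝ≥0} {i : ExtEdge} (ha : 0 < a) (h : i.scale / γ ≤ a) (hγ : 0 < γ) :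
    i.scale * a⁻¹ ≤ γ := by
  rw [← div_eq_mul_inv, div_le_iff₀ ha, mul_comm]
  exact (div_le_iff₀ hγ).1 h

/-- In a subnetwork of the skeleton whose part in `D` is not good, some flow that cannot be
extended along unsaturated paths has rate at most `3 γ`. -/
theorem exists_bad_start {ε : ℝ≥0} {hε : 0 < ε} {a : ExtEdge → ℝ≥0} {ha : ∀ i, 0 < a i} {γ : ℝ≥0}
    (hγ : 0 < γ) (haγ : ∀ i, i.scale / γ ≤ a i) (hεγ : ε * (3 * γ) ≤ 1)
    {H : Set (AmpEdge E Unit)} (hgood : ¬ I.Good {e | .base e ∈ H}) :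
    ∃ f₀ : List (AmpEdge E Unit) →₀ ℝ≥0,
      (∀ π ∈ f₀.support, (skel I).IsPathIn H .s π .t) ∧ (skeleton I ε hε a ha).cost f₀ ≤ 1 ∧
      ∀ f, f₀ ≤ f → (∀ π ∈ f.support, (skel I).IsPathIn H .s π .t) →
        (skeleton I ε hε a ha).cost f ≤ 1 → rate f ≤ 3 * γ := by
  classical
  -- At cost 1 an edgework carries at most `1 / a i`, and nothing if it is missing. These capacities
  -- are at most `γ`, and at most `2γ` for `e₁` and `e₃`.
  set c : ExtEdge → ℝ≥0 := fun i => if .work i () ∈ H then (a i)⁻¹ else 0 with hc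
  have hcγ : ∀ i, i.scale * c i ≤ γ := by
    intro i
    simp only [hc]
    split_ifs
    · exact capacity_le (ha i) (haγ i) hγ
    · simp
  have hc1 : c .e₁ ≤ 2 * γ := by
    have := hcγ .e₁
    rw [ExtEdge.scale, one_div, inv_mul_le_iff₀ (by norm_num)] at this
    exact this
  have hc3 : c .e₃ ≤ 2 * γ := by
    have := hcγ .e₃
    rw [ExtEdge.scale, one_div, inv_mul_le_iff₀ (by norm_num)] at this
    exact this
  have hc4 : c .e₄ ≤ γ := by simpa [ExtEdge.scale] using hcγ .e₄
  have hc5 : c .e₅ ≤ γ := by simpa [ExtEdge.scale] using hcγ .e₅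
  have hc6 : c .e₆ ≤ γ := by simpa [ExtEdge.scale] using hcγ .e₆
  have hc7 : c .e₇ ≤ γ := by simpa [ExtEdge.scale] using hcγ .e₇
  have hc8 : c .e₈ ≤ γ := by simpa [ExtEdge.scale] using hcγ .e₈
  have hc9 : c .e₉ ≤ γ := by simpa [ExtEdge.scale] using hcγ .e₉
  have hmem : ∀ i, c i ≠ 0 → .work i () ∈ H := by
    intro i hi
    by_contra h
    exact hi (if_neg h)
  have hcap : ∀ f, (∀ π ∈ f.support, (skel I).IsPathIn H .s π .t) →
      (skeleton I ε hε a ha).cost f ≤ 1 → ∀ i, load f (.work i ()) ≤ c i := by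
    intro f hf hcost i
    by_cases hi : .work i () ∈ H
    · simp only [hc, if_pos hi]
      rw [← one_div, le_div_iff₀ (ha i), mul_comm]
      exact ((skeleton I ε hε a ha).coef_mul_load_le_cost f (.work i ())).trans hcost
    · rw [load_eq_zero]
      · exact zero_le
      · exact fun π hπ hiπ => hi ((hf π hπ).2 _ hiπ)
  have hstart : ∀ f, rate f ≤ 3 * γ → (∀ i, load f (.work i ()) ≤ c i) →
      (skeleton I ε hε a ha).cost f ≤ 1 := by
    intro f hf hl
    rw [cost_le_iff]
    have hε' : ∀ e, ε * load f e ≤ 1 := fun e =>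
      (mul_le_mul_right ((load_le_rate f e).trans hf) ε).trans hεγ
    rintro (_ | e | ⟨i, ⟨⟩⟩)
    · exact hε' _
    · exact hε' _
    · refine (mul_le_mul_right (hl i) (a i)).trans ?_
      simp only [hc]
      split_ifs
      · rw [mul_inv_cancel₀ (ha i).ne']
      · simp
  have hc' : ∀ f, (∀ π ∈ f.support, (skel I).IsPathIn H .s π .t) →
      ∀ e, e ∉ H → load f e = 0 := fun f hf e he =>
    load_eq_zero f e fun π hπ heπ => he ((hf π hπ).2 _ heπ)
  have hreal : ∀ f, (∀ π ∈ f.support, (skel I).IsPathIn H .s π .t) →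
      (rate f : ℝ) = load f (.work .e₁ ()) + load f (.work .e₄ ()) + load f (.work .e₆ ()) ∧
      (rate f : ℝ) = load f (.work .e₃ ()) + load f (.work .e₈ ()) + load f (.work .e₉ ()) ∧
      (load f (.work .e₄ ()) : ℝ) + load f .e₂ = load f (.work .e₃ ()) + load f (.work .e₅ ()) ∧
      (load f (.work .e₁ ()) : ℝ) + load f (.work .e₇ ()) = load f .e₂ + load f (.work .e₈ ()) := by
    intro f hf
    have hf' := fun π hπ => (hf π hπ).1
    exact ⟨by exact_mod_cast skel_rate_source hf', by exact_mod_cast skel_rate_target hf',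
      by exact_mod_cast skel_load_v hf', by exact_mod_cast skel_load_u hf'⟩
  have hcapR : ∀ f, (∀ π ∈ f.support, (skel I).IsPathIn H .s π .t) →
      (skeleton I ε hε a ha).cost f ≤ 1 → ∀ i, (load f (.work i ()) : ℝ) ≤ c i :=
    fun f hf hcost i => by exact_mod_cast hcap f hf hcost i
  have hR1 : (c .e₁ : ℝ) ≤ 2 * γ := by exact_mod_cast hc1
  have hR3 : (c .e₃ : ℝ) ≤ 2 * γ := by exact_mod_cast hc3
  have hR4 : (c .e₄ : ℝ) ≤ γ := by exact_mod_cast hc4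
  have hR5 : (c .e₅ : ℝ) ≤ γ := by exact_mod_cast hc5
  have hR6 : (c .e₆ : ℝ) ≤ γ := by exact_mod_cast hc6
  have hR7 : (c .e₇ : ℝ) ≤ γ := by exact_mod_cast hc7
  have hR8 : (c .e₈ : ℝ) ≤ γ := by exact_mod_cast hc8
  have hR9 : (c .e₉ : ℝ) ≤ γ := by exact_mod_cast hc9
  by_cases h2 : .e₂ ∈ H
  swap
  -- Without `e₂`, conservation at `u` gives `l₁ ≤ l₈`, so every flow has rate `l₁ + l₄ + l₆ ≤ l₈ +
  -- l₄ + l₆ ≤ 3γ`.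
  · refine ⟨0, by simp, by simp [cost], fun f _ hf hcost => ?_⟩
    obtain ⟨e1, e2, e3, e4⟩ := hreal f hf
    have hl := hcapR f hf hcost
    have h0 : (load f .e₂ : ℝ) = 0 := by exact_mod_cast hc' f hf _ h2
    have : (rate f : ℝ) ≤ 3 * γ := by
      linarith [hl .e₄, hl .e₆, hl .e₈, (load f (.work .e₇ ())).coe_nonneg]
    exact_mod_cast this
  -- The amount that fits on `e₁e₂e₃`. Once `l₂ ≥ m`, the contribution `l₁ + l₃ - l₂` to the rate is
  -- at most `max (c₁, c₃) ≤ 2γ`.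
  set m := min (c .e₁) (c .e₃) with hm
  have hm1 : m ≤ c .e₁ := min_le_left _ _
  have hm3 : m ≤ c .e₃ := min_le_right _ _
  have hX : m ≠ 0 → (skel I).IsPathIn H .s [.work .e₁ (), .e₂, .work .e₃ ()] .t := by
    intro hm0
    have hmp := pos_iff_ne_zero.2 hm0
    refine ⟨skel_isPath_e₁e₂e₃, ?_⟩
    simp only [List.forall_mem_cons]
    exact ⟨hmem _ (hmp.trans_le hm1).ne', h2, hmem _ (hmp.trans_le hm3).ne', by simp⟩
  by_cases hcross : I.Reach {e | .base e ∈ H} I.s₁ I.t₂ ∧ I.Reach {e | .base e ∈ H} I.s₂ I.t₁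
  · obtain ⟨⟨q, hq, hqH⟩, ⟨p, hp, hpH⟩⟩ := hcross
    -- Both crossing paths pass through `e₂`. Replacing `y` units on `e₁e₂e₃` by `y` units on each
    -- crossing path keeps the loads of `e₁` and `e₃` at `m` and raises that of `e₂` to `m + y`.
    set y := min m (min (min (c .e₅) (c .e₆)) (min (c .e₇) (c .e₉))) with hy
    have hym : y ≤ m := min_le_left _ _
    have hy' : y ≤ min (min (c .e₅) (c .e₆)) (min (c .e₇) (c .e₉)) := min_le_right _ _
    have hy5 : y ≤ c .e₅ := hy'.trans ((min_le_left _ _).trans (min_le_left _ _))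
    have hy6 : y ≤ c .e₆ := hy'.trans ((min_le_left _ _).trans (min_le_right _ _))
    have hy7 : y ≤ c .e₇ := hy'.trans ((min_le_right _ _).trans (min_le_left _ _))
    have hy9 : y ≤ c .e₉ := hy'.trans ((min_le_right _ _).trans (min_le_right _ _))
    have hX1 : y ≠ 0 → (skel I).IsPathIn H .s
        ([.work .e₁ (), .e₂, .work .e₅ ()] ++ q.map .base ++ [.work .e₉ ()]) .t := by
      intro hy0
      have hyp := pos_iff_ne_zero.2 hy0
      refine ⟨skel_isPath_e₁e₂e₅e₉ hq, ?_⟩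
      simp only [List.forall_mem_append, List.forall_mem_cons, List.forall_mem_map]
      exact ⟨⟨⟨hmem _ (hyp.trans_le (hym.trans hm1)).ne', h2,
        hmem _ (hyp.trans_le hy5).ne', by simp⟩, hqH⟩, hmem _ (hyp.trans_le hy9).ne', by simp⟩
    have hX2 : y ≠ 0 → (skel I).IsPathIn H .s
        ([.work .e₆ ()] ++ p.map .base ++ [.work .e₇ (), .e₂, .work .e₃ ()]) .t := by
      intro hy0
      have hyp := pos_iff_ne_zero.2 hy0
      refine ⟨skel_isPath_e₆e₇e₂e₃ hp, ?_⟩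
      simp only [List.forall_mem_append, List.forall_mem_cons, List.forall_mem_map]
      exact ⟨⟨⟨hmem _ (hyp.trans_le hy6).ne', by simp⟩, hpH⟩, hmem _ (hyp.trans_le hy7).ne', h2,
        hmem _ (hyp.trans_le (hym.trans hm3)).ne', by simp⟩
    have hmy : y + (m - y) = m := add_tsub_cancel_of_le hym
    refine ⟨Finsupp.single ([.work .e₁ (), .e₂, .work .e₅ ()] ++ q.map .base ++ [.work .e₉ ()]) y +
      Finsupp.single ([.work .e₆ ()] ++ p.map .base ++ [.work .e₇ (), .e₂, .work .e₃ ()]) y +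
      Finsupp.single [.work .e₁ (), .e₂, .work .e₃ ()] (m - y), ?_, ?_, ?_⟩
    · intro π hπ
      rcases Finset.mem_union.1 (Finsupp.support_add hπ) with hπ | hπ
      · rcases Finset.mem_union.1 (Finsupp.support_add hπ) with hπ | hπ
        · obtain ⟨rfl, h0⟩ := Finsupp.eq_of_mem_support_single hπ
          exact hX1 h0
        · obtain ⟨rfl, h0⟩ := Finsupp.eq_of_mem_support_single hπ
          exact hX2 h0
      · obtain ⟨rfl, h0⟩ := Finsupp.eq_of_mem_support_single hπ
        exact hX fun hm0 => h0 (by simp [hm0])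
    · apply hstart
      · simp only [rate_add, rate_single]
        calc y + y + (m - y) = y + m := by rw [add_assoc, hmy]
          _ ≤ γ + 2 * γ := add_le_add (hy5.trans hc5) (hm1.trans hc1)
          _ = 3 * γ := by ring
      · intro i
        simp only [load_add, load_single]
        cases i <;> simp [hmy, hm1, hm3, hy5, hy6, hy7, hy9]
    · intro f hle hf hcost
      obtain ⟨e1, e2, e3, e4⟩ := hreal f hf
      have hl := hcapR f hf hcost
      have h0 : (y : ℝ) + m ≤ load f .e₂ := by
        have h1 := load_mono hle .e₂
        simp only [load_add, load_single] at h1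
        simp [add_assoc, hmy] at h1
        exact_mod_cast h1
      have : (rate f : ℝ) ≤ 3 * γ := by
        have l1 := hl .e₁
        have l3 := hl .e₃
        have l4 := hl .e₄
        have l5 := hl .e₅
        have l6 := hl .e₆
        have l7 := hl .e₇
        have l8 := hl .e₈
        have l9 := hl .e₉
        -- If `y = m`, then `c₁ ≤ γ` or `c₃ ≤ γ`, and the cut at `s` or at `t` alone gives `3γ`.
        rcases min_choice m (min (min (c .e₅) (c .e₆)) (min (c .e₇) (c .e₉))) with h | h
        · rcases min_choice (c .e₁) (c .e₃) with h' | h'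
          · have : (c .e₁ : ℝ) ≤ c .e₅ := by
              rw [← h', ← hm, ← h]
              exact_mod_cast hy5
            linarith
          · have : (c .e₃ : ℝ) ≤ c .e₅ := by
              rw [← h', ← hm, ← h]
              exact_mod_cast hy5
            linarith
        -- Otherwise `y` is one of these capacities. In the matching formula for the rate, `l₂ ≥ m +
        -- y` cancels it together with `min (c₁, c₃)`; what remains is at most `2γ + γ`.
        · have hyc : y = c .e₅ ∨ y = c .e₆ ∨ y = c .e₇ ∨ y = c .e₉ := by
            rw [hy, h]
            rcases min_choice (min (c .e₅) (c .e₆)) (min (c .e₇) (c .e₉)) with h1 | h1 <;> rw [h1]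
            · rcases min_choice (c .e₅) (c .e₆) with h2 | h2 <;> rw [h2] <;> simp
            · rcases min_choice (c .e₇) (c .e₉) with h2 | h2 <;> rw [h2] <;> simp
          have hyc' : (y : ℝ) = c .e₅ ∨ (y : ℝ) = c .e₆ ∨ (y : ℝ) = c .e₇ ∨ (y : ℝ) = c .e₉ := by
            exact_mod_cast hyc
          have hmc : (m : ℝ) = c .e₁ ∨ (m : ℝ) = c .e₃ := by
            rcases min_choice (c .e₁) (c .e₃) with h' | h'
            · exact .inl (by rw [hm, h'])
            · exact .inr (by rw [hm, h'])
          rcases hyc' with h | h | h | h <;> rcases hmc with h' | h' <;> linarith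
      exact_mod_cast this
  · refine ⟨Finsupp.single [.work .e₁ (), .e₂, .work .e₃ ()] m, ?_, ?_, ?_⟩
    · intro π hπ
      obtain ⟨rfl, h0⟩ := Finsupp.eq_of_mem_support_single hπ
      exact hX h0
    · apply hstart
      · rw [rate_single]
        refine (hm1.trans hc1).trans ?_
        gcongr
        norm_num
      · intro i
        simp only [load_single]
        cases i <;> simp [hm1, hm3]
    · intro f hle hf hcost
      obtain ⟨e1, e2, e3, e4⟩ := hreal f hf
      have hl := hcapR f hf hcost
      have h0 : (m : ℝ) ≤ load f .e₂ := by
        have h1 := load_mono hle .e₂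
        simp only [load_single] at h1
        simp at h1
        exact_mod_cast h1
      have hmc : (m : ℝ) = c .e₁ ∨ (m : ℝ) = c .e₃ := by
        rcases min_choice (c .e₁) (c .e₃) with h' | h'
        · exact .inl (by rw [hm, h'])
        · exact .inr (by rw [hm, h'])
      -- A crossing connection is missing, so failing to be good means that some terminal is cut off
      -- from both of its possible partners. The external edge at this terminal is then useless, and
      -- one of the two formulas for the rate loses a summand.
      have hzero : (load f (.work .e₅ ()) = 0 ∨ load f (.work .e₆ ()) = 0) ∨
          (load f (.work .e₇ ()) = 0 ∨ load f (.work .e₉ ()) = 0) := by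
        set S : Set E := {e | .base e ∈ H} with hS
        have hcases : (¬ I.Reach S I.s₁ I.t₁ ∧ ¬ I.Reach S I.s₁ I.t₂) ∨
            (¬ I.Reach S I.s₂ I.t₁ ∧ ¬ I.Reach S I.s₂ I.t₂) ∨
            (¬ I.Reach S I.s₁ I.t₁ ∧ ¬ I.Reach S I.s₂ I.t₁) ∨
            (¬ I.Reach S I.s₁ I.t₂ ∧ ¬ I.Reach S I.s₂ I.t₂) := by
          unfold DDP.Good at hgood
          tauto
        have hfwd : ∀ x, ∀ π ∈ f.support, ∀ e, .base e ∈ π → I.src e ∈ {z | I.Reach S x z} →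
            I.tgt e ∈ {z | I.Reach S x z} := fun x π hπ e he hx =>
          DiMultigraph.Reach.trans _ hx (DiMultigraph.Reach.edge _ ((hf π hπ).2 _ he))
        have hbwd : ∀ x, ∀ π ∈ f.support, ∀ e, .base e ∈ π → I.tgt e ∈ {z | I.Reach S z x} →
            I.src e ∈ {z | I.Reach S z x} := fun x π hπ e he hx =>
          DiMultigraph.Reach.trans _ (DiMultigraph.Reach.edge _ ((hf π hπ).2 _ he)) hx
        rcases hcases with ⟨h1, h2⟩ | ⟨h1, h2⟩ | ⟨h1, h2⟩ | ⟨h1, h2⟩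
        · exact .inl (.inl (load_eq_zero _ _ fun π hπ =>
            (notMem_of_closed (hf π hπ).1 (hfwd I.s₁ π hπ) h1 h2).1 (.refl _ _ _)))
        · exact .inl (.inr (load_eq_zero _ _ fun π hπ =>
            (notMem_of_closed (hf π hπ).1 (hfwd I.s₂ π hπ) h1 h2).2 (.refl _ _ _)))
        · exact .inr (.inl (load_eq_zero _ _ fun π hπ =>
            (notMem_of_coclosed (hf π hπ).1 (hbwd I.t₁ π hπ) h1 h2).1 (.refl _ _ _)))
        · exact .inr (.inr (load_eq_zero _ _ fun π hπ =>
            (notMem_of_coclosed (hf π hπ).1 (hbwd I.t₂ π hπ) h1 h2).2 (.refl _ _ _)))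
      have hzero' : ((load f (.work .e₅ ()) : ℝ) = 0 ∨ (load f (.work .e₆ ()) : ℝ) = 0) ∨
          ((load f (.work .e₇ ()) : ℝ) = 0 ∨ (load f (.work .e₉ ()) : ℝ) = 0) := by
        exact_mod_cast hzero
      have : (rate f : ℝ) ≤ 3 * γ := by
        have l1 := hl .e₁
        have l3 := hl .e₃
        have l5 := hl .e₅
        have l6 := hl .e₆
        have l7 := hl .e₇
        have l9 := hl .e₉
        rcases hzero' with (h | h) | h | h <;> rcases hmc with h' | h' <;> linarith
      exact_mod_cast this

theorem exists_bad_nash [Finite E] {ε : ℝ≥0} {hε : 0 < ε} {a : ExtEdge → ℝ≥0} {ha : ∀ i, 0 < a i}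
    {γ : ℝ≥0} (hγ : 0 < γ) (haγ : ∀ i, i.scale / γ ≤ a i) (hεγ : ε * (3 * γ) ≤ 1)
    {H : Set (AmpEdge E Unit)} (hgood : ¬ I.Good {e | .base e ∈ H})
    (hp : ∃ π, (skel I).IsPathIn H .s π .t) {r : ℝ≥0} (hr : 0 < r) :
    ∃ h, (skeleton I ε hε a ha).IsNash H r h ∧
      r / (3 * γ) ≤ (skeleton I ε hε a ha).cost h := by
  obtain ⟨f₀, h1, h2, h3⟩ := exists_bad_start (ha := ha) hγ haγ hεγ hgood (hε := hε)
  obtain ⟨f, hle, hf, hfc, hfb⟩ := (skeleton I ε hε a ha).exists_blocking_extension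
    (by simp [skeleton]) H 1 f₀ h1 h2
  obtain ⟨hpos, g, hg, hgc⟩ := (skeleton I ε hε a ha).exists_nash_of_blocking one_pos f hf hfc hfb
    hp hr
  refine ⟨g, hg, ?_⟩
  rw [hgc, mul_one]
  have := h3 f hle hf hfc
  gcongr

end BadNash

/-! ### The amplified network is a gap instance -/

section Gap

variable {V E W F K : Type*} {I : DDP V E} {N : LinNetwork W F} {copies : K → DCopy I N}
  {γ₁ γ₂ : ℝ≥0}

theorem IsGapInstance.s_ne_t (hG : IsGapInstance I N copies γ₁ γ₂) : N.s ≠ N.t := by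
  obtain ⟨⟨f, hf, hc⟩, -⟩ := hG.opt 1 one_pos
  refine N.s_ne_t_of_cost_pos hf ?_
  rw [hc]
  exact div_pos one_pos (hG.pos.trans hG.lt)

/-- The rate of a flow of the amplified network is at most `4 γ₁` times its cost. -/
theorem rate_le_of_amplify {ε : ℝ≥0} {hε : 0 < ε} (hG : IsGapInstance I N copies γ₁ γ₂)
    {H : Set (AmpEdge E N.Kept)} {f : List (AmpEdge E N.Kept) →₀ ℝ≥0}
    (hf : ∀ p ∈ f.support, (amplify I N ε hε).IsSTPath H p) :
    rate f ≤ 4 * γ₁ * (amplify I N ε hε).cost f := by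
  obtain ⟨h, k, hh, hr, hk, hkr, hkl⟩ := exists_projection I hG.s_ne_t hf
  have hγ₁ : 0 < γ₁ := hG.pos.trans hG.lt
  -- The flow inside an edgework costs at least the optimum of `N` at its rate.
  have key : ∀ i, i.scale * load h (.work i ()) ≤ γ₁ * (amplify I N ε hε).cost f := by
    intro i
    rw [← hkr]
    rcases eq_zero_or_pos (rate (k i)) with h0 | h0
    · rw [h0, mul_zero]
      exact zero_le
    · have h1 := (hG.opt _ h0).2 ⟨k i, ⟨fun p hp => ⟨(hk i p hp).1, by simp⟩, rfl⟩, rfl⟩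
      rw [div_le_iff₀ hγ₁] at h1
      calc _ ≤ i.scale * (N.cost (k i) * γ₁) := by gcongr
        _ = γ₁ * (i.scale * N.cost (k i)) := by ring
        _ ≤ _ := by
          gcongr
          exact scale_mul_cost_projection_le I (hk i) (hkl i)
  rw [← hr, skel_rate_source fun π hπ => (hh π hπ).1]
  have h1 := key .e₁
  have h4 := key .e₄
  have h6 := key .e₆
  simp only [ExtEdge.scale, one_mul, one_div] at h1 h4 h6
  rw [inv_mul_le_iff₀ (by norm_num)] at h1
  calc _ ≤ 2 * (γ₁ * (amplify I N ε hε).cost f) + γ₁ * (amplify I N ε hε).cost f +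
      γ₁ * (amplify I N ε hε).cost f := by gcongr
    _ = _ := by ring

theorem amplify_isOptCost {ε : ℝ≥0} {hε : 0 < ε} (hI : I.HasCrossingPaths)
    (hG : IsGapInstance I N copies γ₁ γ₂) (hlt : ε < 1 / (4 * γ₁)) (r : ℝ≥0) :
    (amplify I N ε hε).IsOptCost r (r / (4 * γ₁)) := by
  classical
  have hγ₁ : 0 < γ₁ := hG.pos.trans hG.lt
  have hlow : ∀ f, (amplify I N ε hε).IsFlow Set.univ r f →
      r / (4 * γ₁) ≤ (amplify I N ε hε).cost f := by
    intro f hf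
    rw [div_le_iff₀ (by positivity), mul_comm]
    exact hf.2 ▸ rate_le_of_amplify hG hf.1
  refine ⟨?_, ?_⟩
  swap
  · rintro _ ⟨f, hf, rfl⟩
    exact hlow f hf
  obtain ⟨q, p, hq, hp, -⟩ := hI
  obtain ⟨⟨g, hg, hgc⟩, -⟩ := hG.opt 1 one_pos
  -- In the skeleton this flow puts `r/2` on the halved edgeworks `e₁`, `e₃` and `r/4` on all
  -- others, so that all edgeworks cost the same.
  set h : List (AmpEdge E Unit) →₀ ℝ≥0 :=
    Finsupp.single [.work .e₁ (), .e₂, .work .e₃ ()] (r / 2) +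
    Finsupp.single ([.work .e₆ ()] ++ p.map .base ++ [.work .e₇ (), .work .e₈ ()]) (r / 4) +
    Finsupp.single ([.work .e₄ (), .work .e₅ ()] ++ q.map .base ++ [.work .e₉ ()]) (r / 4) with hh
  have hhr : rate h = r := by
    simp only [hh, rate_add, rate_single]
    apply NNReal.eq
    push_cast
    ring
  have hhp : ∀ π ∈ h.support, (skel I).IsPath .s π .t := by
    intro π hπ
    rcases Finset.mem_union.1 (Finsupp.support_add hπ) with hπ | hπ
    · rcases Finset.mem_union.1 (Finsupp.support_add hπ) with hπ | hπ
      · obtain ⟨rfl, h0⟩ := Finsupp.eq_of_mem_support_single hπ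
        exact skel_isPath_e₁e₂e₃
      · obtain ⟨rfl, h0⟩ := Finsupp.eq_of_mem_support_single hπ
        exact skel_isPath_e₆e₇e₈ hp
    · obtain ⟨rfl, h0⟩ := Finsupp.eq_of_mem_support_single hπ
      exact skel_isPath_e₄e₅e₉ hq
  have hrate : ∀ _ : ExtEdge, rate g = 1 := fun _ => hg.2
  have hf : (amplify I N ε hε).IsFlow Set.univ r (liftFlow N h fun _ => g) :=
    ⟨fun p hp => ⟨support_liftFlow_isPath I hG.s_ne_t hhp (fun _ _ => hg.1) hp, by simp⟩,
      (rate_liftFlow hrate).trans hhr⟩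
  refine ⟨_, hf, le_antisymm ?_ (hlow _ hf)⟩
  have hsmall : ∀ e, ε * load h e ≤ r / (4 * γ₁) := by
    intro e
    calc _ ≤ 1 / (4 * γ₁) * r := mul_le_mul' hlt.le (hhr ▸ load_le_rate h e)
      _ = _ := by rw [one_div, mul_comm, div_eq_mul_inv]
  refine cost_liftFlow_le I hrate (hsmall _) (fun e => hsmall _) fun i => ?_
  have hload : i.scale * load h (.work i ()) ≤ r / 4 := by
    simp only [hh, load_add, load_single]
    have h24 : 2⁻¹ * (r / 2) ≤ r / 4 := by
      rw [inv_mul_eq_div, div_div]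
      norm_num
    cases i <;> simp [ExtEdge.scale, h24]
  rw [hgc]
  calc _ = i.scale * load h (.work i ()) * (1 / γ₁) := by ring
    _ ≤ r / 4 * (1 / γ₁) := by gcongr
    _ = _ := by rw [div_mul_div_comm, mul_one]

/-- In a NO-like subnetwork, the bad equilibria of the edgeworks combine to a bad equilibrium. -/
theorem amplify_worstCostGE [Finite E] {ε : ℝ≥0} {hε : 0 < ε}
    (hG : IsGapInstance I N copies γ₁ γ₂) (hlt : ε < 1 / (4 * γ₁))
    {H : Set (AmpEdge E N.Kept)} (hgood : ¬ I.Good {e | .base e ∈ H})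
    (hw : ∀ i, N.WorstCostGE (workPart H i) 1 (1 / γ₂)) {r : ℝ≥0} (hr : 0 < r) :
    (amplify I N ε hε).WorstCostGE H r (r / (3 * γ₂)) := by
  classical
  rintro ⟨p, hp⟩
  have hst := hG.s_ne_t
  have hex : ∀ i, ∃ g, rate g = 1 ∧ ((∃ p, N.IsSTPath (workPart H i) p) →
      N.IsNash (workPart H i) 1 g ∧ 1 / γ₂ ≤ N.cost g) := by
    intro i
    by_cases hi : ∃ p, N.IsSTPath (workPart H i) p
    · obtain ⟨g, hg, hgc⟩ := hw i hi
      exact ⟨g, hg.1.2, fun _ => ⟨hg, hgc⟩⟩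
    -- A dummy unit flow: lifting needs rate 1 also in edgeworks that no path can traverse.
    · exact ⟨Finsupp.single [] 1, rate_single _ _, fun h => absurd h hi⟩
  choose g hg1 hg2 using hex
  set a : ExtEdge → ℝ≥0 := fun i =>
    if ∃ p, N.IsSTPath (workPart H i) p then i.scale * N.cost (g i) else i.scale / γ₂ with ha
  have hle : ∀ i, i.scale / γ₂ ≤ a i := by
    intro i
    simp only [ha]
    split_ifs with hi
    · rw [div_eq_mul_one_div]
      exact mul_le_mul_right (hg2 i hi).2 _
    · exact le_rfl
  have hapos : ∀ i, 0 < a i := fun i => (div_pos i.scale_pos hG.pos).trans_le (hle i)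
  have hεγ : ε * (3 * γ₂) ≤ 1 := by
    have h1 : 3 * γ₂ ≤ 4 * γ₁ := mul_le_mul' (by norm_num) hG.lt.le
    calc _ ≤ 1 / (4 * γ₁) * (4 * γ₁) := mul_le_mul' hlt.le h1
      _ = 1 := one_div_mul_cancel (mul_pos (by norm_num) (hG.pos.trans hG.lt)).ne'
  obtain ⟨P, π, -, hπ, -⟩ := exists_liftPath_of_isSTPath I hst hp
  obtain ⟨h, hh, hhc⟩ := exists_bad_nash (I := I) (hε := hε) (ha := hapos) (H := skelPart H)
    hG.pos hle hεγ hgood ⟨π, hπ⟩ hr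
  obtain ⟨h1, h2⟩ := isNash_liftFlow I hst hg1 (fun i hi => (hg2 i hi).1)
    (fun i hi => if_pos hi) hr hh
  exact ⟨_, h1, hhc.trans h2⟩

/-- If every path of the skeleton within two disjoint paths of `D` contains a blocked edge, and
blocked edges carry much flow, then the rate of the flow is large. -/
theorem rate_ge_of_blocked {p q : List E} (hp : I.IsPath I.s₁ p I.t₁) (hq : I.IsPath I.s₂ q I.t₂)
    (hpq : (I.verts I.s₁ p).Disjoint (I.verts I.s₂ q)) {h : List (AmpEdge E Unit) →₀ ℝ≥0}
    (hh : ∀ π ∈ h.support, (skel I).IsPath .s π .t)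
    (hcomp : ∀ π ∈ h.support, ∀ e, .base e ∈ π → e ∈ p ∨ e ∈ q) (blocked : ExtEdge → Prop)
    {c : ℝ≥0} (hcut : ∀ π, (skel I).IsPath .s π .t → (∀ e, .base e ∈ π → e ∈ p ∨ e ∈ q) →
      ∃ i, .work i () ∈ π ∧ blocked i)
    (hblocked : ∀ i, blocked i → c ≤ i.scale * load h (.work i ())) : 4 * c ≤ rate h := by
  classical
  have hpv : ∀ e ∈ p, I.src e ∈ I.verts I.s₁ p ∧ I.tgt e ∈ I.verts I.s₁ p := fun e he =>
    ⟨hp.1.src_mem_verts _ he, List.mem_cons_of_mem _ (List.mem_map_of_mem he)⟩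
  have hqv : ∀ e ∈ q, I.src e ∈ I.verts I.s₂ q ∧ I.tgt e ∈ I.verts I.s₂ q := fun e he =>
    ⟨hq.1.src_mem_verts _ he, List.mem_cons_of_mem _ (List.mem_map_of_mem he)⟩
  have hSp : ∀ π ∈ h.support, ∀ e, .base e ∈ π →
      (I.src e ∈ {z | z ∈ I.verts I.s₁ p} ↔ I.tgt e ∈ {z | z ∈ I.verts I.s₁ p}) := by
    intro π hπ e he
    rcases hcomp π hπ e he with h | h
    · exact iff_of_true (hpv e h).1 (hpv e h).2
    · exact iff_of_false (fun h' => hpq h' (hqv e h).1) (fun h' => hpq h' (hqv e h).2)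
  have hs₁ : I.s₁ ∈ I.verts I.s₁ p := List.mem_cons_self
  have hs₂ : I.s₂ ∈ I.verts I.s₂ q := List.mem_cons_self
  have ht₁ : I.t₁ ∈ I.verts I.s₁ p := hp.1.target_mem_verts
  have ht₂ : I.t₂ ∈ I.verts I.s₂ q := hq.1.target_mem_verts
  have hs₂' : I.s₂ ∉ I.verts I.s₁ p := fun h => hpq h hs₂
  have ht₂' : I.t₂ ∉ I.verts I.s₁ p := fun h => hpq h ht₂
  have hs₁' : I.s₁ ∉ I.verts I.s₂ q := fun h => hpq hs₁ h
  have ht₁' : I.t₁ ∉ I.verts I.s₂ q := fun h => hpq ht₁ h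
  -- The path `p` is a union of components of the retained part of `D`. It is entered from outside
  -- only at `s₁` and left only at `t₁`.
  have h57 : load h (.work .e₇ ()) ≤ load h (.work .e₅ ()) := by
    refine load_le_of_imp fun π hπ h7 => ?_
    have := onPath_component (hh π hπ) (hSp π hπ)
    simp only [Set.mem_ofPred_eq, hs₁, ht₁, hs₂', ht₂', if_true, if_false, add_zero, onPath,
      h7] at this
    by_contra h5
    simp [h5] at this
  have h54 : load h (.work .e₅ ()) ≤ load h (.work .e₄ ()) :=
    load_le_of_imp fun π hπ h5 => mem_e₄_of_mem_e₅ (hh π hπ) (hSp π hπ) hs₁ ht₂' h5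
  have hS' : ∀ π ∈ h.support, ∀ e, .base e ∈ π →
      (I.src e ∈ {z | z ∈ I.verts I.s₂ q} ↔ I.tgt e ∈ {z | z ∈ I.verts I.s₂ q}) := by
    intro π hπ e he
    rcases hcomp π hπ e he with h | h
    · exact iff_of_false (fun h' => hpq (hpv e h).1 h') (fun h' => hpq (hpv e h).2 h')
    · exact iff_of_true (hqv e h).1 (hqv e h).2
  have h69 : ∀ π ∈ h.support, onPath π (.work .e₆ ()) = onPath π (.work .e₉ ()) := by
    intro π hπ
    have := onPath_component (hh π hπ) (hS' π hπ)
    simpa [hs₂, ht₂, hs₁', ht₁'] using this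
  have h69' : ∀ π ∈ h.support, (.work .e₆ () ∈ π ↔ .work .e₉ () ∈ π) := by
    intro π hπ
    have := h69 π hπ
    unfold onPath at this
    split_ifs at this <;> simp_all
  have h96 : load h (.work .e₆ ()) = load h (.work .e₉ ()) :=
    le_antisymm (load_le_of_imp fun π hπ => (h69' π hπ).1)
      (load_le_of_imp fun π hπ => (h69' π hπ).2)
  -- Five skeleton paths, each of which contains a blocked edgework, suffice for the bound.
  have hA : blocked .e₁ ∨ blocked .e₈ := by
    obtain ⟨i, hi, hb⟩ := hcut _ skel_isPath_e₁e₈ (by simp)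
    cases i <;> simp at hi <;> simp [hb]
  have hB : blocked .e₁ ∨ blocked .e₃ := by
    obtain ⟨i, hi, hb⟩ := hcut _ skel_isPath_e₁e₂e₃ (by simp)
    cases i <;> simp at hi <;> simp [hb]
  have hC : blocked .e₄ ∨ blocked .e₃ := by
    obtain ⟨i, hi, hb⟩ := hcut _ skel_isPath_e₄e₃ (by simp)
    cases i <;> simp at hi <;> simp [hb]
  have hD : blocked .e₄ ∨ blocked .e₅ ∨ blocked .e₇ ∨ blocked .e₈ := by
    obtain ⟨i, hi, hb⟩ := hcut _ (skel_isPath_e₄e₅e₇e₈ hp) (fun e he => .inl (by simpa using he))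
    cases i <;> simp at hi <;> simp [hb]
  have hE : blocked .e₆ ∨ blocked .e₉ := by
    obtain ⟨i, hi, hb⟩ := hcut _ (skel_isPath_e₆e₉ hq) (fun e he => .inr (by simpa using he))
    cases i <;> simp at hi <;> simp [hb]
  have hbl1 : ∀ i, i.scale = 1 → blocked i → (c : ℝ) ≤ load h (.work i ()) := by
    intro i hi hb
    have := hblocked i hb
    rw [hi, one_mul] at this
    exact_mod_cast this
  have hbl2 : ∀ i, i.scale = 1 / 2 → blocked i → (c : ℝ) * 2 ≤ load h (.work i ()) := by
    intro i hi hb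
    have := hblocked i hb
    rw [hi, one_div, inv_mul_eq_div, le_div_iff₀ (by norm_num)] at this
    exact_mod_cast this
  have b1 := hbl2 .e₁ rfl
  have b3 := hbl2 .e₃ rfl
  have b4 := hbl1 .e₄ rfl
  have b5 := hbl1 .e₅ rfl
  have b6 := hbl1 .e₆ rfl
  have b7 := hbl1 .e₇ rfl
  have b8 := hbl1 .e₈ rfl
  have b9 := hbl1 .e₉ rfl
  have r1 : (rate h : ℝ) = load h (.work .e₁ ()) + load h (.work .e₄ ()) + load h (.work .e₆ ()) := by
    have := skel_rate_source hh
    exact_mod_cast this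
  have r2 : (rate h : ℝ) = load h (.work .e₃ ()) + load h (.work .e₈ ()) + load h (.work .e₉ ()) := by
    have := skel_rate_target hh
    exact_mod_cast this
  have c57 : (load h (.work .e₇ ()) : ℝ) ≤ load h (.work .e₅ ()) := by exact_mod_cast h57
  have c54 : (load h (.work .e₅ ()) : ℝ) ≤ load h (.work .e₄ ()) := by exact_mod_cast h54
  have c69 : (load h (.work .e₆ ()) : ℝ) = load h (.work .e₉ ()) := by exact_mod_cast h96
  have c6 : (c : ℝ) ≤ load h (.work .e₆ ()) := by
    rcases hE with hE | hE
    · exact b6 hE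
    · exact c69 ▸ b9 hE
  -- Always `l₆ = l₉ ≥ c`. If `e₃` and `e₈` are blocked, the cut at `t` gives `2c + c + c`.
  -- Otherwise `e₁` is blocked and `l₄ ≥ c`, either directly or through `l₇ ≤ l₅ ≤ l₄`, and the cut
  -- at `s` gives `2c + c + c`.
  have hfin : (4 : ℝ) * c ≤ rate h := by
    by_cases h1 : blocked .e₁
    · have b1 := b1 h1
      by_cases h8 : blocked .e₈ ∧ blocked .e₃
      · have b8 := b8 h8.1
        have b3 := b3 h8.2
        linarith
      · have h4 : (c : ℝ) ≤ load h (.work .e₄ ()) := by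
          by_cases h4 : blocked .e₄
          · exact b4 h4
          · have h3 : blocked .e₃ := hC.resolve_left h4
            rcases hD with hD | hD | hD | hD
            · exact absurd hD h4
            · exact (b5 hD).trans c54
            · exact (b7 hD).trans (c57.trans c54)
            · exact absurd ⟨hD, h3⟩ h8
        linarith
    · have b8 := b8 (hA.resolve_left h1)
      have b3 := b3 (hB.resolve_left h1)
      linarith
  exact_mod_cast hfin

/-- Keeping only two disjoint paths of `D` removes the routes that allowed bad equilibria. The
blocked edgeworks of any Nash flow then carry enough flow to bound its cost. -/
theorem amplify_isWorstCost [Finite E] [Finite F] {ε : ℝ≥0} {hε : 0 < ε}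
    (hG : IsGapInstance I N copies γ₁ γ₂) (hlt : ε < 1 / (4 * γ₁)) (hyes : I.IsYes)
    {r : ℝ≥0} (hr : 0 < r) :
    ∃ H, (amplify I N ε hε).IsWorstCost H r (r / (4 * γ₁)) := by
  classical
  have hγ₁ : 0 < γ₁ := hG.pos.trans hG.lt
  have hst := hG.s_ne_t
  obtain ⟨H₀, hH₀⟩ := hG.yes 1 one_pos hyes
  have hworst : ∀ r, 0 < r → N.IsWorstCost H₀ r (r / γ₁) := by
    intro r hr
    have := hH₀.scale N hr
    rwa [mul_one, mul_one_div] at this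
  obtain ⟨p, q, hp, hq, hpq⟩ := hyes
  set H : Set (AmpEdge E N.Kept) := fun e => match e with
    | .e₂ => True
    | .base e => e ∈ p ∨ e ∈ q
    | .work _ f => f.1 ∈ H₀ with hH
  have hpart : ∀ i P, N.IsSTPath (workPart H i) P ↔ N.IsSTPath H₀ P := by
    intro i P
    constructor
    · rintro ⟨h1, h2⟩
      exact ⟨h1, fun e he => (h2 e he).2⟩
    · intro h
      exact ⟨h.1, fun e he => ⟨h.useful N he, h.2 e he⟩⟩
  obtain ⟨P₀, hP₀⟩ : ∃ P, N.IsSTPath H₀ P := by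
    obtain ⟨⟨g, hg, -⟩, -⟩ := hH₀
    obtain ⟨P, -, hP⟩ := hg.1.exists_path N one_pos
    exact ⟨P, hP⟩
  have hwork : ∀ i, .work i () ∈ skelPart H := fun i => ⟨P₀, (hpart i _).2 hP₀⟩
  have h2 : .e₂ ∈ skelPart H := trivial
  refine ⟨H, ?_⟩
  -- All equilibria have the same cost, and one exists because `e₁e₈` provides a path.
  suffices hsuff : ∀ f, (amplify I N ε hε).IsNash H r f →
      (amplify I N ε hε).cost f = r / (4 * γ₁) by
    have hpath : (skel I).IsPathIn (skelPart H) .s [.work .e₁ (), .work .e₈ ()] .t :=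
      ⟨skel_isPath_e₁e₈, by simp [hwork]⟩
    obtain ⟨f, hf⟩ := (amplify I N ε hε).exists_nash (by simp [amplify]) (H := H)
      ⟨_, isSTPath_liftPath I hst (P := fun _ => P₀) hpath fun i _ => (hpart i _).2 hP₀⟩ hr
    refine ⟨⟨f, hf, hsuff f hf⟩, ?_⟩
    rintro _ ⟨f', hf', rfl⟩
    exact (hsuff f' hf').le
  intro f hf
  have hfr : rate f = r := hf.1.2
  set B := (amplify I N ε hε).cost f with hB
  have hlow : r / (4 * γ₁) ≤ B := by
    rw [div_le_iff₀ (by positivity), mul_comm, ← hfr]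
    exact rate_le_of_amplify hG hf.1.1
  have hBpos : 0 < B := (div_pos hr (by positivity)).trans_le hlow
  refine le_antisymm ?_ hlow
  rw [le_div_iff₀ (by positivity)]
  obtain ⟨h, k, hh, hhr, hk, hkr, hkl⟩ := exists_projection I hst hf.1.1
  have hnash := ((isNash_iff _).1 hf).2
  have hsmall : ∀ e, ε * load f e < B := by
    intro e
    refine lt_of_lt_of_le ?_ hlow
    calc _ ≤ ε * r := mul_le_mul_right (hfr ▸ load_le_rate f e) _
      _ < 1 / (4 * γ₁) * r := mul_lt_mul_of_pos_right hlt hr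
      _ = _ := by rw [one_div, mul_comm, div_eq_mul_inv]
  -- An edgework is blocked if all its paths have bottleneck cost at least `B`.
  let blocked : ExtEdge → Prop := fun i =>
    ∀ P, N.IsSTPath H₀ P → B ≤ i.scale * N.pathCost (k i) P
  have hblocked : ∀ i, blocked i → B * γ₁ ≤ i.scale * load h (.work i ()) := by
    intro i hi
    have hpos : 0 < rate (k i) := by
      rw [pos_iff_ne_zero]
      intro h0
      have h1 : N.pathCost (k i) P₀ ≤ 0 := (pathCost_le_iff _).2 fun e _ => by
        have h1 := load_le_rate (k i) e
        rw [h0, nonpos_iff_eq_zero] at h1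
        rw [h1, mul_zero]
      have h2 := hi P₀ hP₀
      rw [nonpos_iff_eq_zero.1 h1, mul_zero] at h2
      exact hBpos.not_ge h2
    have hle := scale_mul_cost_projection_le I (hε := hε) (hk i) (hkl i)
    -- After scaling, the flow in the edgework costs at most `B` and each of its paths costs at
    -- least `B`; so it is a Nash flow of `H₀`, whose cost is at most its rate over `γ₁`.
    have hN : N.IsNash H₀ (rate (k i)) (k i) :=
      N.isNash_iff.2 ⟨⟨fun P hP => (hpart i P).1 (hk i P hP), rfl⟩, fun P hP =>
        le_of_mul_le_mul_left (hle.trans (hi P hP)) i.scale_pos⟩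
    have h1 := (hworst _ hpos).2 ⟨_, hN, rfl⟩
    rw [le_div_iff₀ hγ₁] at h1
    calc B * γ₁ ≤ i.scale * N.pathCost (k i) P₀ * γ₁ := by
          gcongr
          exact hi P₀ hP₀
      _ ≤ i.scale * N.cost (k i) * γ₁ := by
          gcongr
          exact pathCost_le_cost _ _ _
      _ = i.scale * (N.cost (k i) * γ₁) := by ring
      _ ≤ i.scale * rate (k i) := by gcongr
      _ = _ := by rw [hkr]
  have hcut : ∀ π, (skel I).IsPathIn (skelPart H) .s π .t → ∃ i, .work i () ∈ π ∧ blocked i := by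
    intro π hπ
    by_contra hno
    have hP : ∀ i, ∃ P, N.IsSTPath H₀ P ∧
        (.work i () ∈ π → i.scale * N.pathCost (k i) P < B) := by
      intro i
      by_cases hi : .work i () ∈ π
      · have : ¬ blocked i := fun hb => hno ⟨i, hi, hb⟩
        simp only [blocked, not_forall, not_le] at this
        obtain ⟨P, hP, hlt⟩ := this
        exact ⟨P, hP, fun _ => hlt⟩
      · exact ⟨P₀, hP₀, fun h => absurd h hi⟩
    choose P hP hPlt using hP
    -- If nothing on `π` were blocked, cheap paths in its edgeworks would combine with the edges of
    -- latency `ε x`, which cost less than `B`, to a path that contradicts equilibrium.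
    have hlift := isSTPath_liftPath I (ε := ε) (hε := hε) hst hπ
      (P := P) fun i _ => (hpart i _).2 (hP i)
    obtain ⟨e, he, hBe⟩ := (amplify I N ε hε).exists_le_of_le_pathCost hBpos (hnash _ hlift)
    rcases e with _ | e | ⟨i, e⟩
    · exact (hsmall .e₂).not_ge hBe
    · exact (hsmall (.base e)).not_ge hBe
    · obtain ⟨h1, h2⟩ := mem_liftPath_work.1 he
      have h3 := (mul_le_mul_right (N.le_pathCost (f := k i) h2) i.scale).trans_lt (hPlt i h1)
      rw [hkl, ← mul_assoc] at h3
      exact h3.not_ge hBe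
  have hfin := rate_ge_of_blocked hp hq hpq (fun π hπ => (hh π hπ).1)
    (fun π hπ e he => (hh π hπ).2 _ he) blocked (c := B * γ₁) (fun π hπ hπ' => hcut π ⟨hπ, ?_⟩)
    hblocked
  · rw [hhr, hfr] at hfin
    refine le_trans (le_of_eq ?_) hfin
    ring
  · rintro (_ | e | ⟨i, ⟨⟩⟩) he
    · exact h2
    · exact hπ' e he
    · exact hwork i

theorem retained_baseCopy {ε : ℝ≥0} {hε : 0 < ε} (H : Set (AmpEdge E N.Kept)) :
    (baseCopy I N ε hε).retained H = {e | .base e ∈ H} := by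
  ext e
  simp [DCopy.retained, baseCopy]

theorem retained_edgeworkCopy {ε : ℝ≥0} {hε : 0 < ε} (c : DCopy I N) (i : ExtEdge)
    (H : Set (AmpEdge E N.Kept)) :
    (edgeworkCopy c i ε hε).retained H = c.retained (workPart H i) := by
  ext e
  simp only [DCopy.retained, edgeworkCopy, Set.mem_ofPred_eq, Option.bind_eq_some_iff, workPart]
  constructor
  · rintro ⟨f, hf, f', hf', h⟩
    split_ifs at h with hu
    cases h
    exact ⟨f', ⟨hu, hf⟩, hf'⟩
  · rintro ⟨f, ⟨hu, hf⟩, hf'⟩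
    exact ⟨_, hf, f, hf', dif_pos hu⟩

/-- In a NO-instance nothing good is retained and all edgeworks are bad. In general, if no
designated copy retains a good subnetwork, then neither `D` nor any edgework does, and the same bad
equilibrium arises. -/
theorem amplify_isGapInstance [Finite E] [Finite F] (hI : I.HasCrossingPaths)
    (hG : IsGapInstance I N copies γ₁ γ₂) (ε : ℝ≥0) (hε : 0 < ε) (hlt : ε < 1 / (4 * γ₁)) :
    IsGapInstance I (amplify I N ε hε) (amplifyCopies copies ε hε) (4 * γ₁) (3 * γ₂) where
  pos := mul_pos (by norm_num) hG.pos
  lt := mul_lt_mul'' (by norm_num) hG.lt zero_le zero_le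
  includes := ⟨none, fun e => ⟨_, rfl⟩⟩
  opt r _ := amplify_isOptCost hI hG hlt r
  yes r hr hyes := amplify_isWorstCost hG hlt hyes hr
  no r hr hno H := amplify_worstCostGE hG hlt (I.not_good_of_not_isYes hno _)
    (fun i => hG.no 1 one_pos hno _) hr
  good r hr H := by
    by_cases hgood : ∃ k, I.Good ((amplifyCopies copies ε hε k).retained H)
    · exact .inl hgood
    · push Not at hgood
      refine .inr (amplify_worstCostGE hG hlt ?_ (fun i => ?_) hr)
      · have := hgood none
        rwa [show amplifyCopies copies ε hε none = baseCopy I N ε hε from rfl,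
          retained_baseCopy] at this
      · refine (hG.good 1 one_pos _).resolve_left ?_
        rintro ⟨k, hk⟩
        rw [← retained_edgeworkCopy (hε := hε)] at hk
        exact hgood (some (i, k)) hk

end Gap

/-! ### The output code -/

instance : Finite Terminal :=
  Finite.of_injective (β := Fin 6) (fun
    | .s => 0 | .t => 1 | .s₁ => 2 | .s₂ => 3 | .t₁ => 4 | .t₂ => 5) (by
    intro a b h
    cases a <;> cases b <;> simp_all)

instance : Finite Letter :=
  Finite.of_injective (β := Fin 6 × Bool × Terminal) (fun
    | .bit b => (0, b, .s) | .sep => (1, true, .s) | .vertex => (2, true, .s)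
    | .edge => (3, true, .s) | .bar => (4, true, .s) | .term a => (5, true, a)) (by
    intro a b h
    cases a <;> cases b <;> simp_all)

instance : Fintype Letter := Fintype.ofFinite _

/-- The kinds of vertices of the amplified network that are named by bit strings. -/
inductive NameTag
  | u | v | s₁ | s₂ | t₁ | t₂ | base
  | work (i : ExtEdge)

/-- The suffix that distinguishes vertices of different kinds. -/
def NameTag.bits : NameTag → List Bool
  | u => [false, false, false, false]
  | v => [false, false, false, true]
  | s₁ => [false, false, true, false]
  | s₂ => [false, false, true, true]
  | t₁ => [false, true, false, false]
  | t₂ => [false, true, false, true]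
  | base => [false, true, true, false]
  | work .e₁ => [true, false, false, false]
  | work .e₃ => [true, false, false, true]
  | work .e₄ => [true, false, true, false]
  | work .e₅ => [true, false, true, true]
  | work .e₆ => [true, true, false, false]
  | work .e₇ => [true, true, false, true]
  | work .e₈ => [true, true, true, false]
  | work .e₉ => [true, true, true, true]

theorem NameTag.length_bits (a : NameTag) : a.bits.length = 4 := by
  rcases a with _ | _ | _ | _ | _ | _ | _ | i <;> try rfl
  cases i <;> rfl

theorem NameTag.bits_injective : Function.Injective NameTag.bits := by
  rintro (_ | _ | _ | _ | _ | _ | _ | i) (_ | _ | _ | _ | _ | _ | _ | j) h <;>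
    first | rfl | (try cases i) <;> (try cases j) <;> first | rfl | simp [bits] at h

theorem NameTag.append_bits_inj {a b : NameTag} {w w' : List Bool}
    (h : w ++ a.bits = w' ++ b.bits) : w = w' ∧ a = b := by
  obtain ⟨h1, h2⟩ := List.append_inj' h (by rw [a.length_bits, b.length_bits])
  exact ⟨h1, bits_injective h2⟩

/-- The tag of the vertices of `D` (`none`) or of an edgework. -/
def partTag : Option ExtEdge → NameTag
  | none => .base
  | some i => .work i

/-- The name of a distinguished vertex of `D` in the amplified network. -/
def baseTermName : Terminal → VName
  -- The names `s` and `t` do not occur in a code that represents `D`; these values only keep the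
  -- renaming injective.
  | .s => .term .s
  | .t => .term .t
  | .s₁ => .inner (NameTag.bits .s₁)
  | .s₂ => .inner (NameTag.bits .s₂)
  | .t₁ => .inner (NameTag.bits .t₁)
  | .t₂ => .inner (NameTag.bits .t₂)

/-- The name of the tail of an external edge. -/
def tailName : ExtEdge → VName
  | .e₁ => .term .s
  | .e₃ => .inner (NameTag.bits .v)
  | .e₄ => .term .s
  | .e₅ => .inner (NameTag.bits .v)
  | .e₆ => .term .s
  | .e₇ => baseTermName .t₁
  | .e₈ => .inner (NameTag.bits .u)
  | .e₉ => baseTermName .t₂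

/-- The name of the head of an external edge. -/
def headName : ExtEdge → VName
  | .e₁ => .inner (NameTag.bits .u)
  | .e₃ => .term .t
  | .e₄ => .inner (NameTag.bits .v)
  | .e₅ => baseTermName .s₁
  | .e₆ => baseTermName .s₂
  | .e₇ => .inner (NameTag.bits .u)
  | .e₈ => .term .t
  | .e₉ => .term .t

/-- The name in the amplified network of a distinguished vertex of `D` or of an edgework. -/
def partTermName : Option ExtEdge → Terminal → VName
  | none, a => baseTermName a
  | some i, .s => tailName i
  | some i, .t => headName i
  | some _, a => .term a

/-- The name in the amplified network of a vertex of `D` or of an edgework. -/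
def partName (o : Option ExtEdge) : VName → VName
  | .term a => partTermName o a
  | .inner w => .inner (w ++ (partTag o).bits)

/-- The denominator of `ε`, as a bit string. -/
def epsBits (k : ℕ) : List Bool := List.replicate k false ++ [false, false, true]

/-- The code of the edge `e₂`. -/
def midEdge (k : ℕ) : EdgeCode :=
  ⟨.inner (NameTag.bits .u), .inner (NameTag.bits .v), [true], epsBits k⟩

/-- The code in the amplified network of an edge of `D`. -/
def baseEdge (k : ℕ) (e : VName × VName) : EdgeCode :=
  ⟨partName none e.1, partName none e.2, [true], epsBits k⟩

/-- The digits by which the scaling of an edgework shifts denominators. -/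
def scaleBits : ExtEdge → List Bool
  | .e₁ => [false]
  | .e₃ => [false]
  | _ => []

/-- A name that the source of a useful edge cannot have. -/
def VName.isT : VName → Bool
  | .term .t => true
  | _ => false

/-- A name that the target of a useful edge cannot have. -/
def VName.isS : VName → Bool
  | .term .s => true
  | _ => false

/-- The code in the edgework `i` of an edge, if it is kept. -/
def workEdge (i : ExtEdge) (e : EdgeCode) : Option EdgeCode :=
  if !e.src.isT && !e.tgt.isS then
    some ⟨partName (some i) e.src, partName (some i) e.tgt, e.num, scaleBits i ++ e.den⟩
  else none

/-- The list of the external edges. -/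
def extEdges : List ExtEdge := [.e₁, .e₃, .e₄, .e₅, .e₆, .e₇, .e₈, .e₉]

/-- The names of the new vertices and the distinguished vertices of `D`. -/
def cornerNames : List (List Bool) :=
  [NameTag.bits .u, NameTag.bits .v, NameTag.bits .s₁, NameTag.bits .s₂, NameTag.bits .t₁,
    NameTag.bits .t₂]

/-- The inner vertices of one part of the amplified network. -/
def partInner (c : InputCode) : Option ExtEdge → List (List Bool)
  | none => (c.ddp.inner.map fun w => w ++ (partTag none).bits) ++ cornerNames
  | some i => c.net.inner.map fun w => w ++ (partTag (some i)).bits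

/-- The edges of one part of the amplified network. -/
def partEdges (c : InputCode) : Option ExtEdge → List EdgeCode
  | none => c.ddp.edges.map (baseEdge c.word.length) ++ [midEdge c.word.length]
  | some i => c.net.edges.filterMap (workEdge i)

/-- The code of the amplified network. -/
def buildCode (c : InputCode) : NetCode where
  inner := partInner c none ++ extEdges.flatMap fun i => partInner c (some i)
  edges := partEdges c none ++ extEdges.flatMap fun i => partEdges c (some i)

/-- The word of an edge. -/
def EdgeCode.word (e : EdgeCode) : List Letter :=
  Letter.edge :: (e.src.word ++ e.tgt.word ++ bitsWord e.num ++ bitsWord e.den)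

/-! ### Scanning the input -/

/-- The part of the code of a vertex or an edge. -/
inductive ScanField
  | vertex | src | tgt | num | den

/-- The following part. -/
def ScanField.succ : ScanField → ScanField
  | vertex => vertex
  | src => tgt
  | tgt => num
  | num => den
  | den => den

/-- What is known about a position of the input word: whether it is in the code of the network, in
which part of the code of a vertex or an edge, and whether the edge is still possibly kept. -/
structure ScanState where
  net : Bool
  field : ScanField
  keep : Bool

instance : Finite ScanField :=
  Finite.of_injective (β := Fin 5) (fun
    | .vertex => 0 | .src => 1 | .tgt => 2 | .num => 3 | .den => 4) (by
    intro a b h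
    cases a <;> cases b <;> simp_all)

instance : Finite ScanState :=
  Finite.of_injective (β := Bool × ScanField × Bool) (fun q => (q.net, q.field, q.keep)) (by
    rintro ⟨a, b, c⟩ ⟨a', b', c'⟩ h
    simp_all)

/-- Whether a reserved name at a given place makes an edge useless. -/
def uselessTerm : ScanField → Terminal → Bool
  | .src, .t => true
  | .tgt, .s => true
  | _, _ => false

/-- Scanning a letter. -/
def ScanState.next (q : ScanState) : Letter → ScanState
  | .vertex => ⟨q.net, .vertex, true⟩
  | .edge => ⟨q.net, .src, true⟩
  | .bar => ⟨true, .vertex, true⟩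
  | .bit _ => q
  | .sep => ⟨q.net, q.field.succ, q.keep⟩
  | .term a => ⟨q.net, q.field.succ, q.keep && !uselessTerm q.field a⟩

/-- The initial state of a scan. -/
def ScanState.start : ScanState := ⟨false, .vertex, true⟩

/-- Scanning a word. -/
def ScanState.nexts (q : ScanState) (w : List Letter) : ScanState := w.foldl ScanState.next q

/-- A word with its letters annotated by the states of the scan. -/
def annotate : ScanState → List Letter → List (Letter × ScanState)
  | _, [] => []
  | q, x :: w => (x, q) :: annotate (q.next x) w

theorem annotate_append (q : ScanState) (w w' : List Letter) :
    annotate q (w ++ w') = annotate q w ++ annotate (q.nexts w) w' := by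
  induction w generalizing q with
  | nil => rfl
  | cons x w ih => simp [annotate, ih, ScanState.nexts]

theorem ScanState.nexts_append (q : ScanState) (w w' : List Letter) :
    q.nexts (w ++ w') = (q.nexts w).nexts w' := List.foldl_append

theorem annotate_map_fst (q : ScanState) (w : List Letter) : (annotate q w).map Prod.fst = w := by
  induction w generalizing q with
  | nil => rfl
  | cons x w ih => simp [annotate, ih]

/-! ### The passes over the input -/

/-- A pass over the input writes the inner vertices (`false`) or the edges (`true`) of a part of
the amplified network. -/
abbrev Pass : Type := Bool × Option ExtEdge

/-- The end of a name. -/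
def tagWord (o : Option ExtEdge) : List Letter := bitsWord (partTag o).bits

/-- The numerator of `ε`. -/
def oneWord : List Letter := bitsWord [true]

/-- The letters, and whether they are followed by the denominator of `ε`, by which the pass `m`
replaces the letter `x`, if `b` tells whether the current edge is kept. -/
def replacement : Pass → Letter → ScanState → Bool → List Letter × Bool
  | (false, none), x, q, _ => match x, q with
    | .vertex, ⟨false, _, _⟩ => ([.vertex], false)
    | .bit c, ⟨false, .vertex, _⟩ => ([.bit c], false)
    | .sep, ⟨false, .vertex, _⟩ => (tagWord none, false)
    | .bar, _ => (verticesWord cornerNames, false)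
    | _, _ => ([], false)
  | (false, some i), x, q, _ => match x, q with
    | .vertex, ⟨true, _, _⟩ => ([.vertex], false)
    | .bit c, ⟨true, .vertex, _⟩ => ([.bit c], false)
    | .sep, ⟨true, .vertex, _⟩ => (tagWord (some i), false)
    | _, _ => ([], false)
  | (true, none), x, q, _ => match x, q with
    | .edge, ⟨false, _, _⟩ => ([.edge], false)
    | .bit c, ⟨false, .src, _⟩ => ([.bit c], false)
    | .bit c, ⟨false, .tgt, _⟩ => ([.bit c], false)
    | .sep, ⟨false, .src, _⟩ => (tagWord none, false)
    | .sep, ⟨false, .tgt, _⟩ => (tagWord none ++ oneWord, true)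
    | .term a, ⟨false, .src, _⟩ => ((partTermName none a).word, false)
    | .term a, ⟨false, .tgt, _⟩ => ((partTermName none a).word ++ oneWord, true)
    | .bar, _ => (.edge :: (bitsWord (NameTag.bits .u) ++ bitsWord (NameTag.bits .v) ++ oneWord),
        true)
    | _, _ => ([], false)
  | (true, some i), x, q, b => match b, x, q with
    | true, .edge, ⟨true, _, _⟩ => ([.edge], false)
    | true, .bit c, ⟨true, .src, _⟩ => ([.bit c], false)
    | true, .bit c, ⟨true, .tgt, _⟩ => ([.bit c], false)
    | true, .bit c, ⟨true, .num, _⟩ => ([.bit c], false)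
    | true, .bit c, ⟨true, .den, _⟩ => ([.bit c], false)
    | true, .sep, ⟨true, .src, _⟩ => (tagWord (some i), false)
    | true, .sep, ⟨true, .tgt, _⟩ => (tagWord (some i), false)
    | true, .sep, ⟨true, .num, _⟩ => (.sep :: (scaleBits i).map .bit, false)
    | true, .sep, ⟨true, .den, _⟩ => ([.sep], false)
    | true, .term a, ⟨true, .src, _⟩ => ((partTermName (some i) a).word, false)
    | true, .term a, ⟨true, .tgt, _⟩ => ((partTermName (some i) a).word, false)
    | _, _, _ => ([], false)

/-- Reading backwards, the last letter of the code of an edge tells whether it is kept. -/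
def keepFlag (b : Bool) : Letter → ScanState → Bool
  | .sep, ⟨_, .den, k⟩ => k
  | _, _ => b

/-- The effect of a pass at a letter. -/
def passStep (k : ℕ) (m : Pass) (x : Letter × ScanState) (s : Bool × List Letter) :
    Bool × List Letter :=
  (keepFlag s.1 x.1 x.2,
    (replacement m x.1 x.2 (keepFlag s.1 x.1 x.2)).1 ++
      ((if (replacement m x.1 x.2 (keepFlag s.1 x.1 x.2)).2 then bitsWord (epsBits k) else []) ++
        s.2))

/-- The effect of a pass. -/
def passResult (k : ℕ) (m : Pass) (l : List (Letter × ScanState)) (s : Bool × List Letter) :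
    Bool × List Letter := l.foldr (passStep k m) s

theorem passResult_append (k : ℕ) (m : Pass) (l l' : List (Letter × ScanState))
    (s : Bool × List Letter) :
    passResult k m (l ++ l') s = passResult k m l (passResult k m l' s) := List.foldr_append

/-- The word written by a pass. -/
def passWord (c : InputCode) : Pass → List Letter
  | (false, o) => verticesWord (partInner c o)
  | (true, o) => (partEdges c o).flatMap EdgeCode.word

/-- Whether a name at a given place makes an edge useless. -/
def uselessName (f : ScanField) : VName → Bool
  | .term a => uselessTerm f a
  | .inner _ => false

theorem annotate_bits (q : ScanState) (w : List Bool) :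
    annotate q (w.map .bit) = (w.map Letter.bit).map (·, q) := by
  induction w with
  | nil => rfl
  | cons x w ih => simpa [annotate, ScanState.next] using ih

theorem nexts_bits (q : ScanState) (w : List Bool) : q.nexts (w.map .bit) = q := by
  induction w with
  | nil => rfl
  | cons x w ih => simpa [ScanState.nexts, ScanState.next] using ih

theorem annotate_bitsWord (q : ScanState) (w : List Bool) :
    annotate q (bitsWord w) = (bitsWord w).map (·, q) := by
  rw [bitsWord, annotate_append, annotate_bits, nexts_bits]
  simp [annotate]

theorem nexts_bitsWord (q : ScanState) (w : List Bool) :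
    q.nexts (bitsWord w) = ⟨q.net, q.field.succ, q.keep⟩ := by
  rw [bitsWord, ScanState.nexts_append, nexts_bits]
  rfl

theorem annotate_vname (q : ScanState) (a : VName) :
    annotate q a.word = a.word.map (·, q) := by
  cases a with
  | term a => rfl
  | inner w => exact annotate_bitsWord q w

theorem nexts_vname (q : ScanState) (a : VName) :
    q.nexts a.word = ⟨q.net, q.field.succ, q.keep && !uselessName q.field a⟩ := by
  cases a with
  | term a => rfl
  | inner w => simp [VName.word, nexts_bitsWord, uselessName]

/-- The flag may still change while nothing is written, so only the output is compared. -/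
theorem passResult_silent {k : ℕ} {m : Pass} {l : List (Letter × ScanState)}
    (h : ∀ x ∈ l, ∀ b, replacement m x.1 x.2 b = ([], false)) (s : Bool × List Letter) :
    (passResult k m l s).2 = s.2 := by
  induction l with
  | nil => rfl
  | cons x l ih =>
    have h1 := h x List.mem_cons_self
    have h2 := ih fun y hy => h y (List.mem_cons_of_mem _ hy)
    simp only [passResult, List.foldr_cons, passStep, h1] at h2 ⊢
    simpa using h2

theorem passResult_bits {k : ℕ} {m : Pass} {q : ScanState} (w : List Bool) (b : Bool)
    (out : List Letter) (h : ∀ c, replacement m (.bit c) q b = ([.bit c], false)) :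
    passResult k m ((w.map Letter.bit).map (·, q)) (b, out) = (b, w.map .bit ++ out) := by
  induction w with
  | nil => rfl
  | cons x w ih =>
    simp only [passResult, List.map_cons, List.foldr_cons] at ih ⊢
    rw [ih]
    simp [passStep, keepFlag, h]

theorem passResult_bitsWord {k : ℕ} {m : Pass} {q : ScanState} (w : List Bool) (b : Bool)
    (out : List Letter) {X : List Letter} {e : Bool}
    (h : ∀ c, replacement m (.bit c) q (keepFlag b .sep q) = ([.bit c], false))
    (hs : replacement m .sep q (keepFlag b .sep q) = (X, e)) :
    passResult k m ((bitsWord w).map (·, q)) (b, out) =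
      (keepFlag b .sep q, w.map .bit ++ (X ++ ((if e then bitsWord (epsBits k) else []) ++ out))) := by
  rw [bitsWord, List.map_append, passResult_append]
  rw [show passResult k m ([Letter.sep].map (·, q)) (b, out) =
    (keepFlag b .sep q, X ++ ((if e then bitsWord (epsBits k) else []) ++ out)) by
      simp [passResult, passStep, hs]]
  rw [passResult_bits _ _ _ h]

/-- `X` is what the pass appends to the name, and `e` tells whether the denominator of `ε` follows;
both are used at the target of an edge of `D`. -/
theorem passResult_vname {k : ℕ} {m : Pass} {q : ScanState} (a : VName) (b : Bool)
    (out : List Letter) {X : List Letter} {e : Bool} {o : Option ExtEdge}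
    (hq : keepFlag b .sep q = b)
    (h : ∀ c, replacement m (.bit c) q b = ([.bit c], false))
    (hs : replacement m .sep q b = (tagWord o ++ X, e))
    (ht : ∀ z, replacement m (.term z) q b = ((partTermName o z).word ++ X, e)) :
    passResult k m (a.word.map (·, q)) (b, out) =
      (b, (partName o a).word ++ (X ++ ((if e then bitsWord (epsBits k) else []) ++ out))) := by
  cases a with
  | term z =>
    simp [VName.word, passResult, passStep, ht, partName, keepFlag]
  | inner w =>
    rw [VName.word, passResult_bitsWord w b out (X := tagWord o ++ X) (e := e) (by rwa [hq])
      (by rwa [hq]), hq]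
    simp [partName, VName.word, bitsWord, tagWord]

/-- A pass ignores a letter. -/
def Ignores (m : Pass) (x : Letter × ScanState) : Prop :=
  ∀ b, replacement m x.1 x.2 b = ([], false)

theorem ignores_bitsWord {m : Pass} {q : ScanState} (w : List Bool)
    (h : ∀ c, Ignores m (.bit c, q)) (hs : Ignores m (.sep, q)) :
    ∀ x ∈ (bitsWord w).map (·, q), Ignores m x := by
  intro x hx
  obtain ⟨y, hy, rfl⟩ := List.mem_map.1 hx
  rcases List.mem_append.1 hy with hy | hy
  · obtain ⟨c, -, rfl⟩ := List.mem_map.1 hy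
    exact h c
  · rw [List.mem_singleton.1 hy]
    exact hs

theorem ignores_vname {m : Pass} {q : ScanState} (a : VName)
    (h : ∀ c, Ignores m (.bit c, q)) (hs : Ignores m (.sep, q)) (ht : ∀ z, Ignores m (.term z, q)) :
    ∀ x ∈ a.word.map (·, q), Ignores m x := by
  cases a with
  | term z => simpa [VName.word] using ht z
  | inner w => exact ignores_bitsWord w h hs

theorem ScanState.nexts_cons (q : ScanState) (x : Letter) (w : List Letter) :
    q.nexts (x :: w) = (q.next x).nexts w := rfl

/-! ### Vertices -/

theorem vertexWord_scan (q : ScanState) (w : List Bool) :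
    annotate q (.vertex :: bitsWord w) =
      (.vertex, q) :: (bitsWord w).map (·, ⟨q.net, .vertex, true⟩) ∧
    q.nexts (.vertex :: bitsWord w) = ⟨q.net, .vertex, true⟩ := by
  constructor
  · rw [annotate, annotate_bitsWord]
    rfl
  · exact nexts_bitsWord ⟨q.net, .vertex, true⟩ w

theorem verticesWord_cons (w : List Bool) (l : List (List Bool)) :
    verticesWord (w :: l) = (.vertex :: bitsWord w) ++ verticesWord l := by
  simp [verticesWord]

theorem verticesWord_append (l l' : List (List Bool)) :
    verticesWord (l ++ l') = verticesWord l ++ verticesWord l' := by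
  simp [verticesWord]

theorem passResult_vertices {k : ℕ} (o : Option ExtEdge) (l : List (List Bool)) (q : ScanState)
    (hq : q.net = o.isSome) (s : Bool × List Letter) :
    (passResult k (false, o) (annotate q (verticesWord l)) s).2 =
      verticesWord (l.map fun w => w ++ (partTag o).bits) ++ s.2 ∧
    (q.nexts (verticesWord l)).net = q.net := by
  induction l generalizing q with
  | nil => simp [verticesWord, annotate, passResult, ScanState.nexts]
  | cons w l ih =>
    obtain ⟨h1, h2⟩ := vertexWord_scan q w
    obtain ⟨i1, i2⟩ := ih ⟨q.net, .vertex, true⟩ hq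
    rw [verticesWord_cons, annotate_append, ScanState.nexts_append, h1, h2]
    refine ⟨?_, i2⟩
    rw [passResult_append]
    set s' := passResult k (false, o) (annotate ⟨q.net, .vertex, true⟩ (verticesWord l)) s
    obtain ⟨b, out⟩ := s'
    change out = _ at i1
    subst i1
    have h3 := passResult_bitsWord (k := k) (m := (false, o)) (q := ⟨q.net, .vertex, true⟩) w b
      (verticesWord (l.map fun w => w ++ (partTag o).bits) ++ s.2) (X := tagWord o) (e := false)
      (by rw [hq]; cases o <;> intro c <;> rfl) (by rw [hq]; cases o <;> rfl)
    obtain ⟨n, f, kp⟩ := q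
    simp only at hq
    subst hq
    simp only [passResult, List.foldr_cons] at h3 ⊢
    rw [h3]
    cases o <;> simp [passStep, replacement, verticesWord_cons, tagWord, bitsWord]

theorem passResult_vertices_silent {k : ℕ} (m : Pass) (l : List (List Bool)) (q : ScanState)
    (hm : m.1 = true ∨ q.net ≠ m.2.isSome) (s : Bool × List Letter) :
    (passResult k m (annotate q (verticesWord l)) s).2 = s.2 ∧
    (q.nexts (verticesWord l)).net = q.net := by
  induction l generalizing q with
  | nil => simp [verticesWord, annotate, passResult, ScanState.nexts]
  | cons w l ih =>
    obtain ⟨h1, h2⟩ := vertexWord_scan q w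
    obtain ⟨i1, i2⟩ := ih ⟨q.net, .vertex, true⟩ hm
    rw [verticesWord_cons, annotate_append, ScanState.nexts_append, h1, h2]
    refine ⟨?_, i2⟩
    rw [passResult_append, passResult_silent, i1]
    refine List.forall_mem_cons.2 ⟨?_, ignores_bitsWord w ?_ ?_⟩
    all_goals
      obtain ⟨_ | _, _ | i⟩ := m <;> obtain ⟨_ | _, f, kp⟩ := q <;>
        first | exact fun _ _ => rfl | exact fun _ => rfl | (simp at hm; done) |
          (intro b; cases b <;> rfl) | (intro c b; cases b <;> rfl)

/-! ### Edges -/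

/-- The word of an edge of `D`. -/
def ddpEdgeWord (e : VName × VName) : List Letter := Letter.edge :: (e.1.word ++ e.2.word)

theorem ddpEdgeWord_scan (q : ScanState) (e : VName × VName) :
    annotate q (ddpEdgeWord e) = (.edge, q) :: (e.1.word.map (·, ⟨q.net, .src, true⟩) ++
      e.2.word.map (·, ⟨q.net, .tgt, !uselessName .src e.1⟩)) ∧
    (q.nexts (ddpEdgeWord e)).net = q.net := by
  constructor
  · simp [ddpEdgeWord, annotate, annotate_append, annotate_vname, ScanState.next, nexts_vname,
      ScanField.succ]
  · simp [ddpEdgeWord, ScanState.nexts_cons, ScanState.nexts_append, nexts_vname, ScanState.next]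

theorem netEdgeWord_scan (q : ScanState) (e : EdgeCode) :
    annotate q e.word = (.edge, q) :: (e.src.word.map (·, ⟨q.net, .src, true⟩) ++
      (e.tgt.word.map (·, ⟨q.net, .tgt, !uselessName .src e.src⟩) ++
      ((bitsWord e.num).map
        (·, ⟨q.net, .num, !uselessName .src e.src && !uselessName .tgt e.tgt⟩) ++
      (bitsWord e.den).map
        (·, ⟨q.net, .den, !uselessName .src e.src && !uselessName .tgt e.tgt⟩)))) ∧
    (q.nexts e.word).net = q.net := by
  constructor
  · simp [EdgeCode.word, annotate, annotate_append, annotate_vname, ScanState.next, nexts_vname,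
      ScanField.succ, annotate_bitsWord, nexts_bitsWord]
  · simp [EdgeCode.word, ScanState.nexts_cons, ScanState.nexts_append, nexts_vname,
      nexts_bitsWord, ScanState.next]

theorem passResult_snd_eta {k : ℕ} {m : Pass} {l : List (Letter × ScanState)}
    {s : Bool × List Letter} {out : List Letter} (h : (passResult k m l s).2 = out) :
    ∃ b, passResult k m l s = (b, out) := ⟨_, Prod.ext rfl h⟩

theorem passResult_ddpEdges {k : ℕ} (l : List (VName × VName)) (q : ScanState)
    (hq : q.net = false) (s : Bool × List Letter) :
    (passResult k (true, none) (annotate q (l.flatMap ddpEdgeWord)) s).2 =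
      (l.map (baseEdge k)).flatMap EdgeCode.word ++ s.2 ∧
    (q.nexts (l.flatMap ddpEdgeWord)).net = q.net := by
  induction l generalizing q with
  | nil => simp [annotate, passResult, ScanState.nexts]
  | cons e l ih =>
    obtain ⟨h1, h2⟩ := ddpEdgeWord_scan q e
    obtain ⟨i1, i2⟩ := ih (q.nexts (ddpEdgeWord e)) (h2.trans hq)
    rw [List.flatMap_cons, annotate_append, ScanState.nexts_append, h1]
    refine ⟨?_, i2.trans h2⟩
    rw [passResult_append]
    obtain ⟨b, hb⟩ := passResult_snd_eta i1
    rw [hb]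
    obtain ⟨n, f, kp⟩ := q
    simp only at hq
    subst hq
    rw [← List.singleton_append, passResult_append, passResult_append,
      passResult_vname (o := none) (X := oneWord) (e := true) e.2 b _ rfl (fun _ => rfl) rfl
        (fun _ => rfl),
      passResult_vname (o := none) (X := []) (e := false) e.1 b _ rfl (fun _ => rfl)
        (by simp [replacement]) (by simp [replacement])]
    simp [passResult, passStep, replacement, EdgeCode.word, baseEdge, oneWord]

/-- The verdict accumulated by the forward scan agrees with the test in `workEdge`. -/
theorem useless_eq (e : EdgeCode) :
    (!uselessName .src e.src && !uselessName .tgt e.tgt) = (!e.src.isT && !e.tgt.isS) := by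
  obtain ⟨a, b, -, -⟩ := e
  rcases a with a | a <;> rcases b with b | b <;> (try cases a) <;> (try cases b) <;> rfl

/-- A lowered flag suppresses all output of an edgework pass, and only the end of a denominator can
raise it. -/
theorem passResult_off {k : ℕ} {i : ExtEdge} {l : List (Letter × ScanState)}
    (h : ∀ x ∈ l, keepFlag false x.1 x.2 = false) (out : List Letter) :
    passResult k (true, some i) l (false, out) = (false, out) := by
  induction l with
  | nil => rfl
  | cons x l ih =>
    have h1 := h x List.mem_cons_self
    have h2 := ih fun y hy => h y (List.mem_cons_of_mem _ hy)
    simp only [passResult, List.foldr_cons] at h2 ⊢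
    simp [h2, passStep, h1, replacement]

theorem keepFlag_off {q : ScanState} (hq : q.field ≠ .den) (w : List Letter) :
    ∀ x ∈ w.map (·, q), keepFlag false x.1 x.2 = false := by
  obtain ⟨n, f, kp⟩ := q
  intro x hx
  obtain ⟨y, -, rfl⟩ := List.mem_map.1 hx
  cases y <;> cases f <;> first | rfl | exact absurd rfl hq

theorem passResult_netEdges {k : ℕ} (i : ExtEdge) (l : List EdgeCode) (q : ScanState)
    (hq : q.net = true) (s : Bool × List Letter) :
    (passResult k (true, some i) (annotate q (l.flatMap EdgeCode.word)) s).2 =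
      (l.filterMap (workEdge i)).flatMap EdgeCode.word ++ s.2 ∧
    (q.nexts (l.flatMap EdgeCode.word)).net = q.net := by
  induction l generalizing q with
  | nil => simp [annotate, passResult, ScanState.nexts]
  | cons e l ih =>
    obtain ⟨h1, h2⟩ := netEdgeWord_scan q e
    obtain ⟨i1, i2⟩ := ih (q.nexts e.word) (h2.trans hq)
    rw [List.flatMap_cons, annotate_append, ScanState.nexts_append, h1]
    refine ⟨?_, i2.trans h2⟩
    rw [passResult_append]
    obtain ⟨b, hb⟩ := passResult_snd_eta i1
    rw [hb]
    obtain ⟨n, f, kp⟩ := q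
    simp only at hq
    subst hq
    rw [useless_eq]
    have hwe : workEdge i e = if (!e.src.isT && !e.tgt.isS) = true then
      some ⟨partName (some i) e.src, partName (some i) e.tgt, e.num, scaleBits i ++ e.den⟩
      else none := rfl
    generalize (!e.src.isT && !e.tgt.isS) = kf at hwe ⊢
    rw [← List.singleton_append]
    cases kf with
    | true =>
      rw [passResult_append, passResult_append, passResult_append, passResult_append,
        passResult_bitsWord (X := [.sep]) (e := false) e.den b _ (fun _ => rfl) rfl,
        passResult_bitsWord (X := .sep :: (scaleBits i).map .bit) (e := false) e.num _ _
          (fun _ => rfl) rfl,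
        passResult_vname (o := some i) (X := []) (e := false) e.tgt _ _ rfl (fun _ => rfl)
          (by simp [replacement, keepFlag]) (by simp [replacement, keepFlag]),
        passResult_vname (o := some i) (X := []) (e := false) e.src _ _ rfl (fun _ => rfl)
          (by simp [replacement, keepFlag]) (by simp [replacement, keepFlag])]
      rw [List.filterMap_cons_some hwe]
      simp [passResult, passStep, replacement, EdgeCode.word, keepFlag, bitsWord]
    -- Read backwards, the end of the denominator comes first and carries the verdict; it lowers the
    -- flag before any other letter of the useless edge is met.
    | false =>
      rw [List.filterMap_cons_none hwe, bitsWord.eq_1 e.den, List.map_append]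
      have hsep : passResult k (true, some i) ([Letter.sep].map (·, ⟨true, .den, false⟩))
          (b, (l.filterMap (workEdge i)).flatMap EdgeCode.word ++ s.2) =
          (false, (l.filterMap (workEdge i)).flatMap EdgeCode.word ++ s.2) := by
        simp [passResult, passStep, replacement, keepFlag]
      rw [passResult_append, passResult_append, passResult_append, passResult_append,
        passResult_append, hsep, passResult_off (l := (e.den.map Letter.bit).map _),
        passResult_off (keepFlag_off (by simp) _), passResult_off (keepFlag_off (by simp) _),
        passResult_off (keepFlag_off (by simp) _), passResult_off (by simp [keepFlag])]
      intro x hx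
      obtain ⟨y, hy, rfl⟩ := List.mem_map.1 hx
      obtain ⟨c, -, rfl⟩ := List.mem_map.1 hy
      rfl

theorem passResult_ddpEdges_silent {k : ℕ} (m : Pass) (l : List (VName × VName)) (q : ScanState)
    (hm : m.1 = false ∨ q.net ≠ m.2.isSome) (s : Bool × List Letter) :
    (passResult k m (annotate q (l.flatMap ddpEdgeWord)) s).2 = s.2 ∧
    (q.nexts (l.flatMap ddpEdgeWord)).net = q.net := by
  induction l generalizing q with
  | nil => simp [annotate, passResult, ScanState.nexts]
  | cons e l ih =>
    obtain ⟨h1, h2⟩ := ddpEdgeWord_scan q e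
    obtain ⟨i1, i2⟩ := ih (q.nexts (ddpEdgeWord e)) (by rwa [h2])
    rw [List.flatMap_cons, annotate_append, ScanState.nexts_append, h1]
    refine ⟨?_, i2.trans h2⟩
    rw [passResult_append, passResult_silent, i1]
    refine List.forall_mem_cons.2 ⟨?_, List.forall_mem_append.2
      ⟨ignores_vname _ ?_ ?_ ?_, ignores_vname _ ?_ ?_ ?_⟩⟩
    all_goals
      obtain ⟨_ | _, _ | i⟩ := m <;> obtain ⟨_ | _, f, kp⟩ := q <;>
        first | exact fun _ _ => rfl | exact fun _ => rfl | (simp at hm; done) |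
          (intro b; cases b <;> rfl) | (intro c b; cases b <;> rfl)

theorem passResult_netEdges_silent {k : ℕ} (m : Pass) (l : List EdgeCode) (q : ScanState)
    (hm : m.1 = false ∨ q.net ≠ m.2.isSome) (s : Bool × List Letter) :
    (passResult k m (annotate q (l.flatMap EdgeCode.word)) s).2 = s.2 ∧
    (q.nexts (l.flatMap EdgeCode.word)).net = q.net := by
  induction l generalizing q with
  | nil => simp [annotate, passResult, ScanState.nexts]
  | cons e l ih =>
    obtain ⟨h1, h2⟩ := netEdgeWord_scan q e
    obtain ⟨i1, i2⟩ := ih (q.nexts e.word) (by rwa [h2])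
    rw [List.flatMap_cons, annotate_append, ScanState.nexts_append, h1]
    refine ⟨?_, i2.trans h2⟩
    rw [passResult_append, passResult_silent, i1]
    refine List.forall_mem_cons.2 ⟨?_, List.forall_mem_append.2
      ⟨ignores_vname _ ?_ ?_ ?_, List.forall_mem_append.2 ⟨ignores_vname _ ?_ ?_ ?_,
        List.forall_mem_append.2 ⟨ignores_bitsWord _ ?_ ?_, ignores_bitsWord _ ?_ ?_⟩⟩⟩⟩
    all_goals
      obtain ⟨_ | _, _ | i⟩ := m <;> obtain ⟨_ | _, f, kp⟩ := q <;>
        first | exact fun _ _ => rfl | exact fun _ => rfl | (simp at hm; done) |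
          (intro b; cases b <;> rfl) | (intro c b; cases b <;> rfl)

/-- The effect of a pass on the input. -/
theorem passResult_input (c : InputCode) (m : Pass) (out : List Letter) :
    (passResult c.word.length m (annotate .start c.word) (true, out)).2 = passWord c m ++ out := by
  generalize hk : c.word.length = k
  have hw : c.word = verticesWord c.ddp.inner ++ (c.ddp.edges.flatMap ddpEdgeWord ++
      ([.bar] ++ (verticesWord c.net.inner ++ c.net.edges.flatMap EdgeCode.word))) := by
    change verticesWord c.ddp.inner ++ c.ddp.edges.flatMap ddpEdgeWord ++
      .bar :: (verticesWord c.net.inner ++ c.net.edges.flatMap EdgeCode.word) = _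
    simp
  rw [hw]
  simp only [annotate_append, passResult_append]
  set q₁ := ScanState.start.nexts (verticesWord c.ddp.inner) with hq₁
  set q₂ := q₁.nexts (c.ddp.edges.flatMap ddpEdgeWord) with hq₂
  set q₃ := q₂.nexts [.bar] with hq₃
  set q₄ := q₃.nexts (verticesWord c.net.inner) with hq₄
  have n₁ : q₁.net = false := (passResult_vertices_silent (k := k) (true, none) c.ddp.inner .start
    (.inl rfl) (true, [])).2
  have n₂ : q₂.net = false := (passResult_ddpEdges (k := k) c.ddp.edges q₁ n₁ (true, [])).2.trans n₁
  have n₃ : q₃.net = true := rfl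
  have n₄ : q₄.net = true := (passResult_vertices_silent (k := k) (true, none) c.net.inner q₃
    (.inl rfl) (true, [])).2
  -- The bar occurs exactly once, so the parts of the output that copy nothing, the corner names and
  -- `e₂`, are written there.
  have hbar : ∀ s, (passResult k m (annotate q₂ [.bar]) s).2 = (match m with
      | (false, none) => verticesWord cornerNames
      | (true, none) => (midEdge k).word
      | _ => []) ++ s.2 := by
    intro s
    obtain ⟨_ | _, _ | i⟩ := m
    · simp [annotate, passResult, passStep, replacement]
    · simp [annotate, passResult, passStep, replacement]
    · simp [annotate, passResult, passStep, replacement, EdgeCode.word, midEdge, VName.word, oneWord]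
    · cases s
      simp [annotate, passResult, passStep, replacement, keepFlag]
  obtain ⟨_ | _, _ | i⟩ := m
  · rw [(passResult_vertices none _ _ rfl _).1,
      (passResult_ddpEdges_silent (false, none) _ _ (.inl rfl) _).1, hbar,
      (passResult_vertices_silent (false, none) _ _ (.inr (by simp [n₃])) _).1,
      (passResult_netEdges_silent (false, none) _ _ (.inl rfl) _).1]
    simp [passWord, partInner, verticesWord_append]
  · rw [(passResult_vertices_silent (false, some i) _ _ (.inr (by simp [ScanState.start])) _).1,
      (passResult_ddpEdges_silent (false, some i) _ _ (.inl rfl) _).1, hbar,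
      (passResult_vertices (some i) _ _ n₃ _).1,
      (passResult_netEdges_silent (false, some i) _ _ (.inl rfl) _).1]
    simp [passWord, partInner]
  · rw [(passResult_vertices_silent (true, none) _ _ (.inl rfl) _).1,
      (passResult_ddpEdges _ _ n₁ _).1, hbar,
      (passResult_vertices_silent (true, none) _ _ (.inl rfl) _).1,
      (passResult_netEdges_silent (true, none) _ _ (.inr (by simp [n₄])) _).1]
    simp [passWord, partEdges, hk]
  · rw [(passResult_vertices_silent (true, some i) _ _ (.inl rfl) _).1,
      (passResult_ddpEdges_silent (true, some i) _ _ (.inr (by simp [n₁])) _).1, hbar,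
      (passResult_vertices_silent (true, some i) _ _ (.inl rfl) _).1,
      (passResult_netEdges i _ _ n₄ _).1]
    simp [passWord, partEdges]

/-! ### The machine -/

/-- The passes, in the order of their results. -/
def passes : List Pass :=
  (false, none) :: (extEdges.map fun i => (false, some i)) ++
    (true, none) :: extEdges.map fun i => (true, some i)

/-- The pass with a given number. -/
def passAt (j : ℕ) : Pass := passes.getD j (false, none)

theorem flatMap_passAt {α : Type*} (f : Pass → List α) :
    (List.range 18).flatMap (fun j => f (passAt j)) = passes.flatMap f := rfl

theorem passes_flatMap (c : InputCode) :
    passes.flatMap (passWord c) = (buildCode c).word := by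
  change _ = verticesWord (buildCode c).inner ++ (buildCode c).edges.flatMap EdgeCode.word
  simp only [passes, buildCode, passWord, extEdges, List.flatMap_append, List.flatMap_cons,
    List.flatMap_nil, List.map, verticesWord_append, List.append_assoc, List.append_nil,
    List.cons_append, List.nil_append]

/-- The stacks: the input, the annotated input, the output, and a unary counter that is moved
back and forth between two stacks. -/
inductive Stk
  | inp | ann | out | cnt | cnt'

instance : Finite Stk :=
  Finite.of_injective (β := Fin 5) (fun
    | .inp => 0 | .ann => 1 | .out => 2 | .cnt => 3 | .cnt' => 4) (by
    intro a b h
    cases a <;> cases b <;> simp_all)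

instance : Fintype Stk := Fintype.ofFinite _

instance : DecidableEq Stk := Classical.decEq _

/-- The letters on the stacks. -/
@[reducible]
def Stk.Alphabet : Stk → Type
  | .inp => Letter
  | .ann => Letter × ScanState
  | .out => Letter
  | .cnt => Unit
  | .cnt' => Unit

/-- The labels of the program. -/
inductive Lbl
  | count
  | uncount
  | scan (j : Fin 18) (q : ScanState)
  | back (j : Fin 18) (b : Bool)
  | begin (j : Fin 18) (x : Letter) (q : ScanState) (b : Bool)
  | zeros (j : Fin 18) (x : Letter) (q : ScanState) (b : Bool)
  | restore (j : Fin 18) (x : Letter) (q : ScanState) (b : Bool)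
  | write (j : Fin 18) (x : Letter) (q : ScanState) (b : Bool)
  | clear
  | clearCount

instance : Finite Lbl :=
  Finite.of_injective (β := Fin 10 × Fin 18 × Letter × ScanState × Bool) (fun
    | .count => (0, 0, .sep, .start, true)
    | .uncount => (1, 0, .sep, .start, true)
    | .scan j q => (2, j, .sep, q, true)
    | .back j b => (3, j, .sep, .start, b)
    | .begin j x q b => (4, j, x, q, b)
    | .zeros j x q b => (5, j, x, q, b)
    | .restore j x q b => (6, j, x, q, b)
    | .write j x q b => (7, j, x, q, b)
    | .clear => (8, 0, .sep, .start, true)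
    | .clearCount => (9, 0, .sep, .start, true)) (by
    intro a b h
    cases a <;> cases b <;> simp_all)

/-- The internal state is the last letter that was read. -/
abbrev Reg : Type := Option (Letter × ScanState)

instance : Fintype Reg := Fintype.ofFinite _

instance : Fintype Lbl := Fintype.ofFinite _

/-- Statements of the machine. -/
abbrev Prog : Type := Turing.TM2.Stmt Stk.Alphabet Lbl Reg

open Turing.TM2.Stmt

/-- Write a word on the output. -/
def pushOut : List Letter → Prog → Prog
  | [], p => p
  | x :: w, p => pushOut w (push .out (fun _ => x) p)

/-- The letter in the internal state. -/
def Reg.get (v : Reg) : Letter × ScanState := v.getD (.sep, .start)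

/-- The label after all letters have been treated in the pass `j`. -/
def afterPass (j : Fin 18) : Lbl :=
  -- A stack grows at its front, so the passes run in decreasing order, and each reads its input
  -- from the end.
  if j.1 = 0 then .clear else .scan ⟨j.1 - 1, by omega⟩ .start

/-- The program. -/
def program : Lbl → Prog
  | .count => pop .inp (fun _ x => x.map (·, .start)) <| branch Option.isSome
      (push .ann Reg.get <| push .cnt (fun _ => ()) <| goto fun _ => .count)
      (goto fun _ => .uncount)
  | .uncount => pop .ann (fun _ x => x) <| branch Option.isSome
      (push .inp (fun v => v.get.1) <| goto fun _ => .uncount)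
      (goto fun _ => .scan 17 .start)
  | .scan j q => pop .inp (fun _ x => x.map (·, q)) <| branch Option.isSome
      (push .ann Reg.get <| goto fun v => .scan j (q.next v.get.1))
      (goto fun _ => .back j true)
  | .back j b => pop .ann (fun _ x => x) <| branch Option.isSome
      (goto fun v => .begin j v.get.1 v.get.2 (keepFlag b v.get.1 v.get.2))
      (goto fun _ => afterPass j)
  | .begin j x q b => if (replacement (passAt j) x q b).2 then
        -- The final digits of the denominator of `ε` are written first; the loop then puts one zero
        -- in front of them for each unit of the counter.
        pushOut [.bit false, .bit false, .bit true, .sep] <| goto fun _ => .zeros j x q b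
      else goto fun _ => .write j x q b
  | .zeros j x q b => pop .cnt (fun _ x => x.map fun _ => (.sep, .start)) <| branch Option.isSome
      (push .cnt' (fun _ => ()) <| push .out (fun _ => .bit false) <| goto fun _ => .zeros j x q b)
      (goto fun _ => .restore j x q b)
  | .restore j x q b => pop .cnt' (fun _ x => x.map fun _ => (.sep, .start)) <|
      branch Option.isSome (push .cnt (fun _ => ()) <| goto fun _ => .restore j x q b)
      (goto fun _ => .write j x q b)
  | .write j x q b => push .inp (fun _ => x) <| pushOut (replacement (passAt j) x q b).1 <|
      goto fun _ => .back j b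
  -- A halting configuration must have the initial internal state and no content on any stack except
  -- the output.
  | .clear => pop .inp (fun _ x => x.map (·, .start)) <| branch Option.isSome
      (goto fun _ => .clear) (goto fun _ => .clearCount)
  | .clearCount => pop .cnt (fun _ x => x.map fun _ => (.sep, .start)) <| branch Option.isSome
      (goto fun _ => .clearCount) (load (fun _ => none) halt)

/-- The machine. -/
def machine : Turing.FinTM2 where
  K := Stk
  k₀ := .inp
  k₁ := .out
  Γ := Stk.Alphabet
  Λ := Lbl
  main := .count
  σ := Reg
  initialState := none
  Γk₀Fin := inferInstanceAs (Fintype Letter)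
  m := program

/-- The contents of the stacks. -/
def mkStacks (a : List Letter) (l : List (Letter × ScanState)) (o : List Letter) (z z' : List Unit) :
    ∀ k, List (Stk.Alphabet k)
  | .inp => a
  | .ann => l
  | .out => o
  | .cnt => z
  | .cnt' => z'

section

variable (a a' : List Letter) (l l' : List (Letter × ScanState)) (o o' : List Letter)
  (z z' y : List Unit)

theorem update_inp : Function.update (mkStacks a l o z z') .inp a' = mkStacks a' l o z z' := by
  funext k
  cases k <;> simp [Function.update, mkStacks]

theorem update_ann : Function.update (mkStacks a l o z z') .ann l' = mkStacks a l' o z z' := by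
  funext k
  cases k <;> simp [Function.update, mkStacks]

theorem update_out : Function.update (mkStacks a l o z z') .out o' = mkStacks a l o' z z' := by
  funext k
  cases k <;> simp [Function.update, mkStacks]

theorem update_cnt : Function.update (mkStacks a l o z z') .cnt y = mkStacks a l o y z' := by
  funext k
  cases k <;> simp [Function.update, mkStacks]

theorem update_cnt' : Function.update (mkStacks a l o z z') .cnt' y = mkStacks a l o z y := by
  funext k
  cases k <;> simp [Function.update, mkStacks]

end

/-- Configurations. -/
abbrev Conf : Type := Turing.TM2.Cfg Stk.Alphabet Lbl Reg

/-- The step function. -/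
def stepM : Conf → Option Conf := Turing.TM2.step program

/-- The machine gets from `c` to `c'` in at most `n` steps. -/
def Runs (n : ℕ) (c c' : Conf) : Prop := ∃ m ≤ n, (flip bind stepM)^[m] (some c) = some c'

theorem Runs.trans {n n' : ℕ} {c c' c'' : Conf} (h : Runs n c c') (h' : Runs n' c' c'') :
    Runs (n + n') c c'' := by
  obtain ⟨m, hm, h⟩ := h
  obtain ⟨m', hm', h'⟩ := h'
  exact ⟨m' + m, by omega, by rw [Function.iterate_add_apply, h, h']⟩

theorem Runs.mono {n n' : ℕ} {c c' : Conf} (h : Runs n c c') (hn : n ≤ n') : Runs n' c c' := by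
  obtain ⟨m, hm, h⟩ := h
  exact ⟨m, hm.trans hn, h⟩

theorem Runs.step {c c' : Conf} (h : stepM c = some c') : Runs 1 c c' := ⟨1, le_rfl, h⟩

theorem Runs.head {n : ℕ} {c c' c'' : Conf} (h : stepM c = some c') (h' : Runs n c' c'') :
    Runs (n + 1) c c'' := by
  rw [add_comm]
  exact (Runs.step h).trans h'

theorem stepAux_pushOut (w : List Letter) (p : Prog) (v : Reg) (a : List Letter)
    (l : List (Letter × ScanState)) (o : List Letter) (z z' : List Unit) :
    Turing.TM2.stepAux (pushOut w p) v (mkStacks a l o z z') =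
      Turing.TM2.stepAux p v (mkStacks a l (w ++ o) z z') := by
  induction w generalizing p with
  | nil => rfl
  | cons x w ih =>
    rw [pushOut, ih, Turing.TM2.stepAux, update_out]
    rfl

theorem replicate_length_append {α β : Type*} (y : β) (z : List β) (x : α) (l : List α) :
    List.replicate (y :: z).length x ++ l = List.replicate z.length x ++ x :: l := by
  rw [List.length_cons, List.replicate_succ', List.append_assoc]
  rfl

/-- The input is moved aside in order to measure its length in unary. The annotations written here
are irrelevant, so only the letters are tracked. -/
theorem runs_count (a : List Letter) (v : Reg) (l : List (Letter × ScanState)) (z : List Unit) :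
    ∃ v' l', Runs (a.length + 1) ⟨some .count, v, mkStacks a l [] z []⟩
      ⟨some .uncount, v', mkStacks [] l' [] (List.replicate a.length () ++ z) []⟩ ∧
      l'.map Prod.fst = a.reverse ++ l.map Prod.fst := by
  induction a generalizing v l z with
  | nil =>
    refine ⟨none, l, Runs.step ?_, rfl⟩
    simp [stepM, Turing.TM2.step, program, mkStacks, update_inp]
  | cons x a ih =>
    obtain ⟨v', l', h, hl⟩ := ih (some (x, .start)) ((x, .start) :: l) (() :: z)
    refine ⟨v', l', Runs.head (c' := ⟨some .count, some (x, .start),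
      mkStacks a ((x, .start) :: l) [] (() :: z) []⟩) ?_ (by
        rwa [replicate_length_append]), by simpa using hl⟩
    simp [stepM, Turing.TM2.step, program, mkStacks, update_inp, update_ann, update_cnt, Reg.get]

theorem runs_uncount (l : List (Letter × ScanState)) (v : Reg) (a : List Letter) (z : List Unit) :
    ∃ v', Runs (l.length + 1) ⟨some .uncount, v, mkStacks a l [] z []⟩
      ⟨some (.scan 17 .start), v', mkStacks ((l.map Prod.fst).reverse ++ a) [] [] z []⟩ := by
  induction l generalizing v a with
  | nil =>
    refine ⟨none, Runs.step ?_⟩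
    simp [stepM, Turing.TM2.step, program, mkStacks, update_ann]
  | cons x l ih =>
    obtain ⟨v', h⟩ := ih (some x) (x.1 :: a)
    refine ⟨v', Runs.head (c' := ⟨some .uncount, some x, mkStacks (x.1 :: a) l [] z []⟩) ?_ (by
      simpa using h)⟩
    simp [stepM, Turing.TM2.step, program, mkStacks, update_inp, update_ann, Reg.get]

theorem runs_scan (j : Fin 18) (a : List Letter) (q : ScanState) (v : Reg)
    (l : List (Letter × ScanState)) (o : List Letter) (z : List Unit) :
    ∃ v', Runs (a.length + 1) ⟨some (.scan j q), v, mkStacks a l o z []⟩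
      ⟨some (.back j true), v', mkStacks [] ((annotate q a).reverse ++ l) o z []⟩ := by
  induction a generalizing v l q with
  | nil =>
    refine ⟨none, Runs.step ?_⟩
    simp [stepM, Turing.TM2.step, program, mkStacks, update_inp, annotate]
  | cons x a ih =>
    obtain ⟨v', h⟩ := ih (q.next x) (some (x, q)) ((x, q) :: l)
    refine ⟨v', Runs.head (c' := ⟨some (.scan j (q.next x)), some (x, q),
      mkStacks a ((x, q) :: l) o z []⟩) ?_ (by simpa [annotate] using h)⟩
    simp [stepM, Turing.TM2.step, program, mkStacks, update_inp, update_ann, Reg.get]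

theorem runs_zeros (j : Fin 18) (x : Letter) (q : ScanState) (b : Bool) (z z' : List Unit)
    (v : Reg) (a : List Letter) (l : List (Letter × ScanState)) (o : List Letter) :
    ∃ v', Runs (z.length + 1) ⟨some (.zeros j x q b), v, mkStacks a l o z z'⟩
      ⟨some (.restore j x q b), v', mkStacks a l (List.replicate z.length (.bit false) ++ o) []
        (List.replicate z.length () ++ z')⟩ := by
  induction z generalizing v z' o with
  | nil =>
    refine ⟨none, Runs.step ?_⟩
    simp [stepM, Turing.TM2.step, program, mkStacks, update_cnt]
  | cons y z ih =>
    obtain ⟨v', h⟩ := ih (() :: z') (some (.sep, .start)) (.bit false :: o)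
    refine ⟨v', Runs.head (c' := ⟨some (.zeros j x q b), some (.sep, .start),
      mkStacks a l (.bit false :: o) z (() :: z')⟩) ?_ (by
        rwa [replicate_length_append, replicate_length_append])⟩
    simp [stepM, Turing.TM2.step, program, mkStacks, update_cnt, update_cnt', update_out]

theorem runs_restore (j : Fin 18) (x : Letter) (q : ScanState) (b : Bool) (z' z : List Unit)
    (v : Reg) (a : List Letter) (l : List (Letter × ScanState)) (o : List Letter) :
    ∃ v', Runs (z'.length + 1) ⟨some (.restore j x q b), v, mkStacks a l o z z'⟩
      ⟨some (.write j x q b), v', mkStacks a l o (List.replicate z'.length () ++ z) []⟩ := by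
  induction z' generalizing v z with
  | nil =>
    refine ⟨none, Runs.step ?_⟩
    simp [stepM, Turing.TM2.step, program, mkStacks, update_cnt']
  | cons y z' ih =>
    obtain ⟨v', h⟩ := ih (() :: z) (some (.sep, .start))
    refine ⟨v', Runs.head (c' := ⟨some (.restore j x q b), some (.sep, .start),
      mkStacks a l o (() :: z) z'⟩) ?_ (by
        rwa [replicate_length_append])⟩
    simp [stepM, Turing.TM2.step, program, mkStacks, update_cnt, update_cnt']

theorem bitsWord_epsBits (k : ℕ) :
    bitsWord (epsBits k) =
      List.replicate k (.bit false) ++ [.bit false, .bit false, .bit true, .sep] := by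
  simp [bitsWord, epsBits]

/-- One step selects the branch, and moving the counter over and back takes `z.length + 1` steps
each; the counter is left intact for the next letter. -/
theorem runs_begin (j : Fin 18) (x : Letter) (q : ScanState) (b : Bool) (z : List Unit)
    (v : Reg) (a : List Letter) (l : List (Letter × ScanState)) (o : List Letter) :
    ∃ v', Runs (2 * z.length + 3) ⟨some (.begin j x q b), v, mkStacks a l o z []⟩
      ⟨some (.write j x q b), v', mkStacks a l
        ((if (replacement (passAt j) x q b).2 then bitsWord (epsBits z.length) else []) ++ o)
        z []⟩ := by
  by_cases h : (replacement (passAt j) x q b).2 = true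
  · obtain ⟨v₁, h₁⟩ := runs_zeros j x q b z [] v a l
      ([.bit false, .bit false, .bit true, .sep] ++ o)
    obtain ⟨v₂, h₂⟩ := runs_restore j x q b (List.replicate z.length () ++ []) [] v₁ a l
      (List.replicate z.length (.bit false) ++ ([.bit false, .bit false, .bit true, .sep] ++ o))
    rw [List.append_nil, List.length_replicate, List.append_nil] at h₂
    rw [List.append_nil] at h₁
    have hz : List.replicate z.length () = z := (List.eq_replicate_iff.2 ⟨rfl, fun _ _ => rfl⟩).symm
    rw [hz] at h₁ h₂
    refine ⟨v₂, ?_⟩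
    rw [if_pos h, bitsWord_epsBits, List.append_assoc]
    refine (Runs.head (c' := ⟨some (.zeros j x q b), v, mkStacks a l
      ([.bit false, .bit false, .bit true, .sep] ++ o) z []⟩) ?_ (h₁.trans h₂)).mono (by omega)
    simp only [stepM, Turing.TM2.step, program, if_pos h, stepAux_pushOut]
    rfl
  · refine ⟨v, (Runs.step ?_).mono (by omega)⟩
    simp only [stepM, Turing.TM2.step, program, if_neg h]
    rfl

theorem runs_letter (j : Fin 18) (x : Letter × ScanState) (b : Bool) (z : List Unit)
    (v : Reg) (a : List Letter) (l : List (Letter × ScanState)) (o : List Letter) :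
    ∃ v', Runs (2 * z.length + 5) ⟨some (.back j b), v, mkStacks a (x :: l) o z []⟩
      ⟨some (.back j (passStep z.length (passAt j) x (b, o)).1), v', mkStacks (x.1 :: a) l
        (passStep z.length (passAt j) x (b, o)).2 z []⟩ := by
  obtain ⟨v₁, h₁⟩ := runs_begin j x.1 x.2 (keepFlag b x.1 x.2) z (some x) a l o
  refine ⟨v₁, (Runs.head (c' := ⟨some (.begin j x.1 x.2 (keepFlag b x.1 x.2)), some x,
    mkStacks a l o z []⟩) ?_ (h₁.trans (Runs.step ?_))).mono
      (n := 2 * z.length + 3 + 1 + 1) (by omega)⟩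
  · simp [stepM, Turing.TM2.step, program, mkStacks, update_ann, Reg.get]
  · simp only [stepM, Turing.TM2.step, program, Turing.TM2.stepAux, mkStacks, update_inp,
      stepAux_pushOut]
    rfl

/-- The annotated letters come off the stack last letter first, as in the right fold `passResult`.
They are pushed back on the input, which is thereby restored for the next pass. -/
theorem runs_back (j : Fin 18) (l : List (Letter × ScanState)) (b : Bool) (z : List Unit)
    (v : Reg) (a : List Letter) (o : List Letter) :
    ∃ v', Runs (l.length * (2 * z.length + 5) + 1)
      ⟨some (.back j b), v, mkStacks a l.reverse o z []⟩
      ⟨some (afterPass j), v', mkStacks (l.map Prod.fst ++ a) []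
        (passResult z.length (passAt j) l (b, o)).2 z []⟩ := by
  induction l using List.reverseRecOn generalizing b v a o with
  | nil =>
    refine ⟨none, (Runs.step ?_).mono (by simp)⟩
    simp [stepM, Turing.TM2.step, program, mkStacks, update_ann, passResult]
  | append_singleton l x ih =>
    obtain ⟨v₁, h₁⟩ := runs_letter j x b z v a l.reverse o
    obtain ⟨v₂, h₂⟩ := ih (passStep z.length (passAt j) x (b, o)).1 v₁ (x.1 :: a)
      (passStep z.length (passAt j) x (b, o)).2
    refine ⟨v₂, Runs.mono (n := 2 * z.length + 5 + (l.length * (2 * z.length + 5) + 1)) ?_ (by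
      rw [List.length_append, List.length_singleton, add_mul]
      omega)⟩
    rw [List.reverse_concat, passResult_append, List.map_append, List.append_assoc]
    exact h₁.trans h₂

theorem length_annotate (q : ScanState) (w : List Letter) : (annotate q w).length = w.length := by
  rw [← List.length_map (f := Prod.fst), annotate_map_fst]

theorem runs_pass (c : InputCode) (j : Fin 18) (v : Reg) (o : List Letter) (z : List Unit)
    (hz : z.length = c.word.length) :
    ∃ v', Runs (c.word.length * (2 * c.word.length + 6) + 2)
      ⟨some (.scan j .start), v, mkStacks c.word [] o z []⟩
      ⟨some (afterPass j), v', mkStacks c.word [] (passWord c (passAt j) ++ o) z []⟩ := by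
  obtain ⟨v₁, h₁⟩ := runs_scan j c.word .start v [] o z
  obtain ⟨v₂, h₂⟩ := runs_back j (annotate .start c.word) true z v₁ [] o
  rw [hz, passResult_input, annotate_map_fst, List.append_nil, length_annotate] at h₂
  rw [List.append_nil] at h₁
  exact ⟨v₂, (h₁.trans h₂).mono (by rw [mul_add, mul_add]; omega)⟩

theorem runs_passes (c : InputCode) (j : ℕ) (hj : j < 18) (v : Reg) (o : List Letter)
    (z : List Unit) (hz : z.length = c.word.length) :
    ∃ v', Runs ((j + 1) * (c.word.length * (2 * c.word.length + 6) + 2))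
      ⟨some (.scan ⟨j, hj⟩ .start), v, mkStacks c.word [] o z []⟩
      ⟨some .clear, v', mkStacks c.word []
        ((List.range (j + 1)).flatMap (fun i => passWord c (passAt i)) ++ o) z []⟩ := by
  induction j generalizing v o with
  | zero =>
    obtain ⟨v₁, h₁⟩ := runs_pass c ⟨0, hj⟩ v o z hz
    exact ⟨v₁, by simpa [afterPass] using h₁⟩
  | succ j ih =>
    obtain ⟨v₁, h₁⟩ := runs_pass c ⟨j + 1, hj⟩ v o z hz
    obtain ⟨v₂, h₂⟩ := ih (by omega) v₁ (passWord c (passAt (j + 1)) ++ o)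
    refine ⟨v₂, ?_⟩
    rw [List.range_succ, List.flatMap_append, List.append_assoc, add_mul _ 1, one_mul, add_comm]
    exact h₁.trans (by simpa [afterPass] using h₂)

theorem runs_clear (a : List Letter) (v : Reg) (o : List Letter) (z : List Unit) :
    ∃ v', Runs (a.length + 1) ⟨some .clear, v, mkStacks a [] o z []⟩
      ⟨some .clearCount, v', mkStacks [] [] o z []⟩ := by
  induction a generalizing v with
  | nil =>
    refine ⟨none, Runs.step ?_⟩
    simp [stepM, Turing.TM2.step, program, mkStacks, update_inp]
  | cons x a ih =>
    obtain ⟨v', h⟩ := ih (some (x, .start))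
    refine ⟨v', Runs.head (c' := ⟨some .clear, some (x, .start), mkStacks a [] o z []⟩) ?_ h⟩
    simp [stepM, Turing.TM2.step, program, mkStacks, update_inp]

theorem runs_clearCount (z : List Unit) (v : Reg) (o : List Letter) :
    Runs (z.length + 1) ⟨some .clearCount, v, mkStacks [] [] o z []⟩
      ⟨none, none, mkStacks [] [] o [] []⟩ := by
  induction z generalizing v with
  | nil =>
    refine Runs.step ?_
    simp [stepM, Turing.TM2.step, program, mkStacks, update_cnt]
  | cons y z ih =>
    refine Runs.head (c' := ⟨some .clearCount, some (.sep, .start), mkStacks [] [] o z []⟩) ?_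
      (ih _)
    simp [stepM, Turing.TM2.step, program, mkStacks, update_cnt]

/-- A bound on the running time of the machine. -/
def timeBound : Polynomial ℕ :=
  -- The 18 passes, and four loops of `X + 1` steps each: measuring, restoring and clearing the
  -- input, and clearing the counter.
  18 * (Polynomial.X * (2 * Polynomial.X + 6) + 2) + 4 * Polynomial.X + 4

theorem runs_machine (c : InputCode) :
    Runs (timeBound.eval c.word.length) ⟨some .count, none, mkStacks c.word [] [] [] []⟩
      ⟨none, none, mkStacks [] [] (buildCode c).word [] []⟩ := by
  obtain ⟨v₁, l, h₁, hl⟩ := runs_count c.word none [] []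
  obtain ⟨v₂, h₂⟩ := runs_uncount l v₁ [] (List.replicate c.word.length () ++ [])
  obtain ⟨v₃, h₃⟩ := runs_passes c 17 (by omega) v₂ [] (List.replicate c.word.length () ++ [])
    (by simp)
  obtain ⟨v₄, h₄⟩ := runs_clear c.word v₃ (buildCode c).word (List.replicate c.word.length () ++ [])
  have h₅ := runs_clearCount (List.replicate c.word.length () ++ []) v₄ (buildCode c).word
  rw [flatMap_passAt, passes_flatMap, List.append_nil] at h₃
  have hlen : l.length = c.word.length := by
    rw [← List.length_map (f := Prod.fst), hl]
    simp
  rw [hl, hlen] at h₂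
  simp only [List.map_nil, List.append_nil, List.reverse_reverse] at h₁ h₂ h₃ h₄ h₅
  refine (h₁.trans (h₂.trans (h₃.trans (h₄.trans h₅)))).mono ?_
  simp [timeBound]
  omega

theorem computable_buildCode :
    Nonempty (Turing.TM2ComputableInPolyTime InputCode.word NetCode.word buildCode) := by
  have hstart (w : List Letter) :
      Turing.initList machine w = ⟨some .count, none, mkStacks w [] [] [] []⟩ := by
    unfold Turing.initList
    congr 1
    funext k
    cases k <;> first
      | exact dif_pos rfl
      | exact dif_neg (fun h => by cases h)
  have hhalt (w : List Letter) :
      Turing.haltList machine w = ⟨none, none, mkStacks [] [] w [] []⟩ := by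
    unfold Turing.haltList
    congr 1
    funext k
    cases k <;> first
      | exact dif_pos rfl
      | exact dif_neg (fun h => by cases h)
  refine ⟨⟨⟨machine, Equiv.refl _, Equiv.refl _⟩, timeBound, fun c => ?_⟩⟩
  refine Classical.choice ?_
  obtain ⟨m, hm, h⟩ := runs_machine c
  refine ⟨⟨⟨m, ?_⟩, hm⟩⟩
  -- The stack alphabets are those of the words themselves, so the translation of letters is the
  -- identity.
  have hs := (congrArg (Turing.initList machine)
    (List.map_id c.word : List.map (id : Letter → Letter) _ = _)).trans (hstart _)
  have hh := (congrArg (Turing.haltList machine)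
    (List.map_id (buildCode c).word : List.map (id : Letter → Letter) _ = _)).trans (hhalt _)
  exact (congrArg (fun x => (flip bind stepM)^[m] (some x)) hs).trans
    (h.trans (congrArg some hh).symm)

/-! ### The size of the latencies -/

theorem bitsVal_cons (b : Bool) (w : List Bool) : bitsVal (b :: w) = b.toNat + 2 * bitsVal w :=
  rfl

theorem bitsVal_lt (w : List Bool) : bitsVal w < 2 ^ w.length := by
  induction w with
  | nil => simp [bitsVal]
  | cons b w ih =>
    rw [bitsVal_cons, List.length_cons, pow_succ]
    have := b.toNat_le
    omega

theorem bitsVal_epsBits (k : ℕ) : bitsVal (epsBits k) = 2 ^ (k + 2) := by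
  induction k with
  | zero => rfl
  | succ k ih =>
    rw [show epsBits (k + 1) = false :: epsBits k from rfl, bitsVal_cons, ih]
    simp [pow_succ]
    ring

/-- Halving a latency doubles its denominator, that is, puts a zero in front of digits written with
the least significant one first. -/
theorem bitsVal_scaleBits (i : ExtEdge) (w : List Bool) :
    (bitsVal (scaleBits i ++ w) : ℝ≥0) = bitsVal w / i.scale := by
  cases i <;> simp [scaleBits, ExtEdge.scale, bitsVal_cons, mul_comm]

/-- A number is below `2` to its number of digits, and the word of an edge is longer than its
denominator. Lengths add while powers multiply, which dominates the sum. -/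
theorem sum_den_lt (l : List EdgeCode) :
    (l.map fun d => bitsVal d.den).sum < 2 ^ (l.flatMap EdgeCode.word).length := by
  induction l with
  | nil => simp
  | cons d l ih =>
    have h : d.den.length + 1 ≤ d.word.length := by
      simp [EdgeCode.word, bitsWord]
      omega
    have h' := Nat.pow_le_pow_right (n := 2) (by norm_num) h
    have hd := bitsVal_lt d.den
    rw [pow_succ] at h'
    rw [List.map_cons, List.sum_cons, List.flatMap_cons, List.length_append, pow_add]
    have hp := Nat.one_le_two_pow (n := d.den.length)
    calc _ < 2 ^ d.den.length + 2 ^ (l.flatMap EdgeCode.word).length := by omega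
      _ ≤ 2 ^ d.den.length * 2 * 2 ^ (l.flatMap EdgeCode.word).length := by
        nlinarith [Nat.one_le_two_pow (n := (l.flatMap EdgeCode.word).length)]
      _ ≤ _ := Nat.mul_le_mul_right _ h'

/-- Every path has at least one edge, so each unit of flow is counted at least once. -/
theorem LinNetwork.rate_le_sum_load {W F : Type*} {N : LinNetwork W F} (hst : N.s ≠ N.t)
    {H : Set F} {r : ℝ≥0} {f : List F →₀ ℝ≥0} (hf : N.IsFlow H r f) {es : List F}
    (hes : ∀ e, e ∈ es) : r ≤ (es.map (load f)).sum := by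
  classical
  have h : (es.map (load f)).sum =
      ∑ p ∈ f.support, (es.map fun e => if e ∈ p then f p else 0).sum := by
    clear hes
    induction es with
    | nil => simp
    | cons e es ih =>
      simp only [List.map_cons, List.sum_cons, Finset.sum_add_distrib, ih]
      rfl
  rw [h, ← hf.2]
  refine Finset.sum_le_sum fun p hp => ?_
  obtain ⟨e, p', hp'⟩ := List.exists_cons_of_ne_nil ((hf.1 p hp).ne_nil N hst)
  refine le_trans (le_of_eq ?_) (List.single_le_sum (by simp) _
    (List.mem_map_of_mem (f := fun e => if e ∈ p then f p else 0) (hes e)))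
  simp [hp']

section

variable {V E W F K : Type*} {I : DDP V E} {N : LinNetwork W F} {copies : K → DCopy I N}
  {γ₁ γ₂ : ℝ≥0}

/-- In an optimal unit flow, of cost `1 / γ₁`, an edge with coefficient `num / den` carries at most
`den / (num * γ₁) ≤ den / γ₁`, and these loads add up to at least 1. -/
theorem IsGapInstance.gamma_le_sum_den (hG : IsGapInstance I N copies γ₁ γ₂) {c : NetCode}
    (hc : c.Represents N) : γ₁ ≤ (c.edges.map fun d => bitsVal d.den).sum := by
  obtain ⟨name, -, es, -, hes, h2⟩ := hc
  obtain ⟨⟨f, hf, hcost⟩, -⟩ := hG.opt 1 one_pos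
  have hγ : 0 < γ₁ := hG.pos.trans hG.lt
  have hle := LinNetwork.rate_le_sum_load hG.s_ne_t hf hes
  have key : γ₁ * (es.map (LinNetwork.load f)).sum ≤
      ((c.edges.map fun d => bitsVal d.den).sum : ℕ) := by
    clear hle hes
    generalize c.edges = l at h2 ⊢
    induction h2 with
    | nil => simp
    | @cons d e l es hd _ ih =>
      rw [List.map_cons, List.map_cons, List.sum_cons, List.sum_cons, mul_add, Nat.cast_add]
      refine add_le_add ?_ ih
      obtain ⟨-, -, hden, hcoef⟩ := hd
      have h1 := N.coef_mul_load_le_cost f e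
      have h3 := N.coef_pos e
      rw [hcost, hcoef, le_div_iff₀ hγ, div_mul_eq_mul_div, div_mul_eq_mul_div,
        div_le_one (by positivity)] at h1
      rw [hcoef] at h3
      have hnum : (1 : ℝ≥0) ≤ bitsVal d.num := by
        rw [Nat.one_le_cast, Nat.one_le_iff_ne_zero]
        intro h0
        simp [h0] at h3
      calc γ₁ * LinNetwork.load f e ≤ bitsVal d.num * (γ₁ * LinNetwork.load f e) :=
            le_mul_of_one_le_left zero_le hnum
        _ ≤ _ := by linarith
  calc γ₁ = γ₁ * 1 := (mul_one _).symm
    _ ≤ _ := (mul_le_mul_right hle _).trans key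

/-- The number `γ₁` is not part of the input, but it is below `2 ^ c.word.length`; the two extra
digits provide the factor 4. -/
theorem IsGapInstance.epsilon_lt (hG : IsGapInstance I N copies γ₁ γ₂) {c : InputCode}
    (hc : c.net.Represents N) : (1 : ℝ≥0) / 2 ^ (c.word.length + 2) < 1 / (4 * γ₁) := by
  have hγ : 0 < γ₁ := hG.pos.trans hG.lt
  refine one_div_lt_one_div_of_lt (by positivity) ?_
  have h1 := hG.gamma_le_sum_den hc
  have h2 := sum_den_lt c.net.edges
  have h3 : (c.net.edges.flatMap EdgeCode.word).length ≤ c.word.length := by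
    change _ ≤ (c.ddp.word ++ Letter.bar :: (verticesWord c.net.inner ++
      c.net.edges.flatMap EdgeCode.word)).length
    simp only [List.length_append, List.length_cons]
    omega
  have h4 : ((c.net.edges.map fun d => bitsVal d.den).sum : ℝ≥0) < 2 ^ c.word.length := by
    exact_mod_cast h2.trans_le (Nat.pow_le_pow_right (by norm_num) h3)
  rw [pow_add, mul_comm]
  norm_num
  exact h1.trans_lt h4

end

/-! ### The names of the vertices -/

theorem partName_base_injective : Function.Injective (partName none) := by
  have key (a : NameTag) (w : List Bool) (ha : a ≠ .base) : a.bits ≠ w ++ NameTag.base.bits :=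
    fun h => ha (NameTag.append_bits_inj (w := []) h).2
  have h (a : Terminal) (w : List Bool) : baseTermName a ≠ .inner (w ++ NameTag.base.bits) := by
    cases a <;> simp [baseTermName, key]
  rintro (a | w) (b | w') hab
  · cases a <;> cases b <;> simp_all [partName, partTermName, baseTermName, NameTag.bits]
  · exact absurd hab (h a w')
  · exact absurd hab.symm (h b w)
  · simp only [partName, VName.inner.injEq] at hab
    rw [(NameTag.append_bits_inj hab).1]

section

variable {V E W F : Type*} {I : DDP V E} {N : LinNetwork W F} {nameD : V → VName}
  {nameN : W → VName} {lD lN : List (List Bool)}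

/-- The names of the vertices of the amplified network. -/
def ampName (N : LinNetwork W F) (nameD : V → VName) (nameN : W → VName) :
    AmpVertex V N.Inner → VName
  | .s => .term .s
  | .t => .term .t
  | .u => .inner (NameTag.bits .u)
  | .v => .inner (NameTag.bits .v)
  | .base x => partName none (nameD x)
  | .inner i y => partName (some i) (nameN y.1)

/-- The ends of an edgework are shared with other parts of the network. Renaming them inside the
edgework must give the name of the shared vertex, which is what `tailName` and `headName` provide.
-/
theorem ampName_glue (hst : N.s ≠ N.t)
    (hD : IsNaming nameD lD [(I.s₁, .s₁), (I.s₂, .s₂), (I.t₁, .t₁), (I.t₂, .t₂)])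
    (hN : IsNaming nameN lN [(N.s, .s), (N.t, .t)]) (i : ExtEdge) (x : W) :
    ampName N nameD nameN (glue I N i x) = partName (some i) (nameN x) := by
  have h1 : nameD I.s₁ = .term .s₁ := (hD.2.2.2 _ _).2 (by simp)
  have h2 : nameD I.s₂ = .term .s₂ := (hD.2.2.2 _ _).2 (by simp)
  have h3 : nameD I.t₁ = .term .t₁ := (hD.2.2.2 _ _).2 (by simp)
  have h4 : nameD I.t₂ = .term .t₂ := (hD.2.2.2 _ _).2 (by simp)
  have hs : nameN N.s = .term .s := (hN.2.2.2 _ _).2 (by simp)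
  have ht : nameN N.t = .term .t := (hN.2.2.2 _ _).2 (by simp)
  obtain rfl | rfl | ⟨y, rfl⟩ := vertex_cases N x
  · rw [glue_s, hs]
    cases i <;> simp [ExtEdge.tail, ampName, partName, partTermName, tailName, h3, h4]
  · rw [glue_t I N hst, ht]
    cases i <;> simp [ExtEdge.head, ampName, partName, partTermName, headName, h1, h2]
  · rw [glue_inner]
    rfl

theorem exists_inner_of_naming
    (hN : IsNaming nameN lN [(N.s, .s), (N.t, .t)]) (y : N.Inner) :
    ∃ w ∈ lN, nameN y.1 = .inner w := by
  cases h : nameN y.1 with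
  | inner w => exact ⟨w, (hN.2.2.1 w).2 ⟨_, h⟩, rfl⟩
  | term a =>
    have := (hN.2.2.2 _ _).1 h
    simp [y.2.1, y.2.2] at this

/-- The name of a vertex of `D` in the amplified network. -/
theorem partName_base_cases
    (hD : IsNaming nameD lD [(I.s₁, .s₁), (I.s₂, .s₂), (I.t₁, .t₁), (I.t₂, .t₂)]) (x : V) :
    ∃ w a, partName none (nameD x) = .inner (w ++ NameTag.bits a) ∧
      (w ++ a.bits ∈ cornerNames ∨ w ∈ lD ∧ a = .base) ∧ a ≠ .u ∧ a ≠ .v ∧ ∀ i, a ≠ .work i := by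
  cases h : nameD x with
  | inner w => exact ⟨w, .base, rfl, .inr ⟨(hD.2.2.1 w).2 ⟨x, h⟩, rfl⟩, by simp⟩
  | term a =>
    have := (hD.2.2.2 _ _).1 h
    simp only [List.mem_cons, Prod.mk.injEq, List.not_mem_nil, or_false] at this
    obtain ⟨-, rfl⟩ | ⟨-, rfl⟩ | ⟨-, rfl⟩ | ⟨-, rfl⟩ := this
    · exact ⟨[], .s₁, rfl, .inl (by simp [cornerNames]), by simp⟩
    · exact ⟨[], .s₂, rfl, .inl (by simp [cornerNames]), by simp⟩
    · exact ⟨[], .t₁, rfl, .inl (by simp [cornerNames]), by simp⟩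
    · exact ⟨[], .t₂, rfl, .inl (by simp [cornerNames]), by simp⟩

/-- The last four digits of a bit-string name reveal the kind of the vertex, and what precedes them
is the old name. -/
theorem ampName_injective
    (hD : IsNaming nameD lD [(I.s₁, .s₁), (I.s₂, .s₂), (I.t₁, .t₁), (I.t₂, .t₂)])
    (hN : IsNaming nameN lN [(N.s, .s), (N.t, .t)]) :
    Function.Injective (ampName N nameD nameN) := by
  have hs : ampName N nameD nameN (.s : AmpVertex V N.Inner) = .term .s := rfl
  have ht : ampName N nameD nameN (.t : AmpVertex V N.Inner) = .term .t := rfl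
  have hu : ampName N nameD nameN (.u : AmpVertex V N.Inner) = .inner ([] ++ NameTag.bits .u) := rfl
  have hv : ampName N nameD nameN (.v : AmpVertex V N.Inner) = .inner ([] ++ NameTag.bits .v) := rfl
  have hb (x : V) : ∃ w a, ampName N nameD nameN (.base x) = .inner (w ++ NameTag.bits a) ∧
      a ≠ .u ∧ a ≠ .v ∧ ∀ i, a ≠ .work i := by
    obtain ⟨w, a, h, -, h'⟩ := partName_base_cases hD x
    exact ⟨w, a, h, h'⟩
  have hi (i : ExtEdge) (y : N.Inner) : ∃ w, nameN y.1 = .inner w ∧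
      ampName N nameD nameN (.inner i y) = .inner (w ++ NameTag.bits (.work i)) := by
    obtain ⟨w, -, h⟩ := exists_inner_of_naming hN y
    exact ⟨w, h, by rw [ampName, h]; rfl⟩
  choose wb ab hb hbu hbv hbw using hb
  choose wi hi' hi using hi
  intro a b h
  rcases a with _ | _ | _ | _ | x | ⟨i, y⟩ <;> rcases b with _ | _ | _ | _ | x' | ⟨i', y'⟩
  case base.base => rw [hD.1 (partName_base_injective h)]
  case inner.inner =>
    rw [hi, hi, VName.inner.injEq] at h
    obtain ⟨h1, h2⟩ := NameTag.append_bits_inj h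
    cases h2
    rw [Subtype.ext (hN.1 ((hi' i y).trans (h1 ▸ (hi' i y').symm)))]
  all_goals
    first
    | rfl
    | (simp only [hs, ht, hu, hv, hb, hi, VName.inner.injEq, VName.term.injEq, reduceCtorEq] at h
       done)
    | (simp only [hu, hv, hb, hi, VName.inner.injEq] at h
       have h' := (NameTag.append_bits_inj h).2
       first
       | cases h'
       | exact absurd h' (hbu _)
       | exact absurd h'.symm (hbu _)
       | exact absurd h' (hbv _)
       | exact absurd h'.symm (hbv _)
       | exact absurd h' (hbw _ _)
       | exact absurd h'.symm (hbw _ _))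

theorem mem_cornerNames {w : List Bool} :
    w ∈ cornerNames ↔ ∃ a : NameTag, a.bits = w ∧ a ≠ .base ∧ ∀ i, a ≠ .work i := by
  constructor
  · intro h
    simp only [cornerNames, List.mem_cons, List.not_mem_nil, or_false] at h
    rcases h with rfl | rfl | rfl | rfl | rfl | rfl <;> exact ⟨_, rfl, by simp⟩
  · rintro ⟨a, rfl, h, h'⟩
    cases a <;> simp_all [cornerNames]

theorem nodup_buildCode_inner {c : InputCode} (hD : c.ddp.inner.Nodup) (hN : c.net.inner.Nodup) :
    (buildCode c).inner.Nodup := by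
  have hinj (a : NameTag) : Function.Injective fun w : List Bool => w ++ a.bits :=
    fun _ _ h => List.append_cancel_right h
  refine List.Nodup.append (List.Nodup.append (hD.map (hinj _)) ?_ ?_)
    (List.nodup_flatMap.2 ⟨fun i _ => hN.map (hinj _), ?_⟩) ?_
  · simp [cornerNames, NameTag.bits]
  · intro w h h'
    obtain ⟨w', -, rfl⟩ := List.mem_map.1 h
    obtain ⟨a, h1, h2, -⟩ := mem_cornerNames.1 h'
    exact h2 (NameTag.append_bits_inj (w := []) h1).2
  · have : extEdges.Nodup := by simp [extEdges]
    refine this.imp fun {i j} hij => ?_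
    intro w h h'
    obtain ⟨w', -, rfl⟩ := List.mem_map.1 h
    obtain ⟨w'', -, h'⟩ := List.mem_map.1 h'
    exact hij (NameTag.work.inj (NameTag.append_bits_inj h').2).symm
  · intro w h h'
    obtain ⟨i, -, h'⟩ := List.mem_flatMap.1 h'
    obtain ⟨w', -, rfl⟩ := List.mem_map.1 h'
    rcases List.mem_append.1 h with h | h
    · obtain ⟨w'', -, h⟩ := List.mem_map.1 h
      exact absurd (NameTag.append_bits_inj h).2 (by simp [partTag])
    · obtain ⟨a, h1, -, h2⟩ := mem_cornerNames.1 h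
      exact h2 i (NameTag.append_bits_inj (w := []) h1).2

theorem mem_buildCode_inner {c : InputCode} {w : List Bool} :
    w ∈ (buildCode c).inner ↔ (∃ w' ∈ c.ddp.inner, w' ++ NameTag.base.bits = w) ∨
      w ∈ cornerNames ∨ ∃ i, ∃ w' ∈ c.net.inner, w' ++ (NameTag.work i).bits = w := by
  have (i : ExtEdge) : i ∈ extEdges := by cases i <;> simp [extEdges]
  simp [buildCode, partInner, partTag, this]

theorem isNaming_ampName {c : InputCode}
    (hD : IsNaming nameD c.ddp.inner [(I.s₁, .s₁), (I.s₂, .s₂), (I.t₁, .t₁), (I.t₂, .t₂)])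
    (hN : IsNaming nameN c.net.inner [(N.s, .s), (N.t, .t)]) :
    IsNaming (ampName N nameD nameN) (buildCode c).inner [(.s, .s), (.t, .t)] := by
  have h1 : nameD I.s₁ = .term .s₁ := (hD.2.2.2 _ _).2 (by simp)
  have h2 : nameD I.s₂ = .term .s₂ := (hD.2.2.2 _ _).2 (by simp)
  have h3 : nameD I.t₁ = .term .t₁ := (hD.2.2.2 _ _).2 (by simp)
  have h4 : nameD I.t₂ = .term .t₂ := (hD.2.2.2 _ _).2 (by simp)
  have hs : nameN N.s = .term .s := (hN.2.2.2 _ _).2 (by simp)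
  have ht : nameN N.t = .term .t := (hN.2.2.2 _ _).2 (by simp)
  refine ⟨ampName_injective hD hN, nodup_buildCode_inner hD.2.1 hN.2.1, fun w => ?_,
    fun x a => ?_⟩
  · rw [mem_buildCode_inner]
    constructor
    · rintro (⟨w', hw, rfl⟩ | hw | ⟨i, w', hw, rfl⟩)
      · obtain ⟨x, hx⟩ := (hD.2.2.1 w').1 hw
        exact ⟨.base x, by rw [ampName, hx]; rfl⟩
      · simp only [cornerNames, List.mem_cons, List.not_mem_nil, or_false] at hw
        rcases hw with rfl | rfl | rfl | rfl | rfl | rfl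
        · exact ⟨.u, rfl⟩
        · exact ⟨.v, rfl⟩
        · exact ⟨.base I.s₁, by rw [ampName, h1]; rfl⟩
        · exact ⟨.base I.s₂, by rw [ampName, h2]; rfl⟩
        · exact ⟨.base I.t₁, by rw [ampName, h3]; rfl⟩
        · exact ⟨.base I.t₂, by rw [ampName, h4]; rfl⟩
      · obtain ⟨x, hx⟩ := (hN.2.2.1 w').1 hw
        refine ⟨.inner i ⟨x, ?_, ?_⟩, by rw [ampName, hx]; rfl⟩
        · rintro rfl
          simp [hs] at hx
        · rintro rfl
          simp [ht] at hx
    · rintro ⟨x, hx⟩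
      rcases x with _ | _ | _ | _ | x | ⟨i, y⟩
      · cases hx
      · cases hx
      · cases hx
        exact .inr (.inl (by simp [cornerNames]))
      · cases hx
        exact .inr (.inl (by simp [cornerNames]))
      · obtain ⟨w', a, h, h' | ⟨h', rfl⟩, -⟩ := partName_base_cases hD x
        · cases h.symm.trans hx
          exact .inr (.inl h')
        · cases h.symm.trans hx
          exact .inl ⟨w', h', rfl⟩
      · obtain ⟨w', hw, h⟩ := exists_inner_of_naming hN y
        rw [ampName, h] at hx
        cases hx
        exact .inr (.inr ⟨i, w', hw, rfl⟩)
  · rcases x with _ | _ | _ | _ | x | ⟨i, y⟩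
    · simp [ampName, eq_comm]
    · simp [ampName, eq_comm]
    · simp [ampName]
    · simp [ampName]
    · obtain ⟨w', a, h, -⟩ := partName_base_cases hD x
      simp [ampName, h]
    · obtain ⟨w', hw, h⟩ := exists_inner_of_naming hN y
      simp [ampName, h, partName]

/-! ### The edges -/

theorem forall₂_flatMap {α β γ : Type*} {R : β → γ → Prop} {f : α → List β} {g : α → List γ}
    (h : ∀ a, List.Forall₂ R (f a) (g a)) (l : List α) :
    List.Forall₂ R (l.flatMap f) (l.flatMap g) := by
  induction l with
  | nil => exact .nil
  | cons a l ih => exact List.rel_append (h a) ih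

theorem isT_iff (hN : IsNaming nameN lN [(N.s, .s), (N.t, .t)]) (x : W) :
    (nameN x).isT = true ↔ x = N.t := by
  have h := hN.2.2.2 x .t
  simp only [List.mem_cons, Prod.mk.injEq, List.not_mem_nil, reduceCtorEq] at h
  rw [VName.isT.eq_def]
  split <;> simp_all

theorem isS_iff (hN : IsNaming nameN lN [(N.s, .s), (N.t, .t)]) (x : W) :
    (nameN x).isS = true ↔ x = N.s := by
  have h := hN.2.2.2 x .s
  simp only [List.mem_cons, Prod.mk.injEq, List.not_mem_nil, reduceCtorEq] at h
  rw [VName.isS.eq_def]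
  split <;> simp_all

/-- The edges of the amplified network. -/
def ampEdges (N : LinNetwork W F) (esD : List E) (esN : List F) : List (AmpEdge E N.Kept) :=
  esD.map .base ++ [.e₂] ++ extEdges.flatMap fun i => esN.filterMap (toWork N E i)

theorem mem_ampEdges {esD : List E} {esN : List F} (hD : ∀ e, e ∈ esD) (hN : ∀ e, e ∈ esN)
    (e : AmpEdge E N.Kept) : e ∈ ampEdges N esD esN := by
  simp only [ampEdges, List.mem_append, List.mem_map, List.mem_flatMap, List.mem_filterMap,
    List.mem_singleton, toWork_eq_some]
  rcases e with _ | e | ⟨i, f⟩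
  · simp
  · exact .inl (.inl ⟨e, hD e, rfl⟩)
  · exact .inr ⟨i, by cases i <;> simp [extEdges], f.1, hN _, f.2, rfl⟩

theorem nodup_ampEdges {esD : List E} {esN : List F} (hD : esD.Nodup) (hN : esN.Nodup) :
    (ampEdges N esD esN).Nodup := by
  unfold ampEdges
  refine List.Nodup.append (List.Nodup.append (hD.map fun _ _ h => by simpa using h)
    (List.nodup_singleton _) ?_) (List.nodup_flatMap.2 ⟨fun i _ => hN.filterMap ?_, ?_⟩) ?_
  · simp
  · intro f f' e h h'
    obtain ⟨hf, rfl⟩ := toWork_eq_some.1 h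
    obtain ⟨hf', h'⟩ := toWork_eq_some.1 h'
    simp_all
  · have : extEdges.Nodup := by simp [extEdges]
    refine this.imp fun {i j} hij => ?_
    intro e h h'
    simp only [List.mem_filterMap, toWork_eq_some] at h h'
    obtain ⟨_, _, _, rfl⟩ := h
    obtain ⟨_, _, _, h'⟩ := h'
    exact hij (AmpEdge.work.inj h').1
  · intro e h h'
    simp only [List.mem_flatMap, List.mem_filterMap, toWork_eq_some] at h'
    obtain ⟨_, _, _, _, _, rfl⟩ := h'
    simp at h

/-- `ampEdges` lists the edges in the order in which the code writes them, so the codes match edge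
by edge. In an edgework both lists are filtered, by the same condition read off names or off
vertices. -/
theorem buildCode_represents {c : InputCode} (hst : N.s ≠ N.t) (hcD : c.ddp.Represents I)
    (hcN : c.net.Represents N) (hε : (0 : ℝ≥0) < 1 / 2 ^ (c.word.length + 2)) :
    (buildCode c).Represents (amplify I N (1 / 2 ^ (c.word.length + 2)) hε) := by
  obtain ⟨nameD, hD, esD, hDn, hDm, hDe⟩ := hcD
  obtain ⟨nameN, hN, esN, hNn, hNm, hNe⟩ := hcN
  have heps : bitsVal (epsBits c.word.length) ≠ 0 := by
    rw [bitsVal_epsBits]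
    positivity
  have heps' : (1 : ℝ≥0) / 2 ^ (c.word.length + 2) =
      (bitsVal [true] : ℝ≥0) / (bitsVal (epsBits c.word.length) : ℝ≥0) := by
    rw [bitsVal_epsBits]
    simp [bitsVal]
  refine ⟨ampName N nameD nameN, isNaming_ampName hD hN, ampEdges N esD esN,
    nodup_ampEdges hDn hNn, mem_ampEdges hDm hNm, ?_⟩
  refine List.rel_append (List.rel_append ?_ ?_) (forall₂_flatMap (fun i => ?_) _)
  · rw [hDe, List.map_map, List.forall₂_map_left_iff, List.forall₂_map_right_iff,
      List.forall₂_same]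
    exact fun e _ => ⟨rfl, rfl, heps, heps'⟩
  · exact .cons ⟨rfl, rfl, heps, heps'⟩ .nil
  · change List.Forall₂ _ (c.net.edges.filterMap (workEdge i)) _
    clear hNn hNm
    generalize c.net.edges = l at hNe ⊢
    induction hNe with
    | nil => exact .nil
    | @cons d e l es hd _ ih =>
      obtain ⟨hsrc, htgt, hden, hcoef⟩ := hd
      have hiff : (!d.src.isT && !d.tgt.isS) = true ↔ N.Useful e := by
        rw [hsrc, htgt, Bool.and_eq_true, Bool.not_eq_true', Bool.not_eq_true',
          ← Bool.not_eq_true, ← Bool.not_eq_true, isT_iff hN, isS_iff hN, and_comm]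
        rfl
      by_cases hu : N.Useful e
      · rw [List.filterMap_cons_some (f := workEdge i) (if_pos (hiff.2 hu)),
          List.filterMap_cons_some (f := toWork N E i) (dif_pos hu)]
        refine .cons ⟨?_, ?_, ?_, ?_⟩ ih
        · exact (congrArg _ hsrc).trans (ampName_glue hst hD hN i _).symm
        · exact (congrArg _ htgt).trans (ampName_glue hst hD hN i _).symm
        · have h : (bitsVal (scaleBits i ++ d.den) : ℝ≥0) ≠ 0 := by
            rw [bitsVal_scaleBits]
            exact div_ne_zero (by exact_mod_cast hden) i.scale_pos.ne'
          exact_mod_cast h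
        · change i.scale * N.coef e = _
          rw [hcoef, bitsVal_scaleBits, div_div_eq_mul_div]
          ring
      · rwa [List.filterMap_cons_none (f := workEdge i) (if_neg (mt hiff.1 hu)),
          List.filterMap_cons_none (f := toWork N E i) (dif_neg hu)]

end

end

theorem lemmal :
    ∃ build : InputCode → NetCode,
      Nonempty (Turing.TM2ComputableInPolyTime InputCode.word NetCode.word build) ∧
      ∀ (V E W F K : Type) [Finite V] [Finite E] [Finite W] [Finite F]
        (I : DDP V E) (N : LinNetwork W F) (copies : K → DCopy I N) (γ₁ γ₂ : ℝ≥0),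
        I.HasCrossingPaths → IsGapInstance I N copies γ₁ γ₂ →
        (∀ (ε : ℝ≥0) (hε : 0 < ε), ε < 1 / (4 * γ₁) →
          IsGapInstance I (amplify I N ε hε) (amplifyCopies copies ε hε) (4 * γ₁) (3 * γ₂)) ∧
        ∀ c : InputCode, c.ddp.Represents I → c.net.Represents N →
          ∃ (ε : ℝ≥0) (hε : 0 < ε), ε < 1 / (4 * γ₁) ∧
            (build c).Represents (amplify I N ε hε) := by
  refine ⟨buildCode, computable_buildCode, ?_⟩
  intro V E W F K _ _ _ _ I N copies γ₁ γ₂ hI hG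
  exact ⟨amplify_isGapInstance hI hG, fun c hcD hcN =>
    ⟨_, by positivity, hG.epsilon_lt hcN, buildCode_represents hG.s_ne_t hcD hcN _⟩⟩
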